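/- **Setting.** Let $d\ge 1$, let $(\boldsymbol a,b)\sim\mathcal D$ with $\boldsymbol a\in\mathbb R^d$, let $F(\boldsymbol x)=\mathbb E\,\ell(\boldsymbol a^\top\boldsymbol x,b)$ (assumed finite for every $\boldsymbol x$) with minimizer $\boldsymbol x^*$, and let $\ell',\ell''$ denote derivatives of $\ell$ in its first argument. Assume: 1. $\ell(\cdot,b)$ is twice differentiable and $\mu_\ell\le\ell''\le L_\ell$ with $\mu_\ell,L_\ell>0$; put $\alpha=L_\ell/\mu_\ell$. 2. $\boldsymbol\Sigma=\mathbb E\boldsymbol a\boldsymbol a^\top$ is finite and positive definite; put $\mu=\lambda_{\min}(\boldsymbol\Sigma)$, $\kappa(\boldsymbol\Sigma)=\lambda_{\max}(\boldsymbol\Sigma)/\lambda_{\min}(\boldsymbol\Sigma)$ and $\boldsymbol H=L_\ell\boldsymbol\Sigma$. 3. $\mathbb E\|\boldsymbol a\|^4<\infty$, $\mathbb E(\|\boldsymbol a\|^2\boldsymbol a\boldsymbol a^\top)\preceq R^2\boldsymbol\Sigma$ and $\mathbb E(\|\boldsymbol a\|_{\boldsymbol\Sigma^{-1}}^2\boldsymbol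 a\boldsymbol a^\top)\preceq\tilde\kappa\boldsymbol\Sigma$. Let $\boldsymbol Q=\mathbb E\,\ell'(\boldsymbol a^\top\boldsymbol x^*,b)^2\boldsymbol a\boldsymbol a^\top$, assumed finite. **Algorithm (SADA).** Start from $\tilde{\boldsymbol x}_{-1}=\tilde{\boldsymbol x}_0$. For $k=1,\dots,K$ put $\tilde{\boldsymbol y}_{k-1}=\tilde{\boldsymbol x}_{k-1}+\beta_k(\tilde{\boldsymbol x}_{k-1}-\tilde{\boldsymbol x}_{k-2})$ and $\boldsymbol x_0=\boldsymbol z_0=\tilde{\boldsymbol y}_{k-1}$; for $t=1,\dots,T$ draw a fresh sample $(\boldsymbol a_t,b_t)\sim\mathcal D$ and put $$\boldsymbol y_{t-1}=\tfrac{1}{1+\theta}\boldsymbol x_{t-1}+\tfrac{\theta}{1+\theta}\boldsymbol z_{t-1},\qquad \hat{\boldsymbol g}_t=h_k\ell'(\boldsymbol a_t^\top\tilde{\boldsymbol y}_{k-1},b_t)\boldsymbol a_t+[\boldsymbol a_t^\top(\boldsymbol y_{t-1}-\tilde{\boldsymbol y}_{k-1})]\boldsymbol a_t,$$ $$\boldsymbol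 x_t=\boldsymbol y_{t-1}-\eta\hat{\boldsymbol g}_t,\qquad \boldsymbol z_t=\theta\boldsymbol y_{t-1}+(1-\theta)\boldsymbol z_{t-1}-\gamma\hat{\boldsymbol g}_t;$$ finally $\tilde{\boldsymbol x}_k=\frac2T\sum_{t=T/2+1}^T\boldsymbol x_t$. Here $K\ge1$, $T\ge 2$ is even, and $n=KT$. **Hyperparameters.** $0<\eta\le\frac1{16R^2}$, $\gamma=\frac14\sqrt{\eta/(\tilde\kappa\mu)}$, $\theta=\frac14\sqrt{\mu\eta/\tilde\kappa}$, $h_k=2\alpha\tilde\theta_k^2/L_\ell$, $\beta_k=(1-\tilde\theta_k)/(1+\tilde\theta_k)$, with $\tilde\theta_k=\tilde\theta_{\max}$ for $k\le K/2$ and $\tilde\theta_k=\dfrac{4}{4/\tilde\theta_{\max}+k-K/2}$ for $k>K/2$. **Theorem.** There are universal constants $c_2,C_T>0$ such that for every $c_1>0$ there are $c_0,C>0$, depending only on $c_1$, for which the following holds in the above setting whenever $$T\ge C_T\sqrt{\frac{\tilde\kappa}{\mu\eta}}\;\ln\frac{4\kappa(\boldsymbol\Sigma)}{\tilde\theta_K^2}.$$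 (a) If $c_1m\le\tilde\theta_{\max}\le c_2m$ with $m=\min\{\frac1{\sqrt\alpha},\frac{T}{\alpha^2\tilde\kappa}\}$, then $F(\tilde{\boldsymbol x}_K)$ is integrable and $$\mathbb EF(\tilde{\boldsymbol x}_K)-F(\boldsymbol x^*)\le C\Big[\exp\Big(-\frac{c_0K}{\sqrt\alpha+\alpha^2\tilde\kappa/T}\Big)\big(F(\tilde{\boldsymbol x}_0)-F(\boldsymbol x^*)\big)+\frac{\alpha\operatorname{tr}(\boldsymbol H^{-1}\boldsymbol Q)}{n}+\frac{\alpha\eta\tilde\kappa\operatorname{tr}\boldsymbol Q}{L_\ell n}\Big].$$ (b) Suppose $B,L>0$ satisfy, for all $\boldsymbol x$, $$\mathbb E(\ell'(\boldsymbol a^\top\boldsymbol x,b)-\ell'(\boldsymbol a^\top\boldsymbol x^*,b))^2\|\boldsymbol a\|^2\le2L_\ell B(F(\boldsymbol x)-F(\boldsymbol x^*)),$$ $$\mathbb E(\ell'(\boldsymbol a^\top\boldsymbol x,b)-\ell'(\boldsymbol a^\top\boldsymbol x^*,b))^2\|\boldsymbol a\|_{\boldsymbol\Sigma^{-1}}^2\le2L_\ell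 L(F(\boldsymbol x)-F(\boldsymbol x^*)),$$ and put $L_{\rm eff}=160(6L+\tilde\kappa(7+16\eta B))$. If $c_1m\le\tilde\theta_{\max}\le c_2m$ with $m=\min\{\frac1{\sqrt\alpha},\frac{T}{\alpha L_{\rm eff}}\}$, then $F(\tilde{\boldsymbol x}_K)$ is integrable and $$\mathbb EF(\tilde{\boldsymbol x}_K)-F(\boldsymbol x^*)\le\frac53\exp\Big(-\frac{c_0K}{\sqrt\alpha+\alpha L_{\rm eff}/T}\Big)\big(F(\tilde{\boldsymbol x}_0)-F(\boldsymbol x^*)\big)+\frac{46080\,\alpha\operatorname{tr}(\boldsymbol H^{-1}\boldsymbol Q)}{n}+\frac{122880\,\alpha\eta\tilde\kappa\operatorname{tr}\boldsymbol Q}{L_\ell n}.$$ -/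

import Mathlib

open MeasureTheory ProbabilityTheory Matrix

universe u v

noncomputable section

namespace SADA

/-- Euclidean space `ℝ^d`; a data point is a pair `(a, b)` with feature `a : Vec d` and a label `b`
in an arbitrary measurable space `Y`. -/
abbrev Vec (d : ℕ) := EuclideanSpace ℝ (Fin d)

variable {d : ℕ} {Y : Type u}

/-! ### The objective and the problem-dependent quantities -/

/-- First derivative of the loss with respect to its first argument. -/
def lossDeriv (ℓ : ℝ → Y → ℝ) (s : ℝ) (b : Y) : ℝ := deriv (fun r => ℓ r b) s

/-- Second derivative of the loss with respect to its first argument. -/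
def lossDeriv2 (ℓ : ℝ → Y → ℝ) (s : ℝ) (b : Y) : ℝ := deriv (fun r => lossDeriv ℓ r b) s

/-- The population risk `F x = 𝔼 ℓ(aᵀx, b)`. -/
def risk [MeasurableSpace Y] (D : Measure (Vec d × Y)) (ℓ : ℝ → Y → ℝ) (x : Vec d) : ℝ :=
  ∫ p, ℓ (inner ℝ p.1 x) p.2 ∂D

/-- The matrix `𝔼 w(a, b) a aᵀ`. -/
def weightedMoment [MeasurableSpace Y] (D : Measure (Vec d × Y)) (w : Vec d × Y → ℝ) :
    Matrix (Fin d) (Fin d) ℝ :=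
  Matrix.of fun i j => ∫ p, w p * (p.1 i * p.1 j) ∂D

/-- The second-moment matrix `Σ = 𝔼 a aᵀ`. -/
def covMat [MeasurableSpace Y] (D : Measure (Vec d × Y)) : Matrix (Fin d) (Fin d) ℝ :=
  weightedMoment D fun _ => 1

/-- The squared norm `‖x‖²_A = xᵀ A x`. -/
def sqNorm (A : Matrix (Fin d) (Fin d) ℝ) (x : Vec d) : ℝ := x.ofLp ⬝ᵥ (A *ᵥ x.ofLp)

/-- The gradient second-moment matrix `Q = 𝔼 (ℓ'(aᵀx⋆, b))² a aᵀ`. -/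
def gradMoment [MeasurableSpace Y] (D : Measure (Vec d × Y)) (ℓ : ℝ → Y → ℝ) (xs : Vec d) :
    Matrix (Fin d) (Fin d) ℝ :=
  weightedMoment D fun p => (lossDeriv ℓ (inner ℝ p.1 xs) p.2) ^ 2

/-- Least eigenvalue of a symmetric matrix. -/
def lamMin (A : Matrix (Fin d) (Fin d) ℝ) : ℝ := sInf (spectrum ℝ A)

/-- Largest eigenvalue of a symmetric matrix. -/
def lamMax (A : Matrix (Fin d) (Fin d) ℝ) : ℝ := sSup (spectrum ℝ A)

/-- Condition number `λ_max / λ_min`. -/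
def condNumber (A : Matrix (Fin d) (Fin d) ℝ) : ℝ := lamMax A / lamMin A

/-! ### Assumptions -/

/-- The loss is twice differentiable in its first argument, with second derivative in
`[μℓ, Lℓ]`. -/
structure LossCondition (ℓ : ℝ → Y → ℝ) (Lℓ μℓ : ℝ) : Prop where
  mu_pos : 0 < μℓ
  L_pos : 0 < Lℓ
  diff : ∀ b, Differentiable ℝ fun s => ℓ s b
  diff2 : ∀ b, Differentiable ℝ fun s => lossDeriv ℓ s b
  lower : ∀ s b, μℓ ≤ lossDeriv2 ℓ s b
  upper : ∀ s b, lossDeriv2 ℓ s b ≤ Lℓ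

/-- `Σ` is finite and positive definite. -/
structure SecondMomentCondition [MeasurableSpace Y] (D : Measure (Vec d × Y)) : Prop where
  integrable : Integrable (fun p => ‖p.1‖ ^ 2) D
  posDef : (covMat D).PosDef

/-- `𝔼 ‖a‖² a aᵀ ⪯ R² Σ` and `𝔼 ‖a‖²_{Σ⁻¹} a aᵀ ⪯ κ̃ Σ` (the moments being finite). -/
structure FourthMomentCondition [MeasurableSpace Y] (D : Measure (Vec d × Y)) (R κt : ℝ) :
    Prop where
  integrable : Integrable (fun p => ‖p.1‖ ^ 4) D
  bound : (R ^ 2 • covMat D - weightedMoment D fun p => ‖p.1‖ ^ 2).PosSemidef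
  boundInv : (κt • covMat D - weightedMoment D fun p => sqNorm (covMat D)⁻¹ p.1).PosSemidef

/-- The `2`-norm bound on the gradient noise, with constant `B`. -/
def GradNoise2 [MeasurableSpace Y] (D : Measure (Vec d × Y)) (ℓ : ℝ → Y → ℝ) (xs : Vec d)
    (Lℓ B : ℝ) : Prop :=
  ∀ x, ∫ p, (lossDeriv ℓ (inner ℝ p.1 x) p.2 - lossDeriv ℓ (inner ℝ p.1 xs) p.2) ^ 2
      * ‖p.1‖ ^ 2 ∂D ≤ 2 * Lℓ * B * (risk D ℓ x - risk D ℓ xs)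

/-- The `Σ⁻¹`-norm bound on the gradient noise, with constant `L`. -/
def GradNoiseInv [MeasurableSpace Y] (D : Measure (Vec d × Y)) (ℓ : ℝ → Y → ℝ) (xs : Vec d)
    (Lℓ L : ℝ) : Prop :=
  ∀ x, ∫ p, (lossDeriv ℓ (inner ℝ p.1 x) p.2 - lossDeriv ℓ (inner ℝ p.1 xs) p.2) ^ 2
      * sqNorm (covMat D)⁻¹ p.1 ∂D ≤ 2 * Lℓ * L * (risk D ℓ x - risk D ℓ xs)

/-! ### The algorithm -/

/-- One inner update of the pair `(x, z)` with the data point `p`, at outer step size `h` and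
extrapolated point `yt`. -/
def innerStep (ℓ : ℝ → Y → ℝ) (η γ θ h : ℝ) (yt : Vec d) (p : Vec d × Y)
    (s : Vec d × Vec d) : Vec d × Vec d :=
  let y := (1 / (1 + θ)) • s.1 + (θ / (1 + θ)) • s.2
  let g := (h * lossDeriv ℓ (inner ℝ p.1 yt) p.2) • p.1 + (inner ℝ p.1 (y - yt)) • p.1
  (y - η • g, θ • y + (1 - θ) • s.2 - γ • g)

/-- The inner iterates `(x_t, z_t)`; `data t` is the sample used in step `t ≥ 1`. -/
def innerIter (ℓ : ℝ → Y → ℝ) (η γ θ h : ℝ) (yt : Vec d) (data : ℕ → Vec d × Y) :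
    ℕ → Vec d × Vec d
  | 0 => (yt, yt)
  | t + 1 => innerStep ℓ η γ θ h yt (data (t + 1)) (innerIter ℓ η γ θ h yt data t)

/-- The tail average `(2 / T) ∑_{t = T/2 + 1}^T x_t` (used for even `T`). -/
def innerOutput (ℓ : ℝ → Y → ℝ) (η γ θ h : ℝ) (T : ℕ) (yt : Vec d) (data : ℕ → Vec d × Y) :
    Vec d :=
  (2 / (T : ℝ)) • ∑ t ∈ Finset.Icc (T / 2 + 1) T, (innerIter ℓ η γ θ h yt data t).1

/-- The pair of the `k`-th and the `(k-1)`-st outer iterates (both equal to the initial point for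
`k = 0`); `data k t` is the sample used in inner step `t ≥ 1` of outer iteration `k ≥ 1`. -/
def outerIter (ℓ : ℝ → Y → ℝ) (η γ θ : ℝ) (h β : ℕ → ℝ) (T : ℕ) (x0 : Vec d)
    (data : ℕ → ℕ → Vec d × Y) : ℕ → Vec d × Vec d
  | 0 => (x0, x0)
  | k + 1 =>
    let s := outerIter ℓ η γ θ h β T x0 data k
    let yt := s.1 + β (k + 1) • (s.1 - s.2)
    (innerOutput ℓ η γ θ (h (k + 1)) T yt (data (k + 1)), s.1)

/-! ### Hyperparameters -/

/-- `γ = (1/4) √(η / (κ̃ μ))`. -/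
def gammaParam (η κt μ : ℝ) : ℝ := 1 / 4 * Real.sqrt (η / (κt * μ))

/-- `θ = (1/4) √(μ η / κ̃)`. -/
def thetaParam (η κt μ : ℝ) : ℝ := 1 / 4 * Real.sqrt (μ * η / κt)

/-- The two-phase schedule `θ̃_k`. -/
def thetaSched (θmax : ℝ) (K k : ℕ) : ℝ :=
  if (k : ℝ) ≤ (K : ℝ) / 2 then θmax else 4 / (4 / θmax + (k : ℝ) - (K : ℝ) / 2)

/-- `h_k = 2 α θ̃_k² / Lℓ`. -/
def stepSched (α Lℓ θmax : ℝ) (K k : ℕ) : ℝ := 2 * α * thetaSched θmax K k ^ 2 / Lℓ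

/-- `β_k = (1 - θ̃_k) / (1 + θ̃_k)`. -/
def momentumSched (θmax : ℝ) (K k : ℕ) : ℝ :=
  (1 - thetaSched θmax K k) / (1 + thetaSched θmax K k)

/-- `L_eff = 160 (6 L + κ̃ (7 + 16 η B))`. -/
def effNoise (L B κt η : ℝ) : ℝ := 160 * (6 * L + κt * (7 + 16 * η * B))

/-- The output after `K` outer iterations, with all hyperparameters as prescribed. -/
def output [MeasurableSpace Y] (D : Measure (Vec d × Y)) (ℓ : ℝ → Y → ℝ) (Lℓ μℓ κt η θmax : ℝ)
    (K T : ℕ) (x0 : Vec d) (data : ℕ → ℕ → Vec d × Y) : Vec d :=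
  (outerIter ℓ η (gammaParam η κt (lamMin (covMat D))) (thetaParam η κt (lamMin (covMat D)))
    (stepSched (Lℓ / μℓ) Lℓ θmax K) (momentumSched θmax K) T x0 data K).1

/-- The lower bound on the inner-loop length, with explicit logarithmic factor. -/
def InnerLong [MeasurableSpace Y] (CT : ℝ) (D : Measure (Vec d × Y)) (κt η θmax : ℝ)
    (K T : ℕ) : Prop :=
  CT * Real.sqrt (κt / (lamMin (covMat D) * η))
    * Real.log (4 * condNumber (covMat D) / thetaSched θmax K K ^ 2) ≤ (T : ℝ)

end SADA

end

/-!
Each outer iteration is an inexact step of Nesterov's method. In the norm of `H = Lℓ Σ` the risk is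
`1`-smooth and `1 / α`-strongly convex, and the inner loop approximates the preconditioned gradient
step `ỹ - h Σ⁻¹ ∇F(ỹ)`.

*Inner loop.* In coordinates centred at the exact step the inner iteration is an accelerated
stochastic approximation scheme for the linear equation `Σ x = 0`, driven by an unbiased oracle with
multiplicative and additive noise (`Problem.oracle_innerOracle`, `innerOutput_eq`). The potential
`‖x‖² + μ ‖z‖²_{Σ⁻¹}` contracts by `1 - θ` per step up to the noise level (`pot_step`). The sum
`x_t + z_t` moves along the stochastic gradients, so the gradients telescope over the tail, and the
tail average is `Σ⁻¹` applied to a sum of martingale differences plus boundary terms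
(`form_accOutput_le`). This gives a variance of order `1 / T` (`accOutput_moment`). The mean of the
tail average follows the noiseless iteration and is therefore exponentially small in `T`
(`form_integral_accOutput_le`); the logarithm in the lower bound on `T` makes this bias negligible.

*Outer loop.* For a fixed pair of outer iterates, the Lyapunov function
`F(x) - F(x⋆) + (μℓ / 4) ‖v - x⋆‖²_Σ`, where `v` is the auxiliary point of Nesterov's method, contracts
by `1 - 0.3 θ̃_k` in expectation, up to additive noise of order `α θ̃_k² / T`
(`Problem.outer_step`). The variance proportional to the gap, the bias, and the change of the momentum
parameter are all absorbed by strong convexity and by the gradient term (`lyap_scalar`,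
`momentum_change_le`). Since every outer iteration uses fresh samples, the bound for a fixed pair
integrates along the trajectory (`integral_le_of_indepFun`). The recursion then yields the
exponential rate from the phase with constant momentum, while the slow decay of `θ̃_k` in the second
phase turns the accumulated noise into `O(α θ̃_K / T) = O(α / (K T))` (`recursion_bound`).

The bound in terms of the fourth moments is the special case `B = α R²`, `L = α κ̃` of the bound in
terms of the noise constants (`Problem.noise_sub_le`).
-/


set_option linter.unusedSectionVars false

noncomputable section

namespace SADA

/-! ### Quadratic forms of an inverse pair of operators -/

section Forms

variable {E : Type*} [NormedAddCommGroup E] [InnerProductSpace ℝ E]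

/-- The bilinear form `⟨A x, y⟩` of an operator `A`. -/
def form (A : E →L[ℝ] E) (x y : E) : ℝ := inner ℝ (A x) y

variable (A : E →L[ℝ] E)

lemma form_add_left (x y z : E) : form A (x + y) z = form A x z + form A y z := by
  simp [form, inner_add_left]

lemma form_add_right (x y z : E) : form A x (y + z) = form A x y + form A x z := by
  simp [form, inner_add_right]

lemma form_sub_left (x y z : E) : form A (x - y) z = form A x z - form A y z := by
  simp [form, inner_sub_left]

lemma form_sub_right (x y z : E) : form A x (y - z) = form A x y - form A x z := by
  simp [form, inner_sub_right]

lemma form_smul_left (c : ℝ) (x y : E) : form A (c • x) y = c * form A x y := by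
  simp [form, real_inner_smul_left]

lemma form_smul_right (c : ℝ) (x y : E) : form A x (c • y) = c * form A x y := by
  simp [form, real_inner_smul_right]

lemma form_smul_smul (c : ℝ) (x : E) : form A (c • x) (c • x) = c ^ 2 * form A x x := by
  rw [form_smul_left, form_smul_right]; ring

@[fun_prop]
lemma continuous_form_self : Continuous fun x : E => form A x x := by
  unfold form; fun_prop

lemma abs_form_self_le (x : E) : |form A x x| ≤ ‖A‖ * ‖x‖ ^ 2 := by
  refine (abs_real_inner_le_norm _ _).trans ?_
  calc ‖A x‖ * ‖x‖ ≤ ‖A‖ * ‖x‖ * ‖x‖ := by gcongr; exact A.le_opNorm x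
    _ = ‖A‖ * ‖x‖ ^ 2 := by ring

/-- A positive definite operator `S` and its inverse `T`, with the spectrum of `S` contained in
`[mu, lam]`. -/
structure InversePair (S T : E →L[ℝ] E) (mu lam : ℝ) : Prop where
  mu_pos : 0 < mu
  symm : ∀ x y, form S x y = form S y x
  left_inv : ∀ x, T (S x) = x
  right_inv : ∀ x, S (T x) = x
  lower : ∀ x, mu * ‖x‖ ^ 2 ≤ form S x x
  upper : ∀ x, form S x x ≤ lam * ‖x‖ ^ 2

namespace InversePair

variable {S T : E →L[ℝ] E} {mu lam : ℝ} (h : InversePair S T mu lam)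
include h

lemma nonneg (x : E) : 0 ≤ form S x x :=
  (mul_nonneg h.mu_pos.le (sq_nonneg _)).trans (h.lower x)

lemma form_inv_apply (x y : E) : form T (S x) y = inner ℝ x y := by
  rw [form, h.left_inv]

lemma form_apply_inv (x y : E) : form S (T x) y = inner ℝ x y := by
  rw [form, h.right_inv]

lemma inv_symm (x y : E) : form T x y = form T y x := by
  have := h.symm (T x) (T y)
  rw [h.form_apply_inv, h.form_apply_inv, real_inner_comm, real_inner_comm (T x)] at this
  exact this.symm

lemma form_inv_apply_right (x y : E) : form T x (S y) = inner ℝ x y := by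
  rw [h.inv_symm, h.form_inv_apply, real_inner_comm]

lemma inv_self (x : E) : form T x x = form S (T x) (T x) := by
  rw [h.form_apply_inv, form, real_inner_comm]

lemma inv_nonneg (x : E) : 0 ≤ form T x x := by
  rw [h.inv_self]; exact h.nonneg _

/-- Cauchy–Schwarz between the dual norms of `S` and `T`. -/
lemma inner_sq_le (x y : E) : inner ℝ x y ^ 2 ≤ form T x x * form S y y := by
  have h1 : ∀ t : ℝ, 0 ≤ form S y y * (t * t) + 2 * inner ℝ x y * t + form T x x := by
    intro t
    have h2 := h.nonneg (T x + t • y)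
    simp only [form_add_left, form_add_right, form_smul_left, form_smul_right,
      h.form_apply_inv] at h2
    rw [h.symm y (T x), h.form_apply_inv, real_inner_comm] at h2
    have h3 : form T x x = inner ℝ (T x) x := rfl
    rw [h3]; linarith
  have h4 := discrim_le_zero h1
  unfold discrim at h4
  linarith

lemma form_sq_le (x y : E) : form S x y ^ 2 ≤ form S x x * form S y y := by
  have h1 := h.inner_sq_le (S x) y
  rw [h.form_inv_apply, real_inner_comm (S x) x] at h1
  exact h1

lemma mu_mul_inv_le (x : E) : mu * form T x x ≤ ‖x‖ ^ 2 := by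
  have h1 := h.lower (T x)
  rw [← h.inv_self] at h1
  have h2 : form T x x ≤ ‖T x‖ * ‖x‖ := real_inner_le_norm _ _
  have h3 := sq_nonneg (mu * ‖T x‖ - ‖x‖)
  nlinarith [h.mu_pos]

lemma norm_sq_le_inv (hl : 0 ≤ lam) (x : E) : ‖x‖ ^ 2 ≤ lam * form T x x := by
  have h1 := h.form_sq_le (T x) x
  rw [h.form_apply_inv, ← h.inv_self, real_inner_self_eq_norm_sq] at h1
  have h2 := mul_le_mul_of_nonneg_left (h.upper x) (h.inv_nonneg x)
  by_contra! hc
  have h4 : 0 < ‖x‖ ^ 2 := lt_of_le_of_lt (mul_nonneg hl (h.inv_nonneg x)) hc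
  nlinarith

lemma form_le_inv (hl : 0 ≤ lam) (x : E) : form S x x ≤ lam ^ 2 * form T x x := by
  calc _ ≤ _ := h.upper x
    _ ≤ lam * (lam * form T x x) := by gcongr; exact h.norm_sq_le_inv hl x
    _ = _ := by ring

lemma norm_apply_sq_le (hl : 0 ≤ lam) (x : E) : ‖S x‖ ^ 2 ≤ lam * form S x x := by
  have := h.norm_sq_le_inv hl (S x)
  rwa [h.form_inv_apply, real_inner_comm] at this

lemma inv_add_le (x y : E) :
    form T (x + y) (x + y) ≤ 2 * form T x x + 2 * form T y y := by
  have := h.inv_nonneg (x - y)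
  simp only [form_add_left, form_add_right, form_sub_left, form_sub_right] at *
  linarith

lemma inv_sub_le (x y : E) :
    form T (x - y) (x - y) ≤ 2 * form T x x + 2 * form T y y := by
  have := h.inv_nonneg (x + y)
  simp only [form_add_left, form_add_right, form_sub_left, form_sub_right] at *
  linarith

lemma form_sub_sub_le (x y z : E) :
    form S (x - y - z) (x - y - z) ≤ 3 * form S x x + 3 * form S y y + 3 * form S z z := by
  have h1 := h.nonneg (x + y)
  have h2 := h.nonneg (x + z)
  have h3 := h.nonneg (y - z)
  simp only [form_add_left, form_add_right, form_sub_left, form_sub_right] at *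
  linarith

end InversePair
end Forms

/-! ### The second-moment operator -/

section Covariance

variable {d : ℕ} {Y : Type u}

/-- The operator of a matrix on Euclidean space. -/
abbrev opOf (A : Matrix (Fin d) (Fin d) ℝ) : Vec d →L[ℝ] Vec d := toEuclideanCLM (𝕜 := ℝ) A

lemma form_opOf (A : Matrix (Fin d) (Fin d) ℝ) (x y : Vec d) :
    form (opOf A) x y = y.ofLp ⬝ᵥ (A *ᵥ x.ofLp) := by
  rw [form, real_inner_comm]; exact inner_toEuclideanCLM A y x

lemma form_opOf_self (A : Matrix (Fin d) (Fin d) ℝ) (x : Vec d) :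
    form (opOf A) x x = sqNorm A x := form_opOf A x x

lemma lamMin_mul_le {A : Matrix (Fin d) (Fin d) ℝ} (hA : A.IsHermitian) (x : Vec d) :
    lamMin A * ‖x‖ ^ 2 ≤ form (opOf A) x x := by
  have hfin : (spectrum ℝ A).Finite := by
    rw [hA.spectrum_real_eq_range_eigenvalues]; exact Set.finite_range _
  have hps : (A - algebraMap ℝ _ (lamMin A)).PosSemidef := by
    rw [posSemidef_iff_isHermitian_and_spectrum_nonneg]
    refine ⟨hA.sub (by simp [Matrix.algebraMap_eq_diagonal, IsHermitian]), fun r hr => ?_⟩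
    rw [← spectrum.sub_singleton_eq] at hr
    obtain ⟨s, hs, t, rfl, rfl⟩ := hr
    exact sub_nonneg.2 (csInf_le hfin.bddBelow hs)
  have := hps.dotProduct_mulVec_nonneg x.ofLp
  rw [sub_mulVec, dotProduct_sub, Algebra.algebraMap_eq_smul_one, smul_mulVec, one_mulVec,
    dotProduct_smul] at this
  rw [form_opOf, EuclideanSpace.real_norm_sq_eq]
  simp only [star_trivial, smul_eq_mul, dotProduct, ← pow_two] at this ⊢
  linarith

lemma le_lamMax_mul {A : Matrix (Fin d) (Fin d) ℝ} (hA : A.IsHermitian) (x : Vec d) :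
    form (opOf A) x x ≤ lamMax A * ‖x‖ ^ 2 := by
  have hfin : (spectrum ℝ A).Finite := by
    rw [hA.spectrum_real_eq_range_eigenvalues]; exact Set.finite_range _
  have hps : (algebraMap ℝ _ (lamMax A) - A).PosSemidef := by
    rw [posSemidef_iff_isHermitian_and_spectrum_nonneg]
    refine ⟨IsHermitian.sub (by simp [Matrix.algebraMap_eq_diagonal, IsHermitian]) hA,
      fun r hr => ?_⟩
    rw [← spectrum.singleton_sub_eq] at hr
    obtain ⟨t, rfl, s, hs, rfl⟩ := hr
    exact sub_nonneg.2 (le_csSup hfin.bddAbove hs)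
  have := hps.dotProduct_mulVec_nonneg x.ofLp
  rw [sub_mulVec, dotProduct_sub, Algebra.algebraMap_eq_smul_one, smul_mulVec, one_mulVec,
    dotProduct_smul] at this
  rw [form_opOf, EuclideanSpace.real_norm_sq_eq]
  simp only [star_trivial, smul_eq_mul, dotProduct, ← pow_two] at this ⊢
  linarith

lemma inversePair_of_posDef [NeZero d] {A : Matrix (Fin d) (Fin d) ℝ} (hA : A.PosDef) :
    InversePair (opOf A) (opOf A⁻¹) (lamMin A) (lamMax A) where
  mu_pos := by
    have hh := hA.isHermitian
    have : lamMin A ∈ spectrum ℝ A := by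
      have hs := hh.spectrum_real_eq_range_eigenvalues
      refine (Set.Nonempty.csInf_mem ?_ ?_)
      · rw [hs]; exact Set.range_nonempty _
      · rw [hs]; exact Set.finite_range _
    rw [hh.spectrum_real_eq_range_eigenvalues] at this
    obtain ⟨i, hi⟩ := this
    rw [← hi]; exact hA.eigenvalues_pos i
  symm x y := by
    rw [form_opOf, form_opOf, dotProduct_mulVec, ← mulVec_transpose, dotProduct_comm]
    have := hA.isHermitian.eq
    rw [conjTranspose_eq_transpose_of_trivial] at this
    rw [this]
  left_inv x := by
    rw [← ContinuousLinearMap.comp_apply, ← ContinuousLinearMap.mul_def, ← map_mul,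
      nonsing_inv_mul A ((isUnit_iff_isUnit_det A).1 hA.isUnit), map_one]; rfl
  right_inv x := by
    rw [← ContinuousLinearMap.comp_apply, ← ContinuousLinearMap.mul_def, ← map_mul,
      mul_nonsing_inv A ((isUnit_iff_isUnit_det A).1 hA.isUnit), map_one]; rfl
  lower := lamMin_mul_le hA.isHermitian
  upper := le_lamMax_mul hA.isHermitian

end Covariance

/-! ### Moments of the features -/

section Moments

variable {d : ℕ} {Y : Type u} [MeasurableSpace Y] {D : Measure (Vec d × Y)}

lemma integrable_mul_coord {w : Vec d × Y → ℝ} (hw : Measurable w)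
    (hi : Integrable (fun p => w p * ‖p.1‖ ^ 2) D) (i j : Fin d) :
    Integrable (fun p => w p * (p.1 i * p.1 j)) D := by
  refine hi.mono (by fun_prop) (.of_forall fun p => ?_)
  have h1 : |p.1 i| ≤ ‖p.1‖ := PiLp.norm_apply_le p.1 i
  have h2 : |p.1 j| ≤ ‖p.1‖ := PiLp.norm_apply_le p.1 j
  simp only [norm_mul, Real.norm_eq_abs, abs_norm, pow_two]
  gcongr

lemma form_weightedMoment {w : Vec d × Y → ℝ} (hw : Measurable w)
    (hi : Integrable (fun p => w p * ‖p.1‖ ^ 2) D) (x y : Vec d) :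
    form (opOf (weightedMoment D w)) x y
      = ∫ p, w p * (inner ℝ p.1 x * inner ℝ p.1 y) ∂D := by
  have h1 : ∀ p : Vec d × Y, w p * (inner ℝ p.1 x * inner ℝ p.1 y)
      = ∑ i, ∑ j, (w p * (p.1 i * p.1 j)) * (y i * x j) := by
    intro p
    simp only [PiLp.inner_apply, RCLike.inner_apply, conj_trivial]
    rw [mul_comm (∑ i, x i * p.1 i), Finset.sum_mul_sum, Finset.mul_sum]
    refine Finset.sum_congr rfl fun i _ => ?_
    rw [Finset.mul_sum]
    exact Finset.sum_congr rfl fun j _ => by ring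
  simp_rw [h1]
  rw [form_opOf, integral_finsetSum _ fun i _ => integrable_finsetSum _ fun j _ =>
    (integrable_mul_coord hw hi i j).mul_const _]
  simp only [dotProduct, mulVec, Finset.mul_sum]
  refine Finset.sum_congr rfl fun i _ => ?_
  rw [integral_finsetSum _ fun j _ => (integrable_mul_coord hw hi i j).mul_const _]
  refine Finset.sum_congr rfl fun j _ => ?_
  rw [integral_mul_const]
  simp only [weightedMoment, of_apply]
  ring

lemma trace_mul_weightedMoment {w : Vec d × Y → ℝ} (hw : Measurable w)
    (hi : Integrable (fun p => w p * ‖p.1‖ ^ 2) D) (A : Matrix (Fin d) (Fin d) ℝ) :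
    (A * weightedMoment D w).trace = ∫ p, w p * form (opOf A) p.1 p.1 ∂D := by
  obtain ⟨f, hf⟩ : ∃ f : Fin d → Fin d → ℝ, ∀ i j, A i j = f i j := ⟨A, fun _ _ => rfl⟩
  have h1 : ∀ p : Vec d × Y, w p * form (opOf A) p.1 p.1
      = ∑ i, ∑ j, f i j * (w p * (p.1 j * p.1 i)) := by
    intro p
    rw [form_opOf]
    simp only [dotProduct, mulVec, Finset.mul_sum, hf]
    exact Finset.sum_congr rfl fun i _ => Finset.sum_congr rfl fun j _ => by ring
  simp_rw [h1]
  rw [integral_finsetSum _ fun i _ => integrable_finsetSum _ fun j _ =>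
    (integrable_mul_coord hw hi j i).const_mul _]
  simp only [trace, diag_apply, mul_apply, hf]
  refine Finset.sum_congr rfl fun i _ => ?_
  rw [integral_finsetSum _ fun j _ => (integrable_mul_coord hw hi j i).const_mul _]
  refine Finset.sum_congr rfl fun j _ => ?_
  rw [integral_const_mul]
  simp only [weightedMoment, of_apply]

lemma trace_weightedMoment {w : Vec d × Y → ℝ} (hw : Measurable w)
    (hi : Integrable (fun p => w p * ‖p.1‖ ^ 2) D) :
    (weightedMoment D w).trace = ∫ p, w p * ‖p.1‖ ^ 2 ∂D := by
  have h := trace_mul_weightedMoment hw hi 1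
  rw [one_mul] at h
  rw [h]
  refine integral_congr_ae (.of_forall fun p => ?_)
  simp [form]

/-- The moments of the features, in operator form: `S` is the second-moment operator, `T` its
inverse, `mu` a lower bound on the spectrum of `S`, and `R2`, `κt` the two fourth-moment constants.
As part of the structure `R2` bounds `S` from above, which makes `R2` admissible wherever the
largest eigenvalue is. -/
structure Design (D : Measure (Vec d × Y)) (S T : Vec d →L[ℝ] Vec d) (mu R2 κt : ℝ) : Prop where
  pair : InversePair S T mu R2
  integrable : Integrable (fun p => ‖p.1‖ ^ 4) D
  cov : ∀ x y, ∫ p, inner ℝ p.1 x * inner ℝ p.1 y ∂D = form S x y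
  bound : ∀ y, ∫ p, ‖p.1‖ ^ 2 * inner ℝ p.1 y ^ 2 ∂D ≤ R2 * form S y y
  boundInv : ∀ y, ∫ p, form T p.1 p.1 * inner ℝ p.1 y ^ 2 ∂D ≤ κt * form S y y
  one_le : 1 ≤ κt

@[fun_prop]
lemma measurable_form_fst (A : Vec d →L[ℝ] Vec d) :
    Measurable fun p : Vec d × Y => form A p.1 p.1 :=
  (continuous_form_self A).measurable.comp measurable_fst

lemma integrable_form_mul [IsProbabilityMeasure D] (A : Vec d →L[ℝ] Vec d)
    {w : Vec d × Y → ℝ} (hw : Measurable w) (hi : Integrable (fun p => w p * ‖p.1‖ ^ 2) D) :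
    Integrable (fun p => form A p.1 p.1 * w p) D := by
  refine (hi.const_mul ‖A‖).mono (by fun_prop) (.of_forall fun p => ?_)
  rw [norm_mul, norm_mul, norm_mul, Real.norm_eq_abs (form A p.1 p.1)]
  calc _ ≤ (‖A‖ * ‖p.1‖ ^ 2) * ‖w p‖ := by gcongr; exact abs_form_self_le A _
    _ = _ := by simp; ring

lemma integrable_norm_sq_mul_inner_sq (h4 : Integrable (fun p => ‖p.1‖ ^ 4) D) (x y : Vec d) :
    Integrable (fun p => ‖p.1‖ ^ 2 * (inner ℝ p.1 x * inner ℝ p.1 y)) D := by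
  refine (h4.mul_const (‖x‖ * ‖y‖)).mono (by fun_prop) (.of_forall fun p => ?_)
  rw [norm_mul, norm_mul, norm_mul]
  calc _ ≤ ‖‖p.1‖ ^ 2‖ * ((‖p.1‖ * ‖x‖) * (‖p.1‖ * ‖y‖)) := by
        gcongr <;> exact norm_inner_le_norm _ _
    _ = _ := by simp; ring

lemma integrable_inner_pow_four (h4 : Integrable (fun p => ‖p.1‖ ^ 4) D) (x : Vec d) :
    Integrable (fun p => (inner ℝ p.1 x : ℝ) ^ 4) D := by
  refine (h4.mul_const (‖x‖ ^ 4)).mono (by fun_prop) (.of_forall fun p => ?_)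
  rw [norm_mul, norm_pow, norm_pow, norm_pow, ← mul_pow, norm_norm, norm_norm]
  gcongr; exact norm_inner_le_norm _ _

/-- If `⟨a, y⟩² ≤ w(a) s` and `𝔼 w(a) ⟨a, y⟩² ≤ c ⟨S y, y⟩`, then `⟨S y, y⟩ ≤ c s`, because
`⟨S y, y⟩² ≤ 𝔼 ⟨a, y⟩⁴`. -/
lemma form_le_of_weighted [IsProbabilityMeasure D] (h4 : Integrable (fun p => ‖p.1‖ ^ 4) D)
    {S : Vec d →L[ℝ] Vec d} {y : Vec d}
    (hcov : ∫ p, inner ℝ p.1 y * inner ℝ p.1 y ∂D = form S y y) (hS : 0 < form S y y)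
    {w : Vec d × Y → ℝ} {s c : ℝ} (hs : 0 ≤ s)
    (hw : ∀ p, (inner ℝ p.1 y : ℝ) ^ 2 ≤ w p * s)
    (hwi : Integrable (fun p => w p * inner ℝ p.1 y ^ 2) D)
    (hc : ∫ p, w p * inner ℝ p.1 y ^ 2 ∂D ≤ c * form S y y) : form S y y ≤ c * s := by
  have hi4 := integrable_inner_pow_four h4 y
  have hL2 : MemLp (fun p : Vec d × Y => (inner ℝ p.1 y : ℝ) ^ 2) 2 D := by
    rw [memLp_two_iff_integrable_sq (by fun_prop)]
    simpa only [← pow_mul] using hi4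
  have hvar := variance_nonneg (fun p : Vec d × Y => (inner ℝ p.1 y : ℝ) ^ 2) D
  rw [variance_eq_sub hL2] at hvar
  simp only [Pi.pow_apply, ← pow_mul] at hvar
  have e1 : ∫ p, (inner ℝ p.1 y : ℝ) ^ 2 ∂D = form S y y := by
    rw [← hcov]; simp only [pow_two]
  rw [e1] at hvar
  have h2 : ∫ p, (inner ℝ p.1 y : ℝ) ^ (2 * 2) ∂D ≤ s * ∫ p, w p * inner ℝ p.1 y ^ 2 ∂D := by
    rw [← integral_const_mul]
    refine integral_mono hi4 (hwi.const_mul s) fun p => ?_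
    have := mul_le_mul_of_nonneg_right (hw p) (sq_nonneg (inner ℝ p.1 y))
    calc (inner ℝ p.1 y : ℝ) ^ (2 * 2) = inner ℝ p.1 y ^ 2 * inner ℝ p.1 y ^ 2 := by ring
      _ ≤ _ := this
      _ = _ := by ring
  have h3 := mul_le_mul_of_nonneg_left hc hs
  have h5 : form S y y * form S y y ≤ (c * s) * form S y y := by nlinarith
  exact le_of_mul_le_mul_right h5 hS

lemma PosSemidef.form_le {A B : Matrix (Fin d) (Fin d) ℝ} (h : (A - B).PosSemidef) (x : Vec d) :
    form (opOf B) x x ≤ form (opOf A) x x := by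
  have := h.dotProduct_mulVec_nonneg x.ofLp
  rw [sub_mulVec, dotProduct_sub, star_trivial] at this
  rw [form_opOf, form_opOf]
  linarith

lemma form_opOf_smul (c : ℝ) (A : Matrix (Fin d) (Fin d) ℝ) (x : Vec d) :
    form (opOf (c • A)) x x = c * form (opOf A) x x := by
  rw [form_opOf, form_opOf, smul_mulVec, dotProduct_smul, smul_eq_mul]

/-- The assumptions on the second and fourth moments give a `Design`. -/
lemma design_of_moments [NeZero d] [IsProbabilityMeasure D] {R κt : ℝ}
    (h2 : SecondMomentCondition D) (h4 : FourthMomentCondition D R κt) :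
    Design D (opOf (covMat D)) (opOf (covMat D)⁻¹) (lamMin (covMat D)) (R ^ 2) κt := by
  have hp := inversePair_of_posDef h2.posDef
  have hcov : ∀ x y, ∫ p, inner ℝ p.1 x * inner ℝ p.1 y ∂D = form (opOf (covMat D)) x y := by
    intro x y
    rw [covMat, form_weightedMoment measurable_const (by simpa using h2.integrable)]
    simp
  have hb : ∀ y, ∫ p, ‖p.1‖ ^ 2 * inner ℝ p.1 y ^ 2 ∂D
      ≤ R ^ 2 * form (opOf (covMat D)) y y := by
    intro y
    have := PosSemidef.form_le h4.bound y
    rw [form_opOf_smul, form_weightedMoment (by fun_prop)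
      (by simpa only [← pow_add] using h4.integrable)] at this
    simpa only [pow_two (inner ℝ _ y)] using this
  have hTa : ∀ p : Vec d × Y, sqNorm (covMat D)⁻¹ p.1 = form (opOf (covMat D)⁻¹) p.1 p.1 :=
    fun p => (form_opOf_self _ _).symm
  have hbi : ∀ y, ∫ p, form (opOf (covMat D)⁻¹) p.1 p.1 * inner ℝ p.1 y ^ 2 ∂D
      ≤ κt * form (opOf (covMat D)) y y := by
    intro y
    have := PosSemidef.form_le h4.boundInv y
    simp only [hTa] at this
    rw [form_opOf_smul, form_weightedMoment (by fun_prop) (integrable_form_mul _ (by fun_prop)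
      (by simpa only [← pow_add] using h4.integrable))] at this
    simpa only [pow_two (inner ℝ _ y)] using this
  have hpos : ∀ y : Vec d, y ≠ 0 → 0 < form (opOf (covMat D)) y y := fun y hy =>
    (mul_pos hp.mu_pos (by positivity)).trans_le (hp.lower y)
  have hR : ∀ y, form (opOf (covMat D)) y y ≤ R ^ 2 * ‖y‖ ^ 2 := by
    intro y
    rcases eq_or_ne y 0 with rfl | hy
    · simp [form]
    · refine form_le_of_weighted h4.integrable (hcov y y) (hpos y hy) (sq_nonneg _)
        (w := fun p => ‖p.1‖ ^ 2) (fun p => ?_) ?_ (hb y)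
      · rw [← mul_pow]; exact sq_le_sq.2 (by
          rw [abs_mul, abs_norm, abs_norm]; exact abs_real_inner_le_norm _ _)
      · simpa only [pow_two (inner ℝ _ y)] using integrable_norm_sq_mul_inner_sq h4.integrable y y
  refine ⟨⟨hp.mu_pos, hp.symm, hp.left_inv, hp.right_inv, hp.lower, hR⟩, h4.integrable, hcov, hb,
    hbi, ?_⟩
  obtain ⟨y, hy⟩ : ∃ y : Vec d, y ≠ 0 := exists_ne 0
  have h1 : form (opOf (covMat D)) y y ≤ κt * form (opOf (covMat D)) y y := by
    refine form_le_of_weighted h4.integrable (hcov y y) (hpos y hy) (hp.nonneg y)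
      (w := fun p => form (opOf (covMat D)⁻¹) p.1 p.1) (fun p => hp.inner_sq_le _ _) ?_ (hbi y)
    refine integrable_form_mul _ (by fun_prop) ?_
    simpa only [pow_two (inner ℝ _ y), mul_comm (‖_‖ ^ 2)] using
      integrable_norm_sq_mul_inner_sq h4.integrable y y
  exact le_of_mul_le_mul_right (by linarith) (hpos y hy)

end Moments

/-! ### The loss and the population risk -/

section Taylor

lemma hasDerivAt_mul_left (c s : ℝ) : HasDerivAt (fun r => c * r) c s := by
  simpa using (hasDerivAt_id' s).const_mul c

lemma tangent_le_of_monotone_deriv {f f' : ℝ → ℝ} (hf : ∀ x, HasDerivAt f (f' x) x)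
    (hm : Monotone f') (s r : ℝ) : f s + f' s * (r - s) ≤ f r := by
  rcases lt_trichotomy s r with h | rfl | h
  · obtain ⟨c, hc, he⟩ := exists_hasDerivAt_eq_slope f f' h
      (fun x _ => (hf x).continuousAt.continuousWithinAt) fun x _ => hf x
    rw [eq_div_iff (by linarith)] at he
    nlinarith [hm hc.1.le]
  · simp
  · obtain ⟨c, hc, he⟩ := exists_hasDerivAt_eq_slope f f' h
      (fun x _ => (hf x).continuousAt.continuousWithinAt) fun x _ => hf x
    rw [eq_div_iff (by linarith)] at he
    nlinarith [hm hc.2.le]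

variable {Y : Type u} {ℓ : ℝ → Y → ℝ} {Lℓ μℓ : ℝ} (h : LossCondition ℓ Lℓ μℓ)
include h

namespace LossCondition

lemma hasDerivAt (b : Y) (s : ℝ) : HasDerivAt (fun r => ℓ r b) (lossDeriv ℓ s b) s :=
  (h.diff b s).hasDerivAt

lemma hasDerivAt2 (b : Y) (s : ℝ) :
    HasDerivAt (fun r => lossDeriv ℓ r b) (lossDeriv2 ℓ s b) s :=
  (h.diff2 b s).hasDerivAt

lemma monotone_lower (b : Y) : Monotone fun s => lossDeriv ℓ s b - μℓ * s := by
  have hd : ∀ s, HasDerivAt (fun s => lossDeriv ℓ s b - μℓ * s) (lossDeriv2 ℓ s b - μℓ) s :=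
    fun s => (h.hasDerivAt2 b s).fun_sub (hasDerivAt_mul_left μℓ s)
  refine monotone_of_deriv_nonneg (fun s => (hd s).differentiableAt) fun s => ?_
  rw [(hd s).deriv]; linarith [h.lower s b]

lemma monotone_upper (b : Y) : Monotone fun s => Lℓ * s - lossDeriv ℓ s b := by
  have hd : ∀ s, HasDerivAt (fun s => Lℓ * s - lossDeriv ℓ s b) (Lℓ - lossDeriv2 ℓ s b) s :=
    fun s => (hasDerivAt_mul_left Lℓ s).fun_sub (h.hasDerivAt2 b s)
  refine monotone_of_deriv_nonneg (fun s => (hd s).differentiableAt) fun s => ?_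
  rw [(hd s).deriv]; linarith [h.upper s b]

lemma taylor_lower (s r : ℝ) (b : Y) :
    ℓ s b + lossDeriv ℓ s b * (r - s) + μℓ / 2 * (r - s) ^ 2 ≤ ℓ r b := by
  have hd : ∀ s, HasDerivAt (fun s => ℓ s b - μℓ / 2 * s ^ 2) (lossDeriv ℓ s b - μℓ * s) s := by
    intro s
    exact ((h.hasDerivAt b s).fun_sub ((hasDerivAt_pow 2 s).const_mul (μℓ / 2))).congr_deriv
      (by push_cast; ring)
  have := tangent_le_of_monotone_deriv hd (h.monotone_lower b) s r
  linarith

lemma taylor_upper (s r : ℝ) (b : Y) :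
    ℓ r b ≤ ℓ s b + lossDeriv ℓ s b * (r - s) + Lℓ / 2 * (r - s) ^ 2 := by
  have hd : ∀ s, HasDerivAt (fun s => Lℓ / 2 * s ^ 2 - ℓ s b) (Lℓ * s - lossDeriv ℓ s b) s := by
    intro s
    exact (((hasDerivAt_pow 2 s).const_mul (Lℓ / 2)).fun_sub (h.hasDerivAt b s)).congr_deriv
      (by push_cast; ring)
  have := tangent_le_of_monotone_deriv hd (h.monotone_upper b) s r
  linarith

lemma sq_sub_le (s r : ℝ) (b : Y) :
    (lossDeriv ℓ r b - lossDeriv ℓ s b) ^ 2 ≤ Lℓ ^ 2 * (r - s) ^ 2 := by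
  rw [← mul_pow]
  refine sq_le_sq.2 ?_
  rw [abs_mul, abs_of_pos h.L_pos]
  wlog hrs : s ≤ r generalizing s r
  · rw [abs_sub_comm, abs_sub_comm r]; exact this r s (le_of_not_ge hrs)
  have h1 := h.monotone_lower b hrs
  have h2 := h.monotone_upper b hrs
  simp only at h1 h2
  have h3 := mul_nonneg h.mu_pos.le (sub_nonneg.2 hrs)
  rw [abs_of_nonneg (sub_nonneg.2 hrs), abs_of_nonneg (by linarith)]
  linarith

end LossCondition

omit h in
/-- The derivative is a limit of difference quotients, hence jointly measurable. -/
lemma measurable_lossDeriv [MeasurableSpace Y] (h : LossCondition ℓ Lℓ μℓ)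
    (hm : Measurable fun q : ℝ × Y => ℓ q.1 q.2) :
    Measurable fun q : ℝ × Y => lossDeriv ℓ q.1 q.2 := by
  refine measurable_of_tendsto_metrizable
    (f := fun (n : ℕ) (q : ℝ × Y) => ((1 : ℝ) / (n + 1))⁻¹ * (ℓ (q.1 + 1 / (n + 1)) q.2 - ℓ q.1 q.2))
    (fun n => ?_) ?_
  · have h1 : Measurable fun q : ℝ × Y => ℓ (q.1 + 1 / (n + 1)) q.2 :=
      hm.comp ((measurable_fst.add_const _).prodMk measurable_snd)
    exact (h1.sub hm).const_mul _
  · rw [tendsto_pi_nhds]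
    intro q
    have h1 := (h.hasDerivAt q.2 q.1).tendsto_slope_zero
    have h2 : Filter.Tendsto (fun n : ℕ => (1 : ℝ) / (n + 1)) Filter.atTop
        (nhdsWithin 0 {0}ᶜ) := by
      refine tendsto_nhdsWithin_of_tendsto_nhds_of_eventually_within _
        tendsto_one_div_add_atTop_nhds_zero_nat (.of_forall fun n => ?_)
      exact ne_of_gt (by positivity)
    simpa [Function.comp_def] using h1.comp h2

end Taylor

section Risk

variable {d : ℕ} {Y : Type u} [MeasurableSpace Y]

/-- The data of the stochastic optimisation problem: a design, a smooth and strongly convex loss,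
a minimiser `xs` of the (finite) risk, and finite gradient noise at `xs`. -/
structure Problem (D : Measure (Vec d × Y)) (ℓ : ℝ → Y → ℝ) (Lℓ μℓ : ℝ) (xs : Vec d)
    (S T : Vec d →L[ℝ] Vec d) (mu R2 κt : ℝ) : Prop where
  design : Design D S T mu R2 κt
  loss : LossCondition ℓ Lℓ μℓ
  meas : Measurable fun q : ℝ × Y => ℓ q.1 q.2
  int : ∀ x : Vec d, Integrable (fun p => ℓ (inner ℝ p.1 x) p.2) D
  min : ∀ x : Vec d, risk D ℓ xs ≤ risk D ℓ x
  noise : Integrable (fun p => (lossDeriv ℓ (inner ℝ p.1 xs) p.2) ^ 2 * ‖p.1‖ ^ 2) D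

/-- The gradient of the population risk, `𝔼 ℓ'(aᵀx, b) a`. -/
def gradRisk (D : Measure (Vec d × Y)) (ℓ : ℝ → Y → ℝ) (x : Vec d) : Vec d :=
  ∫ p, lossDeriv ℓ (inner ℝ p.1 x) p.2 • p.1 ∂D

/-- The suboptimality gap `F x - F x⋆`. -/
def gap (D : Measure (Vec d × Y)) (ℓ : ℝ → Y → ℝ) (xs x : Vec d) : ℝ := risk D ℓ x - risk D ℓ xs

variable {D : Measure (Vec d × Y)} [IsProbabilityMeasure D] {ℓ : ℝ → Y → ℝ} {Lℓ μℓ : ℝ}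
  {xs : Vec d} {S T : Vec d →L[ℝ] Vec d} {mu R2 κt : ℝ}

namespace Problem

variable (h : Problem D ℓ Lℓ μℓ xs S T mu R2 κt)
include h

omit [IsProbabilityMeasure D] in
lemma measurable_lossDeriv_inner :
    Measurable fun q : (Vec d × Y) × Vec d => lossDeriv ℓ (inner ℝ q.1.1 q.2) q.1.2 :=
  (measurable_lossDeriv h.loss h.meas).comp
    (f := fun q : (Vec d × Y) × Vec d => ((inner ℝ q.1.1 q.2 : ℝ), q.1.2)) (by fun_prop)

omit [IsProbabilityMeasure D] in
@[fun_prop]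
lemma measurable_lossDeriv_at (x : Vec d) :
    Measurable fun p : Vec d × Y => lossDeriv ℓ (inner ℝ p.1 x) p.2 :=
  h.measurable_lossDeriv_inner.comp (measurable_id.prodMk measurable_const)

lemma measurable_risk : Measurable (risk D ℓ) := by
  have h1 : Measurable fun q : Vec d × (Vec d × Y) => ℓ (inner ℝ q.2.1 q.1) q.2.2 :=
    h.meas.comp (f := fun q : Vec d × (Vec d × Y) => ((inner ℝ q.2.1 q.1 : ℝ), q.2.2))
      (by fun_prop)
  exact (h1.stronglyMeasurable.integral_prod_right' (ν := D)).measurable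

omit [IsProbabilityMeasure D] in
lemma gap_nonneg (x : Vec d) : 0 ≤ gap D ℓ xs x := sub_nonneg.2 (h.min x)

omit [IsProbabilityMeasure D] in
lemma integrable_inner_sq_mul (y : Vec d) :
    Integrable (fun p => (inner ℝ p.1 y : ℝ) ^ 2 * ‖p.1‖ ^ 2) D := by
  simpa only [pow_two (inner ℝ _ y), mul_comm (‖_‖ ^ 2)] using
      integrable_norm_sq_mul_inner_sq h.design.integrable y y

omit [IsProbabilityMeasure D] in
/-- The excess gradient noise at `x` is square integrable. -/
lemma integrable_noise_sub (x : Vec d) :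
    Integrable (fun p => (lossDeriv ℓ (inner ℝ p.1 x) p.2
      - lossDeriv ℓ (inner ℝ p.1 xs) p.2) ^ 2 * ‖p.1‖ ^ 2) D := by
  have hx := h.measurable_lossDeriv_at x
  have hxs := h.measurable_lossDeriv_at xs
  refine ((h.integrable_inner_sq_mul (x - xs)).const_mul (Lℓ ^ 2)).mono (by fun_prop)
    (.of_forall fun p => ?_)
  have := h.loss.sq_sub_le (inner ℝ p.1 xs) (inner ℝ p.1 x) p.2
  rw [← inner_sub_right] at this
  rw [Real.norm_of_nonneg (by positivity), Real.norm_of_nonneg (by positivity), ← mul_assoc]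
  gcongr

omit [IsProbabilityMeasure D] in
lemma integrable_noise (x : Vec d) :
    Integrable (fun p => lossDeriv ℓ (inner ℝ p.1 x) p.2 ^ 2 * ‖p.1‖ ^ 2) D := by
  have hx := h.measurable_lossDeriv_at x
  have hxs := h.measurable_lossDeriv_at xs
  refine (((h.integrable_noise_sub x).add h.noise).const_mul 2).mono (by fun_prop)
    (.of_forall fun p => ?_)
  simp only [Pi.add_apply]
  rw [Real.norm_of_nonneg (by positivity), Real.norm_of_nonneg (by positivity), ← add_mul,
    ← mul_assoc]
  gcongr
  nlinarith [sq_nonneg (lossDeriv ℓ (inner ℝ p.1 x) p.2 - 2 * lossDeriv ℓ (inner ℝ p.1 xs) p.2)]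

lemma integrable_grad (x : Vec d) :
    Integrable (fun p => lossDeriv ℓ (inner ℝ p.1 x) p.2 • p.1) D := by
  have hx := h.measurable_lossDeriv_at x
  refine MemLp.integrable (q := 2) (by norm_num) ?_
  rw [memLp_two_iff_integrable_sq_norm (by fun_prop)]
  simpa only [norm_smul, mul_pow, Real.norm_eq_abs, sq_abs] using h.integrable_noise x

lemma integrable_grad_inner (x v : Vec d) :
    Integrable (fun p => lossDeriv ℓ (inner ℝ p.1 x) p.2 * inner ℝ p.1 v) D := by
  simpa only [real_inner_smul_left] using (h.integrable_grad x).inner_const (𝕜 := ℝ) v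

lemma inner_gradRisk (x v : Vec d) :
    inner ℝ (gradRisk D ℓ x) v
      = ∫ p, lossDeriv ℓ (inner ℝ p.1 x) p.2 * inner ℝ p.1 v ∂D := by
  rw [gradRisk, real_inner_comm, ← integral_inner (h.integrable_grad x)]
  simp only [real_inner_comm _ v, real_inner_smul_left]

lemma integrable_inner_sq (v : Vec d) :
    Integrable (fun p => (inner ℝ p.1 v : ℝ) ^ 2) D := by
  have h1 : MemLp (fun p : Vec d × Y => (inner ℝ p.1 v : ℝ) ^ 2) 2 D := by
    rw [memLp_two_iff_integrable_sq (by fun_prop)]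
    simpa only [← pow_mul] using integrable_inner_pow_four h.design.integrable v
  exact h1.integrable (by norm_num)

lemma integrable_quad (x v : Vec d) (c : ℝ) :
    Integrable (fun p => ℓ (inner ℝ p.1 x) p.2
      + lossDeriv ℓ (inner ℝ p.1 x) p.2 * inner ℝ p.1 v + c * inner ℝ p.1 v ^ 2) D :=
  ((h.int x).add (h.integrable_grad_inner x v)).add ((h.integrable_inner_sq v).const_mul c)

lemma integral_quad (x v : Vec d) (c : ℝ) :
    ∫ p, (ℓ (inner ℝ p.1 x) p.2 + lossDeriv ℓ (inner ℝ p.1 x) p.2 * inner ℝ p.1 v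
      + c * inner ℝ p.1 v ^ 2) ∂D
      = risk D ℓ x + inner ℝ (gradRisk D ℓ x) v + c * form S v v := by
  have h1 := (h.int x).add (h.integrable_grad_inner x v)
  rw [show (fun p : Vec d × Y => ℓ (inner ℝ p.1 x) p.2) + (fun p =>
    lossDeriv ℓ (inner ℝ p.1 x) p.2 * inner ℝ p.1 v) = fun p => ℓ (inner ℝ p.1 x) p.2 +
    lossDeriv ℓ (inner ℝ p.1 x) p.2 * inner ℝ p.1 v from rfl] at h1
  rw [integral_add h1
    ((h.integrable_inner_sq v).const_mul c), integral_add (h.int x) (h.integrable_grad_inner x v),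
    h.inner_gradRisk, integral_const_mul, ← h.design.cov]
  simp only [risk, pow_two]

/-- The risk is `μℓ`-strongly convex in the norm of `S`. -/
lemma risk_lower (x v : Vec d) :
    risk D ℓ x + inner ℝ (gradRisk D ℓ x) v + μℓ / 2 * form S v v ≤ risk D ℓ (x + v) := by
  rw [← h.integral_quad]
  refine integral_mono (h.integrable_quad _ _ _) (h.int _) fun p => ?_
  have := h.loss.taylor_lower (inner ℝ p.1 x) (inner ℝ p.1 (x + v)) p.2
  simpa only [inner_add_right, add_sub_cancel_left] using this

/-- The risk is `Lℓ`-smooth in the norm of `S`. -/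
lemma risk_upper (x v : Vec d) :
    risk D ℓ (x + v) ≤ risk D ℓ x + inner ℝ (gradRisk D ℓ x) v + Lℓ / 2 * form S v v := by
  rw [← h.integral_quad]
  refine integral_mono (h.int _) (h.integrable_quad _ _ _) fun p => ?_
  have := h.loss.taylor_upper (inner ℝ p.1 x) (inner ℝ p.1 (x + v)) p.2
  simpa only [inner_add_right, add_sub_cancel_left] using this

/-- The gradient is controlled by the gap: compare `x` with a gradient step of length `1 / Lℓ` in
the norm of `S`. -/
lemma form_inv_gradRisk_le (x : Vec d) :
    form T (gradRisk D ℓ x) (gradRisk D ℓ x) ≤ 2 * Lℓ * gap D ℓ xs x := by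
  have hL := h.loss.L_pos
  have h1 := h.risk_upper x ((-Lℓ⁻¹) • T (gradRisk D ℓ x))
  have h2 := h.min (x + (-Lℓ⁻¹) • T (gradRisk D ℓ x))
  rw [real_inner_smul_right, form_smul_smul, ← h.design.pair.inv_self, real_inner_comm] at h1
  have h3 : inner ℝ (T (gradRisk D ℓ x)) (gradRisk D ℓ x)
      = form T (gradRisk D ℓ x) (gradRisk D ℓ x) := rfl
  rw [h3] at h1
  set G := form T (gradRisk D ℓ x) (gradRisk D ℓ x)
  have h4 : -Lℓ⁻¹ * G + Lℓ / 2 * ((-Lℓ⁻¹) ^ 2 * G) = -(G / (2 * Lℓ)) := by field_simp; ring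
  have h5 : G / (2 * Lℓ) ≤ gap D ℓ xs x := by unfold gap; linarith
  rw [div_le_iff₀ (by positivity)] at h5
  linarith

/-- The gradient vanishes at the minimiser. -/
lemma gradRisk_min : gradRisk D ℓ xs = 0 := by
  have h1 := h.form_inv_gradRisk_le xs
  rw [gap, sub_self, mul_zero] at h1
  have h3 := h.design.pair.lower (T (gradRisk D ℓ xs))
  rw [← h.design.pair.inv_self] at h3
  have h4 : ‖T (gradRisk D ℓ xs)‖ ^ 2 ≤ 0 :=
    nonpos_of_mul_nonpos_right (h3.trans h1) h.design.pair.mu_pos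
  have h5 : T (gradRisk D ℓ xs) = 0 := by
    rw [← norm_eq_zero]; exact pow_eq_zero_iff (two_ne_zero) |>.1 (le_antisymm h4 (sq_nonneg _))
  have h6 := h.design.pair.right_inv (gradRisk D ℓ xs)
  rw [h5, map_zero] at h6
  exact h6.symm

lemma form_sub_min_le (x : Vec d) : μℓ / 2 * form S (x - xs) (x - xs) ≤ gap D ℓ xs x := by
  have h1 := h.risk_lower xs (x - xs)
  rw [h.gradRisk_min, inner_zero_left, add_sub_cancel] at h1
  unfold gap; linarith

/-- Strong convexity between `x` and the minimiser. -/
lemma gap_le_inner (x : Vec d) :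
    gap D ℓ xs x + μℓ / 2 * form S (x - xs) (x - xs) ≤ inner ℝ (gradRisk D ℓ x) (x - xs) := by
  have h1 := h.risk_lower x (-(x - xs))
  rw [inner_neg_right, ← neg_one_smul ℝ (x - xs), form_smul_smul, neg_one_smul ℝ (x - xs),
    show x + -(x - xs) = xs by abel] at h1
  unfold gap; linarith

/-- Smoothness in the form needed for comparing the gaps at an iterate and at its extrapolation. -/
lemma gap_add_le (x v : Vec d) :
    gap D ℓ xs (x + v) ≤ 2 * gap D ℓ xs x + Lℓ * form S v v := by
  have hL := h.loss.L_pos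
  have h1 := h.risk_upper x v
  have h2 := h.form_inv_gradRisk_le x
  have h3 := h.design.pair.inner_sq_le (gradRisk D ℓ x) v
  have h4 := h.design.pair.nonneg v
  have h5 : inner ℝ (gradRisk D ℓ x) v ≤ gap D ℓ xs x + Lℓ / 2 * form S v v := by
    have h6 := h.gap_nonneg x
    refine le_of_sq_le_sq ?_ (by positivity)
    nlinarith [sq_nonneg (gap D ℓ xs x - Lℓ / 2 * form S v v),
      mul_le_mul_of_nonneg_right h2 h4]
  unfold gap at *; linarith

end Problem
end Risk

/-! ### Integration against fresh samples -/

section Independence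

variable {Ω α β : Type*} [MeasurableSpace Ω] [MeasurableSpace α] [MeasurableSpace β]
  {P : Measure Ω} [IsProbabilityMeasure P]

lemma indepFun_of_measurable_iSup {ι X : Type*} [MeasurableSpace X] {ξ : ι → Ω → X}
    (hξ : ∀ i, Measurable (ξ i)) (hind : iIndepFun ξ P) {A B : Set ι} (hAB : Disjoint A B)
    {f : Ω → α} {g : Ω → β}
    (hf : Measurable[⨆ i ∈ A, MeasurableSpace.comap (ξ i) inferInstance] f)
    (hg : Measurable[⨆ i ∈ B, MeasurableSpace.comap (ξ i) inferInstance] g) :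
    IndepFun f g P := by
  have h1 := indep_iSup_of_disjoint (fun i => (hξ i).comap_le)
    ((iIndepFun_iff_iIndep _ _ _).1 hind) hAB
  rw [IndepFun_iff_Indep]
  exact indep_of_indep_of_le_left (indep_of_indep_of_le_right h1 hg.comap_le) hf.comap_le

/-- Conditioning on `S` for a nonnegative function of two independent variables `S` and `B`: a
bound for each fixed value of `S` holds on average. -/
lemma integral_le_of_indepFun {S : Ω → α} {B : Ω → β} (hS : Measurable S) (hB : Measurable B)
    (hind : IndepFun S B P) {W : α → β → ℝ} (hW : Measurable fun q : α × β => W q.1 q.2)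
    (hW0 : ∀ s b, 0 ≤ W s b) {V : α → ℝ} (hV : Integrable (fun ω => V (S ω)) P)
    (hi : ∀ s, Integrable (fun ω => W s (B ω)) P) (hle : ∀ s, ∫ ω, W s (B ω) ∂P ≤ V s) :
    Integrable (fun ω => W (S ω) (B ω)) P ∧ ∫ ω, W (S ω) (B ω) ∂P ≤ ∫ ω, V (S ω) ∂P := by
  have hV0 : ∀ s, 0 ≤ V s := fun s => (integral_nonneg fun ω => hW0 _ _).trans (hle s)
  have hWm : Measurable fun q : α × β => ENNReal.ofReal (W q.1 q.2) := hW.ennreal_ofReal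
  have hSB : Measurable fun ω => W (S ω) (B ω) := hW.comp (hS.prodMk hB)
  have hlaw := (indepFun_iff_map_prod_eq_prod_map_map hS.aemeasurable hB.aemeasurable).1 hind
  have h1 : ∫⁻ ω, ENNReal.ofReal (W (S ω) (B ω)) ∂P
      = ∫⁻ ω, ∫⁻ ω', ENNReal.ofReal (W (S ω) (B ω')) ∂P ∂P := by
    have e1 := lintegral_map (μ := P) hWm (hS.prodMk hB)
    rw [hlaw] at e1
    have : IsProbabilityMeasure (P.map B) := Measure.isProbabilityMeasure_map hB.aemeasurable
    rw [lintegral_prod _ hWm.aemeasurable, lintegral_map hWm.lintegral_prod_right' hS] at e1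
    rw [← e1]
    refine lintegral_congr fun ω => ?_
    exact lintegral_map (hWm.comp (measurable_const.prodMk measurable_id)) hB
  have h2 : ∫⁻ ω, ENNReal.ofReal (W (S ω) (B ω)) ∂P ≤ ENNReal.ofReal (∫ ω, V (S ω) ∂P) := by
    rw [h1, ofReal_integral_eq_lintegral_ofReal hV (.of_forall fun ω => hV0 _)]
    refine lintegral_mono fun ω => ?_
    rw [← ofReal_integral_eq_lintegral_ofReal (hi _) (.of_forall fun ω' => hW0 _ _)]
    exact ENNReal.ofReal_le_ofReal (hle _)
  refine ⟨(lintegral_ofReal_ne_top_iff_integrable hSB.aestronglyMeasurable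
    (.of_forall fun ω => hW0 _ _)).1 (ne_top_of_le_ne_top ENNReal.ofReal_ne_top h2), ?_⟩
  rw [integral_eq_lintegral_of_nonneg_ae (.of_forall fun ω => hW0 _ _) hSB.aestronglyMeasurable]
  exact ENNReal.toReal_le_of_le_ofReal (integral_nonneg fun ω => hV0 _) h2

/-- Fubini for a function of two independent variables. -/
lemma integral_of_indepFun {S : Ω → α} {B : Ω → β} (hS : Measurable S) (hB : Measurable B)
    (hind : IndepFun S B P) {E : Type*} [NormedAddCommGroup E] [NormedSpace ℝ E]
    {g : α → β → E} (hg : StronglyMeasurable fun q : α × β => g q.1 q.2)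
    (hi : Integrable (fun ω => g (S ω) (B ω)) P) :
    ∫ ω, g (S ω) (B ω) ∂P = ∫ ω, ∫ ω', g (S ω) (B ω') ∂P ∂P := by
  have hlaw := (indepFun_iff_map_prod_eq_prod_map_map hS.aemeasurable hB.aemeasurable).1 hind
  have hp1 : IsProbabilityMeasure (P.map B) := Measure.isProbabilityMeasure_map hB.aemeasurable
  have hp2 : IsProbabilityMeasure (P.map S) := Measure.isProbabilityMeasure_map hS.aemeasurable
  have e1 := integral_map (μ := P) (hS.prodMk hB).aemeasurable
    (f := fun q : α × β => g q.1 q.2) hg.aestronglyMeasurable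
  have e2 : Integrable (fun q : α × β => g q.1 q.2) ((P.map S).prod (P.map B)) := by
    rw [← hlaw, integrable_map_measure hg.aestronglyMeasurable (hS.prodMk hB).aemeasurable]
    exact hi
  rw [hlaw, integral_prod _ e2, integral_map hS.aemeasurable
    hg.integral_prod_right'.aestronglyMeasurable] at e1
  rw [← e1]
  refine integral_congr_ae (.of_forall fun ω => ?_)
  exact integral_map hB.aemeasurable
    (hg.comp_measurable (measurable_const.prodMk measurable_id)).aestronglyMeasurable

end Independence

section QuadraticMoments

variable {X : Type*} [MeasurableSpace X] {D : Measure X} [IsProbabilityMeasure D]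
  {E : Type*} [NormedAddCommGroup E] [InnerProductSpace ℝ E] [FiniteDimensional ℝ E]
  {f : X → E}

lemma integrable_of_sq (hf : AEStronglyMeasurable f D) (h2 : Integrable (fun p => ‖f p‖ ^ 2) D) :
    Integrable f D :=
  ((memLp_two_iff_integrable_sq_norm hf).2 h2).integrable (by norm_num)

lemma integrable_form_self (A : E →L[ℝ] E) (hf : AEStronglyMeasurable f D)
    (h2 : Integrable (fun p => ‖f p‖ ^ 2) D) : Integrable (fun p => form A (f p) (f p)) D := by
  refine (h2.const_mul ‖A‖).mono
    ((continuous_form_self A).comp_aestronglyMeasurable hf) (.of_forall fun p => ?_)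
  rw [norm_mul, norm_norm, norm_pow, norm_norm]
  exact abs_form_self_le A _

lemma integrable_form_left (A : E →L[ℝ] E) (u : E) (hf : Integrable f D) :
    Integrable (fun p => form A u (f p)) D := hf.const_inner (A u)

lemma integral_form_left (A : E →L[ℝ] E) (u : E) (hf : Integrable f D) :
    ∫ p, form A u (f p) ∂D = form A u (∫ p, f p ∂D) := integral_inner hf (A u)

lemma form_add_smul_self {A : E →L[ℝ] E} (hA : ∀ x y, form A x y = form A y x) (u x : E) (c : ℝ) :
    form A (u + c • x) (u + c • x) = form A u u + 2 * c * form A u x + c ^ 2 * form A x x := by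
  simp only [form_add_left, form_add_right, form_smul_left, form_smul_right, hA x u]
  ring

/-- Second moment of an affine function of a square-integrable vector. -/
lemma integral_form_add_smul {A : E →L[ℝ] E} (hA : ∀ x y, form A x y = form A y x) (u : E) (c : ℝ)
    (hf : AEStronglyMeasurable f D) (h2 : Integrable (fun p => ‖f p‖ ^ 2) D) :
    Integrable (fun p => form A (u + c • f p) (u + c • f p)) D ∧
    ∫ p, form A (u + c • f p) (u + c • f p) ∂D
      = form A u u + 2 * c * form A u (∫ p, f p ∂D) + c ^ 2 * ∫ p, form A (f p) (f p) ∂D := by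
  have h1 := integrable_of_sq hf h2
  simp only [form_add_smul_self hA]
  have i1 : Integrable (fun p => form A u u + 2 * c * form A u (f p)) D :=
    (integrable_const _).add ((integrable_form_left A u h1).const_mul _)
  have i2 : Integrable (fun p => c ^ 2 * form A (f p) (f p)) D :=
    (integrable_form_self A hf h2).const_mul _
  refine ⟨i1.add i2, ?_⟩
  rw [integral_add i1 i2, integral_add (integrable_const _)
    ((integrable_form_left A u h1).const_mul _), integral_const_mul, integral_const_mul,
    integral_form_left A u h1]
  simp

lemma integral_norm_add_smul (u : E) (c : ℝ)
    (hf : AEStronglyMeasurable f D) (h2 : Integrable (fun p => ‖f p‖ ^ 2) D) :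
    Integrable (fun p => ‖u + c • f p‖ ^ 2) D ∧
    ∫ p, ‖u + c • f p‖ ^ 2 ∂D
      = ‖u‖ ^ 2 + 2 * c * inner ℝ u (∫ p, f p ∂D) + c ^ 2 * ∫ p, ‖f p‖ ^ 2 ∂D := by
  have := integral_form_add_smul (A := ContinuousLinearMap.id ℝ E)
    (fun x y => real_inner_comm _ _) u c hf h2
  simpa only [form, ContinuousLinearMap.id_apply, real_inner_self_eq_norm_sq] using this

end QuadraticMoments

/-! ### Accelerated stochastic approximation for a linear equation -/

section Accelerated

variable {d : ℕ}

/-- The extrapolated point `y` of a pair `(x, z)`. -/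
def mid (θ : ℝ) (s : Vec d × Vec d) : Vec d := (1 / (1 + θ)) • s.1 + (θ / (1 + θ)) • s.2

/-- One accelerated step with the gradient oracle `g`, evaluated at the extrapolated point. -/
def accStep (η γ θ : ℝ) (g : Vec d → Vec d) (s : Vec d × Vec d) : Vec d × Vec d :=
  (mid θ s - η • g (mid θ s), θ • mid θ s + (1 - θ) • s.2 - γ • g (mid θ s))

/-- The Lyapunov function `‖x‖² + μ ‖z‖²_{S⁻¹}`. -/
def pot (T : Vec d →L[ℝ] Vec d) (mu : ℝ) (s : Vec d × Vec d) : ℝ :=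
  ‖s.1‖ ^ 2 + mu * form T s.2 s.2

lemma measurable_mid (θ : ℝ) : Measurable (mid (d := d) θ) := by unfold mid; fun_prop

lemma measurable_pot (T : Vec d →L[ℝ] Vec d) (mu : ℝ) : Measurable (pot T mu) := by
  have := (continuous_form_self T).measurable
  unfold pot
  exact (by fun_prop : Measurable fun s : Vec d × Vec d => ‖s.1‖ ^ 2).add
    ((this.comp measurable_snd).const_mul mu)

lemma one_add_smul_mid {θ : ℝ} (hθ : 0 < θ) (s : Vec d × Vec d) :
    s.1 = (1 + θ) • mid θ s - θ • s.2 := by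
  have : (1 + θ) ≠ 0 := by positivity
  rw [mid, smul_add, smul_smul, smul_smul, mul_one_div_cancel this, one_smul,
    mul_div_cancel₀ _ this, add_sub_cancel_right]

/-- The sum of the two iterates moves along the stochastic gradient. -/
lemma accStep_fst_add_snd {η γ θ : ℝ} (hθ : 0 < θ) (g : Vec d → Vec d) (s : Vec d × Vec d) :
    (accStep η γ θ g s).1 + (accStep η γ θ g s).2 = s.1 + s.2 - (η + γ) • g (mid θ s) := by
  have h := one_add_smul_mid hθ s
  simp only [accStep]
  generalize mid θ s = y at *
  rw [h]
  module

/-- One step of the iterates together with the accumulated gradient noise. -/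
def tailStep {X : Type*} (S : Vec d →L[ℝ] Vec d) (η γ θ : ℝ) (G : Vec d → X → Vec d)
    (q : (Vec d × Vec d) × Vec d) (p : X) : (Vec d × Vec d) × Vec d :=
  (accStep η γ θ (fun y => G y p) q.1, q.2 + (G (mid θ q.1) p - S (mid θ q.1)))

/-- The Lyapunov function of the tail: the squared norm of the accumulated noise plus a multiple of
`pot`, whose decrease pays for the multiplicative part of the noise. -/
def tailPot (T : Vec d →L[ℝ] Vec d) (mu c : ℝ) (q : (Vec d × Vec d) × Vec d) : ℝ :=
  form T q.2 q.2 + c * pot T mu q.1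

/-- A stochastic oracle `G y p`, `p ∼ D`, for the linear map `S`: unbiased, with second moments of
growth `R2` and `κt` and additive noise levels `σ2` and `σi` in the Euclidean norm and in the norm
of `T = S⁻¹`. -/
structure Oracle {X : Type*} [MeasurableSpace X] (D : Measure X) (S T : Vec d →L[ℝ] Vec d)
    (R2 κt σ2 σi : ℝ) (G : Vec d → X → Vec d) : Prop where
  meas : Measurable fun q : Vec d × X => G q.1 q.2
  integrable : ∀ y, Integrable (fun p => ‖G y p‖ ^ 2) D
  mean : ∀ y, ∫ p, G y p ∂D = S y
  sq_le : ∀ y, ∫ p, ‖G y p‖ ^ 2 ∂D ≤ 2 * R2 * form S y y + 2 * σ2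
  inv_le : ∀ y, ∫ p, form T (G y p) (G y p) ∂D ≤ 2 * κt * form S y y + 2 * σi

/-- The step sizes of the inner loop. The relation `mu_gamma` makes the cross terms of the potential
`pot` cancel; `eta_R` and `gamma_sq` make the multiplicative part of the noise, in the Euclidean norm
and in the norm of `S⁻¹`, at most `η / 4` times `⟨S y, y⟩`, where the decrease is `2 η`. -/
structure StepSizes (mu R2 κt η γ θ : ℝ) : Prop where
  eta_pos : 0 < η
  gamma_pos : 0 < γ
  theta_pos : 0 < θ
  theta_le : θ ≤ 1
  R2_nonneg : 0 ≤ R2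
  eta_R : R2 * η ≤ 1 / 16
  mu_gamma : mu * γ = θ
  gamma_sq : mu * γ ^ 2 * κt = η / 16

section Step

variable {X : Type*} [MeasurableSpace X] {D : Measure X} [IsProbabilityMeasure D]
  {S T : Vec d →L[ℝ] Vec d} {mu R2 κt σ2 σi η γ θ : ℝ} {G : Vec d → X → Vec d}

/-- Nesterov's coupling for the potential `pot`: the noiseless part of the decrease. -/
lemma pot_coupling (hp : InversePair S T mu R2) (hθ : 0 < θ) (hθ1 : θ ≤ 1) (s : Vec d × Vec d) :
    ‖mid θ s‖ ^ 2 + mu * form T (θ • mid θ s + (1 - θ) • s.2) (θ • mid θ s + (1 - θ) • s.2)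
      - 2 * θ * inner ℝ (θ • mid θ s + (1 - θ) • s.2) (mid θ s) ≤ (1 - θ) * pot T mu s := by
  have hx := one_add_smul_mid hθ s
  set y := mid θ s
  have hxx : ‖s.1‖ ^ 2 = (1 + θ) ^ 2 * ‖y‖ ^ 2 - 2 * (1 + θ) * θ * inner ℝ s.2 y
      + θ ^ 2 * ‖s.2‖ ^ 2 := by
    rw [hx, norm_sub_sq_real, norm_smul, norm_smul, mul_pow, mul_pow, Real.norm_eq_abs,
      Real.norm_eq_abs, sq_abs, sq_abs, real_inner_smul_left, real_inner_smul_right,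
      real_inner_comm]
    ring
  -- convexity of the norm of `T`
  have h1 : form T (θ • y + (1 - θ) • s.2) (θ • y + (1 - θ) • s.2)
      ≤ θ * form T y y + (1 - θ) * form T s.2 s.2 := by
    have h2 := hp.inv_nonneg (y - s.2)
    simp only [form_add_left, form_add_right, form_sub_left, form_sub_right, form_smul_left,
      form_smul_right, hp.inv_symm s.2 y] at h2 ⊢
    nlinarith [mul_nonneg (mul_nonneg hθ.le (sub_nonneg.2 hθ1)) h2]
  have h3 := hp.mu_mul_inv_le y
  have h4 := mul_le_mul_of_nonneg_left h1 hp.mu_pos.le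
  have h5 := mul_le_mul_of_nonneg_left h3 hθ.le
  -- `x - y = θ (y - z)`
  have h6 : 0 ≤ ‖y‖ ^ 2 - 2 * inner ℝ s.2 y + ‖s.2‖ ^ 2 := by
    have := norm_sub_sq_real s.2 y
    nlinarith [sq_nonneg ‖s.2 - y‖]
  rw [inner_add_left, real_inner_smul_left, real_inner_smul_left, real_inner_self_eq_norm_sq,
    pot, hxx]
  nlinarith [mul_nonneg (mul_nonneg (sq_nonneg θ) (sub_nonneg.2 hθ1)) h6]

variable (hp : InversePair S T mu R2) (hG : Oracle D S T R2 κt σ2 σi G)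
  (hs : StepSizes mu R2 κt η γ θ)
include hp hG hs

/-- One accelerated step contracts the potential up to noise. -/
lemma pot_step (s : Vec d × Vec d) :
    Integrable (fun p => pot T mu (accStep η γ θ (fun y => G y p) s)) D ∧
    ∫ p, pot T mu (accStep η γ θ (fun y => G y p) s) ∂D
      ≤ (1 - θ) * pot T mu s - 7 / 4 * η * form S (mid θ s) (mid θ s)
        + (2 * η ^ 2 * σ2 + 2 * mu * γ ^ 2 * σi) := by
  have hc := pot_coupling hp hs.theta_pos hs.theta_le s
  set y := mid θ s with hy
  have hm : AEStronglyMeasurable (G y) D :=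
    (hG.meas.comp (measurable_const.prodMk measurable_id)).aestronglyMeasurable
  obtain ⟨i1, e1⟩ := integral_norm_add_smul y (-η) hm (hG.integrable y)
  obtain ⟨i2, e2⟩ := integral_form_add_smul hp.inv_symm (θ • y + (1 - θ) • s.2) (-γ) hm
    (hG.integrable y)
  have hpot : ∀ p, pot T mu (accStep η γ θ (fun y => G y p) s) = ‖y + (-η) • G y p‖ ^ 2
      + mu * form T (θ • y + (1 - θ) • s.2 + (-γ) • G y p)
        (θ • y + (1 - θ) • s.2 + (-γ) • G y p) := by
    intro p
    simp only [pot, accStep, neg_smul, ← sub_eq_add_neg, ← hy]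
  simp only [hpot]
  refine ⟨i1.add (i2.const_mul mu), ?_⟩
  rw [integral_add i1 (i2.const_mul mu), integral_const_mul, e1, e2, hG.mean]
  have h1 := hG.sq_le y
  have h2 := hG.inv_le y
  rw [hp.form_inv_apply_right, real_inner_comm (S y) y]
  have h3 : inner ℝ (S y) y = form S y y := rfl
  rw [h3]
  have hyy := hp.nonneg y
  have h4 := mul_le_mul_of_nonneg_left h1 (sq_nonneg η)
  have h5 := mul_le_mul_of_nonneg_left h2 (mul_nonneg hp.mu_pos.le (sq_nonneg γ))
  have h6 := mul_le_mul_of_nonneg_right hs.eta_R (mul_nonneg hs.eta_pos.le hyy)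
  have h7 := congrArg (fun r => r * form S y y) hs.gamma_sq
  have h8 := congrArg (fun r => r * inner ℝ (θ • y + (1 - θ) • s.2) y) hs.mu_gamma
  linarith

/-- One step for the potential together with the accumulated gradient noise. The weight
`8 κt / (7 η)` is the one for which the decrease `7 / 4 η ⟨S y, y⟩` of `pot` pays for the noise
`2 κt ⟨S y, y⟩` in the norm of `T`. -/
lemma tailPot_step (hκ : 0 ≤ κt) (q : (Vec d × Vec d) × Vec d) :
    Integrable (fun p => tailPot T mu (8 * κt / (7 * η)) (tailStep S η γ θ G q p)) D ∧
    ∫ p, tailPot T mu (8 * κt / (7 * η)) (tailStep S η γ θ G q p) ∂D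
      ≤ tailPot T mu (8 * κt / (7 * η)) q + (2 * σi
        + 8 * κt / (7 * η) * (2 * η ^ 2 * σ2 + 2 * mu * γ ^ 2 * σi)) := by
  obtain ⟨s, m⟩ := q
  obtain ⟨i1, e1⟩ := pot_step hp hG hs s
  simp only [tailPot, tailStep]
  set y := mid θ s with hy
  have hm : AEStronglyMeasurable (G y) D :=
    (hG.meas.comp (measurable_const.prodMk measurable_id)).aestronglyMeasurable
  obtain ⟨i2, e2⟩ := integral_form_add_smul hp.inv_symm (m - S y) 1 hm (hG.integrable y)
  have hre : ∀ p, m + (G y p - S y) = m - S y + (1 : ℝ) • G y p := fun p => by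
    rw [one_smul]; abel
  simp only [hre]
  have hη := hs.eta_pos
  have i3 := i1.const_mul (8 * κt / (7 * η))
  refine ⟨i2.add i3, ?_⟩
  rw [integral_add i2 i3, integral_const_mul, e2, hG.mean]
  have h2 := hG.inv_le y
  have hSS : form T (S y) (S y) = form S y y := by
    rw [hp.form_inv_apply, real_inner_comm]; rfl
  have hyy := hp.nonneg y
  have hc : (0 : ℝ) ≤ 8 * κt / (7 * η) := by positivity
  have h3 := mul_le_mul_of_nonneg_left e1 hc
  have h4 : 8 * κt / (7 * η) * (7 / 4 * η * form S y y) = 2 * κt * form S y y := by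
    field_simp; ring
  have h5 : 0 ≤ θ * pot T mu s := mul_nonneg hs.theta_pos.le
    (add_nonneg (sq_nonneg _) (mul_nonneg hp.mu_pos.le (hp.inv_nonneg _)))
  have h6 := mul_nonneg hc h5
  simp only [form_sub_left, form_sub_right, hSS, hp.inv_symm m (S y)]
  linarith

end Step
end Accelerated

section Chain

variable {d : ℕ} {X : Type*} [MeasurableSpace X]

/-- The accelerated iterates with both sequences started at `r`; `data t` is used in step `t`. -/
def accIter (η γ θ : ℝ) (G : Vec d → X → Vec d) (r : Vec d) (data : ℕ → X) : ℕ → Vec d × Vec d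
  | 0 => (r, r)
  | t + 1 => accStep η γ θ (fun y => G y (data (t + 1))) (accIter η γ θ G r data t)

/-- The tail average of the second half of `2 n` accelerated iterates. -/
def accOutput (η γ θ : ℝ) (G : Vec d → X → Vec d) (r : Vec d) (n : ℕ) (data : ℕ → X) : Vec d :=
  (n : ℝ)⁻¹ • ∑ j ∈ Finset.Ico n (2 * n), (accIter η γ θ G r data (j + 1)).1

/-- The gradient noise `G y - S y` accumulated in the steps `n + 1, …, t`. -/
def accNoise (S : Vec d →L[ℝ] Vec d) (η γ θ : ℝ) (G : Vec d → X → Vec d) (r : Vec d) (n : ℕ)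
    (data : ℕ → X) (t : ℕ) : Vec d :=
  ∑ j ∈ Finset.Ico n t, (G (mid θ (accIter η γ θ G r data j)) (data (j + 1))
    - S (mid θ (accIter η γ θ G r data j)))

/-- The iterates after `t` steps together with the gradient noise accumulated after step `n`. -/
def tailState (S : Vec d →L[ℝ] Vec d) (η γ θ : ℝ) (G : Vec d → X → Vec d) (r : Vec d) (n : ℕ)
    (data : ℕ → X) (t : ℕ) : (Vec d × Vec d) × Vec d :=
  (accIter η γ θ G r data t, accNoise S η γ θ G r n data t)

variable {S T : Vec d →L[ℝ] Vec d} {mu R2 κt σ2 σi η γ θ : ℝ} {G : Vec d → X → Vec d} {r : Vec d}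

lemma accIter_succ (data : ℕ → X) (t : ℕ) : accIter η γ θ G r data (t + 1)
    = accStep η γ θ (fun y => G y (data (t + 1))) (accIter η γ θ G r data t) := rfl

lemma measurable_oracle_mid (hG : Measurable fun q : Vec d × X => G q.1 q.2) :
    Measurable fun q : (Vec d × Vec d) × X => G (mid θ q.1) q.2 :=
  hG.comp (((measurable_mid θ).comp measurable_fst).prodMk measurable_snd)

lemma measurable_accStep (hG : Measurable fun q : Vec d × X => G q.1 q.2) :
    Measurable fun q : (Vec d × Vec d) × X => accStep η γ θ (fun y => G y q.2) q.1 := by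
  have h1 := measurable_oracle_mid (θ := θ) hG
  have h2 := (measurable_mid (d := d) θ).comp
    (measurable_fst : Measurable fun q : (Vec d × Vec d) × X => q.1)
  have h3 : Measurable fun q : (Vec d × Vec d) × X => q.1.2 := by fun_prop
  exact (h2.sub (h1.const_smul η)).prodMk
    (((h2.const_smul θ).add (h3.const_smul (1 - θ))).sub (h1.const_smul γ))

lemma measurable_tailStep (hG : Measurable fun q : Vec d × X => G q.1 q.2) :
    Measurable fun q : ((Vec d × Vec d) × Vec d) × X => tailStep S η γ θ G q.1 q.2 := by
  have h0 : Measurable fun q : ((Vec d × Vec d) × Vec d) × X => (q.1.1, q.2) := by fun_prop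
  have h1 : Measurable fun q : ((Vec d × Vec d) × Vec d) × X => G (mid θ q.1.1) q.2 :=
    (measurable_oracle_mid (θ := θ) hG).comp h0
  have h2 : Measurable fun q : ((Vec d × Vec d) × Vec d) × X => S (mid θ q.1.1) :=
    S.continuous.measurable.comp ((measurable_mid θ).comp (by fun_prop))
  have h3 : Measurable fun q : ((Vec d × Vec d) × Vec d) × X => q.1.2 := by fun_prop
  have h4 := (measurable_accStep (η := η) (γ := γ) (θ := θ) hG).comp h0
  exact h4.prodMk (h3.add (h1.sub h2))

lemma measurable_tailPot (T : Vec d →L[ℝ] Vec d) (mu c : ℝ) :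
    Measurable (tailPot (d := d) T mu c) :=
  ((continuous_form_self T).measurable.comp measurable_snd).add
    (((measurable_pot T mu).comp measurable_fst).const_mul c)

/-- The sum of the stochastic gradients telescopes. -/
lemma sum_oracle (hθ : 0 < θ) (data : ℕ → X) {n t : ℕ} (hnt : n ≤ t) :
    (η + γ) • ∑ j ∈ Finset.Ico n t, G (mid θ (accIter η γ θ G r data j)) (data (j + 1))
      = ((accIter η γ θ G r data n).1 + (accIter η γ θ G r data n).2)
        - ((accIter η γ θ G r data t).1 + (accIter η γ θ G r data t).2) := by
  induction t, hnt using Nat.le_induction with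
  | base => simp
  | succ t hnt ih =>
    rw [Finset.sum_Ico_succ_top hnt, smul_add, ih]
    rw [accIter_succ, accStep_fst_add_snd hθ]
    abel

lemma pot_nonneg (hp : InversePair S T mu R2) (s : Vec d × Vec d) : 0 ≤ pot T mu s :=
  add_nonneg (sq_nonneg _) (mul_nonneg hp.mu_pos.le (hp.inv_nonneg _))

lemma inv_add_le_pot (hp : InversePair S T mu R2) (s : Vec d × Vec d) :
    mu * form T (s.1 + s.2) (s.1 + s.2) ≤ 2 * pot T mu s := by
  have h1 := mul_le_mul_of_nonneg_left (hp.inv_add_le s.1 s.2) hp.mu_pos.le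
  have h2 := hp.mu_mul_inv_le s.1
  unfold pot; linarith

/-- Deterministic bound on the tail average: it is controlled by the accumulated noise and the
potential at both ends of the tail. -/
lemma form_accOutput_le (hp : InversePair S T mu R2) (hs : StepSizes mu R2 κt η γ θ)
    (hκ : 0 < κt) (n : ℕ) (data : ℕ → X) :
    (n : ℝ) ^ 2 * form S (accOutput η γ θ G r n data) (accOutput η γ θ G r n data)
      ≤ 3 * form T (accNoise S η γ θ G r n data (2 * n)) (accNoise S η γ θ G r n data (2 * n))
        + 200 * κt / η * (pot T mu (accIter η γ θ G r data n)
          + pot T mu (accIter η γ θ G r data (2 * n))) := by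
  have hη := hs.eta_pos
  have hγ := hs.gamma_pos
  rcases Nat.eq_zero_or_pos n with rfl | hn
  · have := pot_nonneg hp (accIter η γ θ G r data 0)
    simp only [accNoise, form]
    simp
    positivity
  have hnn : n ≤ 2 * n := by omega
  set s := accIter η γ θ G r data
  set M := accNoise S η γ θ G r n data (2 * n) with hM
  set Δ := ∑ j ∈ Finset.Ico n (2 * n), G (mid θ (s j)) (data (j + 1)) with hΔ
  have htel := sum_oracle (η := η) (γ := γ) (G := G) (r := r) hs.theta_pos data hnn
  have hy : ∑ j ∈ Finset.Ico n (2 * n), mid θ (s j) = T Δ - T M := by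
    have : S (∑ j ∈ Finset.Ico n (2 * n), mid θ (s j)) = Δ - M := by
      rw [hM, accNoise, Finset.sum_sub_distrib, map_sum]
      simp only [s, hΔ]
      abel
    rw [← map_sub, ← this, hp.left_inv]
  -- `x_{j+1} = y_j - η g_j`, and `∑ y_j` is recovered from `∑ g_j` by applying `T`
  have hx : (n : ℝ) • accOutput η γ θ G r n data = T Δ - T M - η • Δ := by
    rw [accOutput, smul_smul, mul_inv_cancel₀ (by positivity), one_smul, ← hy, hΔ,
      Finset.smul_sum, ← Finset.sum_sub_distrib]
    rfl
  rw [← form_smul_smul, hx]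
  refine (hp.form_sub_sub_le _ _ _).trans ?_
  rw [← hp.inv_self, ← hp.inv_self, form_smul_smul]
  have h1 : η ^ 2 * form S Δ Δ ≤ 1 / 256 * form T Δ Δ := by
    have h2 := mul_le_mul_of_nonneg_left (hp.form_le_inv hs.R2_nonneg Δ) (sq_nonneg η)
    have h3 : (R2 * η) ^ 2 ≤ (1 / 16) ^ 2 :=
      pow_le_pow_left₀ (mul_nonneg hs.R2_nonneg hη.le) hs.eta_R 2
    nlinarith [mul_le_mul_of_nonneg_right h3 (hp.inv_nonneg Δ)]
  have h4 : form T Δ Δ ≤ 64 * κt / η * (pot T mu (s n) + pot T mu (s (2 * n))) := by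
    have h5 := hp.inv_sub_le ((s n).1 + (s n).2) ((s (2 * n)).1 + (s (2 * n)).2)
    rw [← htel, form_smul_smul] at h5
    have h6 := mul_le_mul_of_nonneg_left h5 hp.mu_pos.le
    have h7 := inv_add_le_pot hp (s n)
    have h8 := inv_add_le_pot hp (s (2 * n))
    have h9 : mu * γ ^ 2 * form T Δ Δ ≤ mu * ((η + γ) ^ 2 * form T Δ Δ) := by
      rw [← mul_assoc]
      have := hp.inv_nonneg Δ
      have := hp.mu_pos
      gcongr
      linarith
    have h10 : mu * γ ^ 2 = η / (16 * κt) := by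
      rw [eq_div_iff (by positivity)]; linarith [hs.gamma_sq]
    rw [h10] at h9
    have h11 : η / (16 * κt) * form T Δ Δ ≤ 4 * (pot T mu (s n) + pot T mu (s (2 * n))) := by
      linarith
    calc form T Δ Δ = 16 * κt / η * (η / (16 * κt) * form T Δ Δ) := by field_simp
      _ ≤ 16 * κt / η * (4 * (pot T mu (s n) + pot T mu (s (2 * n)))) := by gcongr
      _ = _ := by ring
  have h12 : 0 ≤ κt / η * (pot T mu (s n) + pot T mu (s (2 * n))) :=
    mul_nonneg (by positivity) (add_nonneg (pot_nonneg hp _) (pot_nonneg hp _))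
  have h13 : 64 * κt / η * (pot T mu (s n) + pot T mu (s (2 * n)))
      = 64 * (κt / η * (pot T mu (s n) + pot T mu (s (2 * n)))) := by ring
  have h14 : 200 * κt / η * (pot T mu (s n) + pot T mu (s (2 * n)))
      = 200 * (κt / η * (pot T mu (s n) + pot T mu (s (2 * n)))) := by ring
  rw [h13] at h4
  rw [h14]
  linarith

lemma pot_start_le (hp : InversePair S T mu R2) (r : Vec d) :
    pot T mu (r, r) ≤ 2 / mu * form S r r := by
  have h1 := hp.mu_mul_inv_le r
  have h2 := hp.lower r
  have hmu := hp.mu_pos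
  have h3 : ‖r‖ ^ 2 ≤ 1 / mu * form S r r := by
    rw [div_mul_eq_mul_div, one_mul, le_div_iff₀ hmu]; linarith
  calc _ ≤ 2 * ‖r‖ ^ 2 := by simp only [pot]; linarith
    _ ≤ 2 * (1 / mu * form S r r) := by gcongr
    _ = _ := by ring

/-! ### Moments of the accelerated iterates -/

variable {D : Measure X} [IsProbabilityMeasure D] {Ω : Type*} [MeasurableSpace Ω] {P : Measure Ω}
  [IsProbabilityMeasure P] {ξ : ℕ → Ω → X}

/-- The `σ`-algebra generated by the samples with index at most `t`. -/
abbrev past (ξ : ℕ → Ω → X) (t : ℕ) : MeasurableSpace Ω :=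
  ⨆ i ∈ Set.Iic t, MeasurableSpace.comap (ξ i) inferInstance

lemma past_mono {s t : ℕ} (hst : s ≤ t) : past ξ s ≤ past ξ t :=
  biSup_mono fun _ hi => le_trans hi hst

lemma past_le (hξ : ∀ t, Measurable (ξ t)) (t : ℕ) : past ξ t ≤ ‹MeasurableSpace Ω› :=
  iSup₂_le fun i _ => (hξ i).comap_le

lemma measurable_past_self (t : ℕ) : Measurable[past ξ t] (ξ t) :=
  measurable_iff_comap_le.2 (le_biSup (fun i => MeasurableSpace.comap (ξ i) inferInstance)
    (Set.mem_Iic.2 le_rfl))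

lemma measurable_accIter_past (hG : Measurable fun q : Vec d × X => G q.1 q.2) (t : ℕ) :
    Measurable[past ξ t] fun ω => accIter η γ θ G r (fun i => ξ i ω) t := by
  induction t with
  | zero => exact measurable_const
  | succ t ih =>
    have h1 : Measurable[past ξ (t + 1)] fun ω =>
        (accIter η γ θ G r (fun i => ξ i ω) t, ξ (t + 1) ω) :=
      (ih.mono (past_mono t.le_succ) le_rfl).prodMk (measurable_past_self _)
    simp only [accIter_succ]
    have h2 := (measurable_accStep (η := η) (γ := γ) (θ := θ) hG).comp h1
    exact h2

lemma integral_le_of_le_combination {a b c₁ c₂ : Ω → ℝ} {k₁ k₂ : ℝ}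
    (ha : AEStronglyMeasurable a P) (ha0 : ∀ ω, 0 ≤ a ω) (hb : Integrable b P)
    (hc₁ : Integrable c₁ P) (hc₂ : Integrable c₂ P)
    (hle : ∀ ω, a ω ≤ k₁ * b ω + k₂ * (c₁ ω + c₂ ω)) :
    Integrable a P ∧ ∫ ω, a ω ∂P ≤ k₁ * ∫ ω, b ω ∂P + k₂ * (∫ ω, c₁ ω ∂P + ∫ ω, c₂ ω ∂P) := by
  have h1 : Integrable (fun ω => c₁ ω + c₂ ω) P := hc₁.add hc₂
  have h2 : Integrable (fun ω => k₁ * b ω + k₂ * (c₁ ω + c₂ ω)) P :=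
    (hb.const_mul k₁).add (h1.const_mul k₂)
  have h3 : Integrable a P := h2.mono' ha (.of_forall fun ω => by
    rw [Real.norm_of_nonneg (ha0 ω)]; exact hle ω)
  refine ⟨h3, (integral_mono h3 h2 hle).trans_eq ?_⟩
  rw [integral_add (hb.const_mul k₁) (h1.const_mul k₂), integral_const_mul, integral_const_mul,
    integral_add hc₁ hc₂]

lemma tailState_succ (n k : ℕ) (data : ℕ → X) :
    tailState S η γ θ G r n data (n + (k + 1))
      = tailStep S η γ θ G (tailState S η γ θ G r n data (n + k)) (data (n + k + 1)) :=
  Prod.ext rfl (Finset.sum_Ico_succ_top (Nat.le_add_right n k) _)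

lemma measurable_tailState_past (hG : Measurable fun q : Vec d × X => G q.1 q.2) (n k : ℕ) :
    Measurable[past ξ (n + k)] fun ω => tailState S η γ θ G r n (fun i => ξ i ω) (n + k) := by
  induction k with
  | zero =>
    have h0 : ∀ ω, tailState S η γ θ G r n (fun i => ξ i ω) (n + 0)
        = (accIter η γ θ G r (fun i => ξ i ω) n, 0) := fun ω => by
      simp [tailState, accNoise]
    simp only [h0]
    exact (measurable_accIter_past hG n).prodMk measurable_const
  | succ k ih =>
    have h1 : Measurable[past ξ (n + (k + 1))] fun ω =>
        (tailState S η γ θ G r n (fun i => ξ i ω) (n + k), ξ (n + k + 1) ω) :=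
      (ih.mono (past_mono (Nat.le_succ _)) le_rfl).prodMk (measurable_past_self _)
    simp only [tailState_succ]
    have h2 := (measurable_tailStep (S := S) (η := η) (γ := γ) (θ := θ) hG).comp h1
    exact h2

lemma measurable_accOutput (hG : Measurable fun q : Vec d × X => G q.1 q.2)
    (hξ : ∀ t, Measurable (ξ t)) (n : ℕ) :
    Measurable fun ω => accOutput η γ θ G r n fun i => ξ i ω := by
  have h1 : ∀ j, Measurable fun ω => (accIter η γ θ G r (fun i => ξ i ω) (j + 1)).1 := fun j =>
    ((measurable_accIter_past hG (j + 1)).mono (past_le hξ _) le_rfl).fst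
  have h2 : Measurable fun ω => ∑ j ∈ Finset.Ico n (2 * n),
      (accIter η γ θ G r (fun i => ξ i ω) (j + 1)).1 :=
    Finset.measurable_fun_sum _ fun j _ => h1 j
  exact h2.const_smul ((n : ℝ)⁻¹)

lemma integral_comp_law {f : X → ℝ} {Z : Ω → X} (hZ : Measurable Z) (hlaw : P.map Z = D)
    (hf : Integrable f D) :
    Integrable (fun ω => f (Z ω)) P ∧ ∫ ω, f (Z ω) ∂P = ∫ p, f p ∂D := by
  subst hlaw
  exact ⟨hf.comp_measurable hZ, (integral_map hZ.aemeasurable hf.1).symm⟩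

variable (hp : InversePair S T mu R2) (hG : Oracle D S T R2 κt σ2 σi G)
  (hs : StepSizes mu R2 κt η γ θ) (hξ : ∀ t, Measurable (ξ t)) (hlaw : ∀ t, P.map (ξ t) = D)
  (hind : iIndepFun ξ P)

lemma indepFun_next {α : Type*} [MeasurableSpace α] (hξ : ∀ t, Measurable (ξ t))
    (hind : iIndepFun ξ P) {t : ℕ} {f : Ω → α} (hf : Measurable[past ξ t] f) :
    IndepFun f (ξ (t + 1)) P := by
  refine indepFun_of_measurable_iSup hξ hind (A := Set.Iic t) (B := {t + 1}) (by simp) hf ?_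
  rw [iSup_singleton]
  exact comap_measurable _

include hp hG hs hξ hlaw hind

/-- The expected potential decays geometrically up to the noise level. -/
lemma pot_moment (hN : 0 ≤ 2 * η ^ 2 * σ2 + 2 * mu * γ ^ 2 * σi) (t : ℕ) :
    Integrable (fun ω => pot T mu (accIter η γ θ G r (fun i => ξ i ω) t)) P ∧
    ∫ ω, pot T mu (accIter η γ θ G r (fun i => ξ i ω) t) ∂P
      ≤ (1 - θ) ^ t * pot T mu (r, r) + (2 * η ^ 2 * σ2 + 2 * mu * γ ^ 2 * σi) / θ := by
  set N := 2 * η ^ 2 * σ2 + 2 * mu * γ ^ 2 * σi with hNdef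
  have hθ := hs.theta_pos
  induction t with
  | zero =>
    simp only [accIter, integrable_const, integral_const, true_and]
    have : 0 ≤ N / θ := by positivity
    simpa using this
  | succ t ih =>
    obtain ⟨ih1, ih2⟩ := ih
    have hm := measurable_accIter_past (η := η) (γ := γ) (θ := θ) (r := r) (ξ := ξ) hG.meas t
    have hstep : ∀ s, Integrable
        (fun ω => pot T mu (accStep η γ θ (fun y => G y (ξ (t + 1) ω)) s)) P ∧
        ∫ ω, pot T mu (accStep η γ θ (fun y => G y (ξ (t + 1) ω)) s) ∂P
          ≤ (1 - θ) * pot T mu s + N := by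
      intro s
      obtain ⟨h1, h2⟩ := pot_step hp hG hs s
      obtain ⟨h3, h4⟩ := integral_comp_law (hξ (t + 1)) (hlaw (t + 1)) h1
      refine ⟨h3, h4.trans_le (h2.trans ?_)⟩
      have := mul_nonneg hs.eta_pos.le (hp.nonneg (mid θ s))
      linarith
    have hV := (ih1.const_mul (1 - θ)).add (integrable_const N)
    obtain ⟨h1, h2⟩ := integral_le_of_indepFun (W := fun s p =>
        pot T mu (accStep η γ θ (fun y => G y p) s)) (V := fun s => (1 - θ) * pot T mu s + N)
      (hm.mono (past_le hξ t) le_rfl) (hξ (t + 1)) (indepFun_next hξ hind hm)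
      ((measurable_pot T mu).comp (measurable_accStep (η := η) (γ := γ) (θ := θ) hG.meas))
      (fun _ _ => pot_nonneg hp _) hV (fun s => (hstep s).1) (fun s => (hstep s).2)
    simp only [accIter_succ]
    refine ⟨h1, h2.trans ?_⟩
    rw [integral_add (ih1.const_mul (1 - θ)) (integrable_const N), integral_const_mul]
    have h3 := mul_le_mul_of_nonneg_left ih2 (sub_nonneg.2 hs.theta_le)
    have h4 : (1 - θ) * (N / θ) + N = N / θ := by field_simp; ring
    simp only [integral_const, probReal_univ, one_smul]
    rw [pow_succ]
    linarith

/-- Second moment of the accumulated gradient noise over the steps after `n`. -/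
lemma tailPot_moment (hκ : 0 ≤ κt) (hN : 0 ≤ 2 * η ^ 2 * σ2 + 2 * mu * γ ^ 2 * σi) (n k : ℕ) :
    Integrable (fun ω => tailPot T mu (8 * κt / (7 * η))
      (tailState S η γ θ G r n (fun i => ξ i ω) (n + k))) P ∧
    ∫ ω, tailPot T mu (8 * κt / (7 * η)) (tailState S η γ θ G r n (fun i => ξ i ω) (n + k)) ∂P
      ≤ 8 * κt / (7 * η) * ((1 - θ) ^ n * pot T mu (r, r)
          + (2 * η ^ 2 * σ2 + 2 * mu * γ ^ 2 * σi) / θ)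
        + k * (2 * σi + 8 * κt / (7 * η) * (2 * η ^ 2 * σ2 + 2 * mu * γ ^ 2 * σi)) := by
  have hη := hs.eta_pos
  have hc : (0 : ℝ) ≤ 8 * κt / (7 * η) := by positivity
  have hstep := fun q => tailPot_step hp hG hs hκ q
  set c := 8 * κt / (7 * η)
  set N := 2 * η ^ 2 * σ2 + 2 * mu * γ ^ 2 * σi with hNdef
  induction k with
  | zero =>
    obtain ⟨h1, h2⟩ := pot_moment (r := r) hp hG hs hξ hlaw hind hN n
    have h0 : ∀ ω, tailPot T mu c (tailState S η γ θ G r n (fun i => ξ i ω) (n + 0))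
        = c * pot T mu (accIter η γ θ G r (fun i => ξ i ω) n) := by
      intro ω; simp [tailPot, tailState, accNoise, form]
    simp only [h0]
    refine ⟨h1.const_mul _, ?_⟩
    rw [integral_const_mul]
    simpa using mul_le_mul_of_nonneg_left h2 hc
  | succ k ih =>
    obtain ⟨ih1, ih2⟩ := ih
    have hm := measurable_tailState_past (S := S) (η := η) (γ := γ) (θ := θ) (r := r) (ξ := ξ)
      hG.meas n k
    have hV : Integrable (fun ω => tailPot T mu c
        (tailState S η γ θ G r n (fun i => ξ i ω) (n + k)) + (2 * σi + c * N)) P :=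
      ih1.add (integrable_const _)
    have hWm : Measurable fun q : ((Vec d × Vec d) × Vec d) × X =>
        tailPot T mu c (tailStep S η γ θ G q.1 q.2) :=
      (measurable_tailPot T mu c).comp
        (measurable_tailStep (S := S) (η := η) (γ := γ) (θ := θ) hG.meas)
    have hfresh := fun q => integral_comp_law (hξ (n + k + 1)) (hlaw (n + k + 1)) (hstep q).1
    obtain ⟨h1, h2⟩ := integral_le_of_indepFun
      (W := fun q p => tailPot T mu c (tailStep S η γ θ G q p))
      (V := fun q => tailPot T mu c q + (2 * σi + c * N))
      (hm.mono (past_le hξ _) le_rfl) (hξ (n + k + 1)) (indepFun_next hξ hind hm) hWm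
      (fun _ _ => add_nonneg (hp.inv_nonneg _) (mul_nonneg hc (pot_nonneg hp _)))
      hV (fun q => (hfresh q).1) (fun q => (hfresh q).2.trans_le (hstep q).2)
    simp only [tailState_succ]
    refine ⟨h1, h2.trans ?_⟩
    rw [integral_add ih1 (integrable_const _)]
    simp only [integral_const, probReal_univ, one_smul, Nat.cast_add, Nat.cast_one]
    linarith

/-- Second moment of the tail average: a variance of order `1 / n` and an exponentially small
contribution of the starting point. The terms divided by `θ`, which come from the stationary size of
the potential, are absorbed because `n θ` exceeds the constant `404`. -/
theorem accOutput_moment (hκ : 0 < κt) (hσ2 : 0 ≤ σ2) (hσi : 0 ≤ σi) {n : ℕ}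
    (hn : 404 ≤ n * θ) :
    Integrable (fun ω => form S (accOutput η γ θ G r n fun i => ξ i ω)
      (accOutput η γ θ G r n fun i => ξ i ω)) P ∧
    ∫ ω, form S (accOutput η γ θ G r n fun i => ξ i ω)
      (accOutput η γ θ G r n fun i => ξ i ω) ∂P
      ≤ (7 * σi + 9 * η * κt * σ2) / n + (1 - θ) ^ n * form S r r := by
  have hη := hs.eta_pos
  have hθ := hs.theta_pos
  have hγ := hs.gamma_pos
  have hmu := hp.mu_pos
  have hn0 : (0 : ℝ) < n := by
    by_contra! hc
    nlinarith
  have hN : 0 ≤ 2 * η ^ 2 * σ2 + 2 * mu * γ ^ 2 * σi := by positivity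
  have hm : Measurable fun ω => form S (accOutput η γ θ G r n fun i => ξ i ω)
      (accOutput η γ θ G r n fun i => ξ i ω) :=
    (continuous_form_self S).measurable.comp (measurable_accOutput hG.meas hξ n)
  obtain ⟨i1, e1⟩ := pot_moment (r := r) hp hG hs hξ hlaw hind hN n
  obtain ⟨i2, e2⟩ := pot_moment (r := r) hp hG hs hξ hlaw hind hN (2 * n)
  obtain ⟨i3, e3⟩ := tailPot_moment (r := r) hp hG hs hξ hlaw hind hκ.le hN n n
  rw [← two_mul] at i3 e3
  have hNval : κt / η * (2 * η ^ 2 * σ2 + 2 * mu * γ ^ 2 * σi) = 2 * η * κt * σ2 + σi / 8 := by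
    have h1 : κt / η * (2 * η ^ 2 * σ2 + 2 * mu * γ ^ 2 * σi)
        = 2 * η * κt * σ2 + 2 * (mu * γ ^ 2 * κt) * σi / η := by field_simp
    rw [h1, hs.gamma_sq]; field_simp; ring
  set N := 2 * η ^ 2 * σ2 + 2 * mu * γ ^ 2 * σi with hNdef
  set c := 8 * κt / (7 * η) with hc
  have hc0 : 0 ≤ c := by positivity
  set ρ := (1 - θ) ^ n with hρ
  have hρ0 : 0 ≤ ρ := pow_nonneg (sub_nonneg.2 hs.theta_le) _
  have hρ2 : (1 - θ) ^ (2 * n) ≤ ρ :=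
    pow_le_pow_of_le_one (sub_nonneg.2 hs.theta_le) (by linarith) (by omega)
  have hp0 := pot_nonneg hp (r, r)
  have hps := pot_start_le hp r
  have hpt : ∀ ω, (n : ℝ) ^ 2 * form S (accOutput η γ θ G r n fun i => ξ i ω)
      (accOutput η γ θ G r n fun i => ξ i ω)
      ≤ 3 * tailPot T mu c (tailState S η γ θ G r n (fun i => ξ i ω) (2 * n))
      + 200 * κt / η * (pot T mu (accIter η γ θ G r (fun i => ξ i ω) n)
        + pot T mu (accIter η γ θ G r (fun i => ξ i ω) (2 * n))) := by
    intro ω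
    have h1 := form_accOutput_le (G := G) (r := r) hp hs hκ n fun i => ξ i ω
    have h2 := mul_nonneg hc0 (pot_nonneg hp (accIter η γ θ G r (fun i => ξ i ω) (2 * n)))
    simp only [tailPot, tailState]
    linarith
  obtain ⟨hint, hmono⟩ := integral_le_of_le_combination
    (hm.const_mul _).aestronglyMeasurable
    (fun ω => mul_nonneg (sq_nonneg _) (hp.nonneg _)) i3 i1 i2 hpt
  have hint' : Integrable (fun ω => form S (accOutput η γ θ G r n fun i => ξ i ω)
      (accOutput η γ θ G r n fun i => ξ i ω)) P := by
    have := hint.const_mul ((n : ℝ) ^ 2)⁻¹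
    simpa only [inv_mul_cancel_left₀ (pow_ne_zero 2 hn0.ne')] using this
  refine ⟨hint', ?_⟩
  rw [integral_const_mul] at hmono
  set E := ∫ ω, form S (accOutput η γ θ G r n fun i => ξ i ω)
      (accOutput η γ θ G r n fun i => ξ i ω) ∂P
  have hA : κt / η * (ρ * pot T mu (r, r)) ≤ n ^ 2 / 404 * (ρ * form S r r) := by
    have hκη : κt / (η * mu) = 1 / (16 * θ ^ 2) := by
      have h1 := hs.gamma_sq
      have h2 := hs.mu_gamma
      rw [div_eq_div_iff (by positivity) (by positivity), ← h2]
      have h3 : κt * (16 * (mu * γ) ^ 2) = 16 * mu * (mu * γ ^ 2 * κt) := by ring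
      rw [h3, h1]; ring
    have h1 : κt / η * (ρ * pot T mu (r, r)) ≤ κt / η * (ρ * (2 / mu * form S r r)) := by
      gcongr
    have h2 : κt / η * (ρ * (2 / mu * form S r r))
        = 2 * (κt / (η * mu)) * (ρ * form S r r) := by field_simp
    rw [h2, hκη] at h1
    refine h1.trans (mul_le_mul_of_nonneg_right ?_ (mul_nonneg hρ0 (hp.nonneg r)))
    rw [le_div_iff₀ (by norm_num), mul_one_div, div_mul_eq_mul_div, div_le_iff₀ (by positivity)]
    nlinarith
  have hB : κt / η * (N / θ) ≤ n / 404 * (κt / η * N) := by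
    have h1 : κt / η * (N / θ) = (1 / θ) * (κt / η * N) := by ring
    rw [h1]
    refine mul_le_mul_of_nonneg_right ?_ (by positivity)
    rw [div_le_div_iff₀ hθ (by norm_num)]; linarith
  rw [hNval] at hB
  have e2' : ∫ ω, pot T mu (accIter η γ θ G r (fun i => ξ i ω) (2 * n)) ∂P
      ≤ ρ * pot T mu (r, r) + N / θ := by
    refine e2.trans ?_
    gcongr
  have h1 : (200 * κt / η) * (∫ ω, pot T mu (accIter η γ θ G r (fun i => ξ i ω) n) ∂P
        + ∫ ω, pot T mu (accIter η γ θ G r (fun i => ξ i ω) (2 * n)) ∂P)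
      ≤ (200 * κt / η) * (2 * (ρ * pot T mu (r, r) + N / θ)) := by
    gcongr; linarith
  have hcc : ∀ x, c * x = 8 / 7 * (κt / η * x) := by intro x; rw [hc]; field_simp
  rw [hcc, hcc, hNval, mul_add (κt / η)] at e3
  have h2 : (200 * κt / η) * (2 * (ρ * pot T mu (r, r) + N / θ))
      = 400 * (κt / η * (ρ * pot T mu (r, r))) + 400 * (κt / η * (N / θ)) := by ring
  rw [h2] at h1
  have hfin : (n : ℝ) ^ 2 * E ≤ n * (7 * σi + 9 * η * κt * σ2) + n ^ 2 * (ρ * form S r r) := by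
    have hx1 : 0 ≤ (n : ℝ) * σi := by positivity
    have hx2 : 0 ≤ (n : ℝ) * (η * κt * σ2) := by positivity
    have hx3 : 0 ≤ (n : ℝ) ^ 2 * (ρ * form S r r) := by
      have := hp.nonneg r
      positivity
    linarith
  have hre : (7 * σi + 9 * η * κt * σ2) / n + ρ * form S r r
      = (n * (7 * σi + 9 * η * κt * σ2) + n ^ 2 * (ρ * form S r r)) / n ^ 2 := by
    field_simp
  rw [hre, le_div_iff₀ (by positivity)]
  linarith

end Chain

/-! ### The mean of the accelerated iterates -/

section Mean

variable {d : ℕ} {X : Type*} [MeasurableSpace X]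
  {S T : Vec d →L[ℝ] Vec d} {mu R2 κt σ2 σi η γ θ : ℝ} {G : Vec d → X → Vec d} {r : Vec d}
  {D : Measure X} [IsProbabilityMeasure D] {Ω : Type*} [MeasurableSpace Ω] {P : Measure Ω}
  [IsProbabilityMeasure P] {ξ : ℕ → Ω → X}

/-- The noiseless iteration, driven by `S` itself. -/
abbrev meanIter (S : Vec d →L[ℝ] Vec d) (η γ θ : ℝ) (r : Vec d) (t : ℕ) : Vec d × Vec d :=
  accIter η γ θ (fun y (_ : Unit) => S y) r (fun _ => ()) t

lemma oracle_exact (hp : InversePair S T mu R2) (hR : 0 ≤ R2) (hκ : 1 ≤ κt) :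
    Oracle (Measure.dirac ()) S T R2 κt 0 0 fun y _ => S y where
  meas := S.continuous.measurable.comp measurable_fst
  integrable y := integrable_const _
  mean y := by simp
  sq_le y := by
    have h1 := hp.norm_apply_sq_le hR y
    have h2 := mul_nonneg hR (hp.nonneg y)
    simp only [integral_const, probReal_univ, one_smul]
    linarith
  inv_le y := by
    have h1 := hp.nonneg y
    simp only [integral_const, probReal_univ, one_smul, hp.form_inv_apply_right]
    change form S y y ≤ _
    nlinarith

lemma pot_meanIter (hp : InversePair S T mu R2) (hs : StepSizes mu R2 κt η γ θ) (hκ : 1 ≤ κt)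
    (t : ℕ) : pot T mu (meanIter S η γ θ r t) ≤ (1 - θ) ^ t * pot T mu (r, r) := by
  induction t with
  | zero => simp [meanIter, accIter]
  | succ t ih =>
    have h1 := (pot_step hp (oracle_exact hp hs.R2_nonneg hκ) hs (meanIter S η γ θ r t)).2
    simp only [integral_const, probReal_univ, one_smul, mul_zero, add_zero] at h1
    have h2 := mul_nonneg hs.eta_pos.le (hp.nonneg (mid θ (meanIter S η γ θ r t)))
    have h3 := mul_le_mul_of_nonneg_left ih (sub_nonneg.2 hs.theta_le)
    rw [meanIter, accIter_succ, pow_succ]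
    linarith

variable (hp : InversePair S T mu R2) (hG : Oracle D S T R2 κt σ2 σi G)
  (hs : StepSizes mu R2 κt η γ θ) (hξ : ∀ t, Measurable (ξ t)) (hlaw : ∀ t, P.map (ξ t) = D)
  (hind : iIndepFun ξ P)
include hp hG hs hξ hlaw hind

lemma integrable_accIter (hN : 0 ≤ 2 * η ^ 2 * σ2 + 2 * mu * γ ^ 2 * σi) (t : ℕ) :
    Integrable (fun ω => (accIter η γ θ G r (fun i => ξ i ω) t).1) P ∧
    Integrable (fun ω => (accIter η γ θ G r (fun i => ξ i ω) t).2) P := by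
  have hm : Measurable fun ω => accIter η γ θ G r (fun i => ξ i ω) t :=
    (measurable_accIter_past hG.meas t).mono (past_le hξ _) le_rfl
  have hpot := (pot_moment (r := r) hp hG hs hξ hlaw hind hN t).1
  have hmu := hp.mu_pos
  constructor
  · refine integrable_of_sq hm.fst.aestronglyMeasurable
      (hpot.mono' (hm.fst.norm.pow_const 2).aestronglyMeasurable (.of_forall fun ω => ?_))
    rw [Real.norm_of_nonneg (sq_nonneg _)]
    have := mul_nonneg hmu.le (hp.inv_nonneg (accIter η γ θ G r (fun i => ξ i ω) t).2)
    simp only [pot]; linarith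
  · refine integrable_of_sq hm.snd.aestronglyMeasurable
      ((hpot.const_mul (R2 / mu)).mono' (hm.snd.norm.pow_const 2).aestronglyMeasurable
        (.of_forall fun ω => ?_))
    rw [Real.norm_of_nonneg (sq_nonneg _)]
    set s := accIter η γ θ G r (fun i => ξ i ω) t
    have h1 := hp.norm_sq_le_inv hs.R2_nonneg s.2
    have h2 := hs.R2_nonneg
    calc ‖s.2‖ ^ 2 ≤ R2 * form T s.2 s.2 := h1
      _ = R2 / mu * (mu * form T s.2 s.2) := by field_simp
      _ ≤ R2 / mu * pot T mu s := by
        gcongr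
        simp only [pot]; linarith [sq_nonneg ‖s.1‖]

/-- The iterates are unbiased for the noiseless iteration. -/
lemma integral_accIter (hN : 0 ≤ 2 * η ^ 2 * σ2 + 2 * mu * γ ^ 2 * σi) (t : ℕ) :
    ∫ ω, (accIter η γ θ G r (fun i => ξ i ω) t).1 ∂P = (meanIter S η γ θ r t).1 ∧
    ∫ ω, (accIter η γ θ G r (fun i => ξ i ω) t).2 ∂P = (meanIter S η γ θ r t).2 := by
  induction t with
  | zero => simp [meanIter, accIter]
  | succ t ih =>
    obtain ⟨ih1, ih2⟩ := ih
    have hpast := measurable_accIter_past (η := η) (γ := γ) (θ := θ) (r := r) (ξ := ξ) hG.meas t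
    have hm : Measurable fun ω => accIter η γ θ G r (fun i => ξ i ω) t :=
      hpast.mono (past_le hξ _) le_rfl
    obtain ⟨i1, i2⟩ := integrable_accIter (r := r) hp hG hs hξ hlaw hind hN t
    obtain ⟨j1, -⟩ := integrable_accIter (r := r) hp hG hs hξ hlaw hind hN (t + 1)
    have iy : Integrable (fun ω => mid θ (accIter η γ θ G r (fun i => ξ i ω) t)) P :=
      (i1.smul (1 / (1 + θ))).add (i2.smul (θ / (1 + θ)))
    have i1' : Integrable (fun ω => (1 / (1 + θ)) • (accIter η γ θ G r (fun i => ξ i ω) t).1) P :=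
      i1.smul (1 / (1 + θ))
    have i2' : Integrable (fun ω => (θ / (1 + θ)) • (accIter η γ θ G r (fun i => ξ i ω) t).2) P :=
      i2.smul (θ / (1 + θ))
    have ey : ∫ ω, mid θ (accIter η γ θ G r (fun i => ξ i ω) t) ∂P
        = mid θ (meanIter S η γ θ r t) := by
      simp only [mid]
      rw [integral_add i1' i2', integral_smul, integral_smul, ih1, ih2]
    have ig : Integrable (fun ω => G (mid θ (accIter η γ θ G r (fun i => ξ i ω) t))
        (ξ (t + 1) ω)) P := by
      have h1 := (iy.sub j1).smul η⁻¹
      refine h1.congr (.of_forall fun ω => ?_)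
      simp only [accIter_succ, accStep, Pi.smul_apply, Pi.sub_apply, sub_sub_cancel]
      rw [smul_smul, inv_mul_cancel₀ hs.eta_pos.ne', one_smul]
    have eg : ∫ ω, G (mid θ (accIter η γ θ G r (fun i => ξ i ω) t)) (ξ (t + 1) ω) ∂P
        = S (mid θ (meanIter S η γ θ r t)) := by
      have h1 := integral_of_indepFun hm (hξ (t + 1)) (indepFun_next hξ hind hpast)
        (g := fun s p => G (mid θ s) p) (measurable_oracle_mid hG.meas).stronglyMeasurable ig
      rw [h1, ← ey, ← ContinuousLinearMap.integral_comp_comm S iy]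
      refine integral_congr_ae (.of_forall fun ω => ?_)
      simp only
      rw [← hG.mean, ← hlaw (t + 1)]
      exact (integral_map (hξ (t + 1)).aemeasurable (hG.meas.comp
        (measurable_const.prodMk measurable_id)).aestronglyMeasurable).symm
    simp only [meanIter, accIter_succ, accStep]
    constructor
    · have k1 : Integrable (fun ω => η • G (mid θ (accIter η γ θ G r (fun i => ξ i ω) t))
          (ξ (t + 1) ω)) P := ig.smul η
      rw [integral_sub iy k1, integral_smul, ey, eg]
    · have k1 : Integrable (fun ω => θ • mid θ (accIter η γ θ G r (fun i => ξ i ω) t)) P :=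
        iy.smul θ
      have k2 : Integrable (fun ω => (1 - θ) • (accIter η γ θ G r (fun i => ξ i ω) t).2) P :=
        i2.smul (1 - θ)
      have k3 : Integrable (fun ω => γ • G (mid θ (accIter η γ θ G r (fun i => ξ i ω) t))
          (ξ (t + 1) ω)) P := ig.smul γ
      have k4 : Integrable (fun ω => θ • mid θ (accIter η γ θ G r (fun i => ξ i ω) t)
          + (1 - θ) • (accIter η γ θ G r (fun i => ξ i ω) t).2) P := k1.add k2
      rw [integral_sub k4 k3, integral_add k1 k2, integral_smul, integral_smul, integral_smul, ey,
        eg, ih2]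

lemma integrable_accOutput (hN : 0 ≤ 2 * η ^ 2 * σ2 + 2 * mu * γ ^ 2 * σi) (n : ℕ) :
    Integrable (fun ω => accOutput η γ θ G r n fun i => ξ i ω) P := by
  have h1 : Integrable (fun ω => ∑ j ∈ Finset.Ico n (2 * n),
      (accIter η γ θ G r (fun i => ξ i ω) (j + 1)).1) P :=
    integrable_finsetSum _ fun j _ => (integrable_accIter hp hG hs hξ hlaw hind hN (j + 1)).1
  exact h1.smul ((n : ℝ)⁻¹)

/-- The mean of the tail average is exponentially small in the length of the tail. -/
theorem form_integral_accOutput_le (hκ : 1 ≤ κt) {lam : ℝ} (hlam : 0 ≤ lam)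
    (hup : ∀ x, form S x x ≤ lam * ‖x‖ ^ 2)
    (hN : 0 ≤ 2 * η ^ 2 * σ2 + 2 * mu * γ ^ 2 * σi) (n : ℕ) :
    form S (∫ ω, accOutput η γ θ G r n (fun i => ξ i ω) ∂P)
      (∫ ω, accOutput η γ θ G r n (fun i => ξ i ω) ∂P)
      ≤ 2 * (lam / mu) * (1 - θ) ^ n * form S r r := by
  have hmu := hp.mu_pos
  have hθ1 := sub_nonneg.2 hs.theta_le
  set ρ := (1 - θ) ^ n with hρ
  have hρ0 : 0 ≤ ρ := pow_nonneg hθ1 _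
  have hp0 := pot_nonneg hp (r, r)
  have h1 : ∫ ω, accOutput η γ θ G r n (fun i => ξ i ω) ∂P
      = (n : ℝ)⁻¹ • ∑ j ∈ Finset.Ico n (2 * n), (meanIter S η γ θ r (j + 1)).1 := by
    simp only [accOutput]
    rw [integral_smul, integral_finsetSum _ fun j _ =>
      (integrable_accIter hp hG hs hξ hlaw hind hN (j + 1)).1]
    congr 1
    exact Finset.sum_congr rfl fun j _ => (integral_accIter hp hG hs hξ hlaw hind hN (j + 1)).1
  have h2 : ∀ j ∈ Finset.Ico n (2 * n), ‖(meanIter S η γ θ r (j + 1)).1‖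
      ≤ √(ρ * pot T mu (r, r)) := by
    intro j hj
    refine Real.le_sqrt_of_sq_le ?_
    have h3 := pot_meanIter (r := r) hp hs hκ (j + 1)
    have h4 : (1 - θ) ^ (j + 1) ≤ ρ := pow_le_pow_of_le_one hθ1 (by linarith [hs.theta_pos])
      ((Finset.mem_Ico.1 hj).1.trans j.le_succ)
    have h5 := mul_le_mul_of_nonneg_right h4 hp0
    have h6 := mul_nonneg hmu.le (hp.inv_nonneg (meanIter S η γ θ r (j + 1)).2)
    simp only [pot] at *
    linarith
  have h3 : ‖∫ ω, accOutput η γ θ G r n (fun i => ξ i ω) ∂P‖ ≤ √(ρ * pot T mu (r, r)) := by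
    rw [h1, norm_smul, norm_inv, Real.norm_natCast]
    have h4 := norm_sum_le_of_le _ h2
    rw [Finset.sum_const, Nat.card_Ico, nsmul_eq_mul, show 2 * n - n = n by omega] at h4
    rcases Nat.eq_zero_or_pos n with h0 | h0
    · simp [h0]
    · have h0' : (0 : ℝ) < n := by exact_mod_cast h0
      rw [inv_mul_le_iff₀ h0']
      exact h4
  have h5 : ‖∫ ω, accOutput η γ θ G r n (fun i => ξ i ω) ∂P‖ ^ 2 ≤ ρ * pot T mu (r, r) := by
    have := pow_le_pow_left₀ (norm_nonneg _) h3 2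
    rwa [Real.sq_sqrt (by positivity)] at this
  calc _ ≤ lam * ‖∫ ω, accOutput η γ θ G r n (fun i => ξ i ω) ∂P‖ ^ 2 := hup _
    _ ≤ lam * (ρ * (2 / mu * form S r r)) := by
      gcongr
      exact h5.trans (by gcongr; exact pot_start_le hp r)
    _ = _ := by ring

end Mean

/-! ### The inner loop as an approximate proximal step -/

section Inner

variable {d : ℕ} {Y : Type u} [MeasurableSpace Y] {D : Measure (Vec d × Y)}
  [IsProbabilityMeasure D] {ℓ : ℝ → Y → ℝ} {Lℓ μℓ : ℝ}
  {xs : Vec d} {S T : Vec d →L[ℝ] Vec d} {mu R2 κt : ℝ}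

/-- The displacement `h S⁻¹ ∇F(ỹ)` of the exact preconditioned gradient step. -/
def exactStep (D : Measure (Vec d × Y)) (ℓ : ℝ → Y → ℝ) (T : Vec d →L[ℝ] Vec d) (h : ℝ)
    (yt : Vec d) : Vec d := h • T (gradRisk D ℓ yt)

/-- The stochastic gradient of the inner loop in coordinates centred at the exact preconditioned
gradient step `ỹ - h S⁻¹ ∇F(ỹ)`. -/
def innerOracle (D : Measure (Vec d × Y)) (ℓ : ℝ → Y → ℝ) (T : Vec d →L[ℝ] Vec d) (h : ℝ)
    (yt y : Vec d) (p : Vec d × Y) : Vec d :=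
  (inner ℝ p.1 y + h * (lossDeriv ℓ (inner ℝ p.1 yt) p.2 - inner ℝ p.1 (T (gradRisk D ℓ yt)))) •
    p.1

lemma innerIter_eq (h η γ θ : ℝ) (hθ : 0 < θ) (yt : Vec d) (data : ℕ → Vec d × Y) (t : ℕ) :
    innerIter ℓ η γ θ h yt data t
      = accIter η γ θ (innerOracle D ℓ T h yt) (exactStep D ℓ T h yt) data t
        + (yt - exactStep D ℓ T h yt, yt - exactStep D ℓ T h yt) := by
  induction t with
  | zero => simp [innerIter, accIter]
  | succ t ih =>
    rw [innerIter, accIter_succ, ih]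
    set s := accIter η γ θ (innerOracle D ℓ T h yt) (exactStep D ℓ T h yt) data t
    set w := yt - exactStep D ℓ T h yt with hw
    have h1 : (1 + θ) ≠ 0 := by positivity
    have hmid : (1 / (1 + θ)) • (s + (w, w)).1 + (θ / (1 + θ)) • (s + (w, w)).2
        = mid θ s + w := by
      have h2 : w = (1 / (1 + θ) + θ / (1 + θ)) • w := by
        rw [← add_div, div_self h1, one_smul]
      simp only [mid, Prod.fst_add, Prod.snd_add]
      nth_rewrite 3 [h2]
      module
    have hg : (h * lossDeriv ℓ (inner ℝ (data (t + 1)).1 yt) (data (t + 1)).2) • (data (t + 1)).1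
        + (inner ℝ (data (t + 1)).1 (mid θ s + w - yt)) • (data (t + 1)).1
        = innerOracle D ℓ T h yt (mid θ s) (data (t + 1)) := by
      rw [innerOracle, ← add_smul, hw, exactStep]
      congr 1
      rw [inner_sub_right, inner_add_right, inner_sub_right, real_inner_smul_right]
      ring
    simp only [innerStep]
    rw [hmid, hg]
    simp only [accStep, Prod.fst_add, Prod.snd_add, Prod.ext_iff]
    constructor <;> module

lemma innerOutput_eq (h η γ θ : ℝ) (hθ : 0 < θ) (yt : Vec d) (data : ℕ → Vec d × Y) {n : ℕ}
    (hn : 0 < n) :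
    innerOutput ℓ η γ θ h (2 * n) yt data
      = accOutput η γ θ (innerOracle D ℓ T h yt) (exactStep D ℓ T h yt) n data
        + (yt - exactStep D ℓ T h yt) := by
  have hn0 : (n : ℝ) ≠ 0 := by positivity
  have h1 : Finset.Icc (2 * n / 2 + 1) (2 * n) = Finset.Ico (n + 1) (2 * n + 1) := by
    rw [Nat.mul_div_cancel_left n two_pos]; rfl
  have h2 : (2 : ℝ) / ((2 * n : ℕ) : ℝ) = (n : ℝ)⁻¹ := by push_cast; field_simp
  rw [innerOutput, accOutput, h1, h2, ← Finset.sum_Ico_add' _ n (2 * n) 1]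
  simp only [innerIter_eq (D := D) (T := T) h η γ θ hθ, Prod.fst_add]
  rw [Finset.sum_add_distrib, smul_add, Finset.sum_const, Nat.card_Ico,
    show 2 * n - n = n by omega, ← Nat.cast_smul_eq_nsmul ℝ, smul_smul, inv_mul_cancel₀ hn0,
    one_smul]

namespace Problem

variable (hP : Problem D ℓ Lℓ μℓ xs S T mu R2 κt)
include hP

lemma measurable_innerOracle (h : ℝ) (yt : Vec d) :
    Measurable fun q : Vec d × (Vec d × Y) => innerOracle D ℓ T h yt q.1 q.2 := by
  have h1 : Measurable fun q : Vec d × (Vec d × Y) => lossDeriv ℓ (inner ℝ q.2.1 yt) q.2.2 :=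
    (hP.measurable_lossDeriv_at yt).comp measurable_snd
  unfold innerOracle
  fun_prop

/-- A pointwise bound on the squared length of the stochastic gradient in any quadratic form. -/
lemma innerOracle_sq_le {w : ℝ} (hw : 0 ≤ w) (h : ℝ) (yt y : Vec d) (p : Vec d × Y) :
    (inner ℝ p.1 y + h * (lossDeriv ℓ (inner ℝ p.1 yt) p.2
      - inner ℝ p.1 (T (gradRisk D ℓ yt)))) ^ 2 * w
    ≤ 2 * (inner ℝ p.1 y ^ 2 * w) + 6 * h ^ 2 * (lossDeriv ℓ (inner ℝ p.1 xs) p.2 ^ 2 * w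
      + (lossDeriv ℓ (inner ℝ p.1 yt) p.2 - lossDeriv ℓ (inner ℝ p.1 xs) p.2) ^ 2 * w
      + inner ℝ p.1 (T (gradRisk D ℓ yt)) ^ 2 * w) := by
  set a : ℝ := inner ℝ p.1 y
  set b := lossDeriv ℓ (inner ℝ p.1 yt) p.2
  set b' := lossDeriv ℓ (inner ℝ p.1 xs) p.2
  set c : ℝ := inner ℝ p.1 (T (gradRisk D ℓ yt))
  have h1 : (a + h * (b - c)) ^ 2 ≤ 2 * a ^ 2 + 2 * (h ^ 2 * (b - c) ^ 2) := by
    nlinarith [sq_nonneg (a - h * (b - c))]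
  have h2 : (b - c) ^ 2 ≤ 3 * (b' ^ 2 + (b - b') ^ 2 + c ^ 2) := by
    nlinarith [sq_nonneg (b' - (b - b')), sq_nonneg (b' + c), sq_nonneg (b - b' + c)]
  have h3 := mul_le_mul_of_nonneg_left h2 (sq_nonneg h)
  have h4 : (a + h * (b - c)) ^ 2 ≤ 2 * a ^ 2 + 6 * h ^ 2 * (b' ^ 2 + (b - b') ^ 2 + c ^ 2) := by
    linarith
  refine (mul_le_mul_of_nonneg_right h4 hw).trans_eq ?_
  ring

/-- Second moment of the stochastic gradient in the norm of an operator `A`, given the moment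
constant `k` and the noise constant `b` for that norm. -/
lemma innerOracle_moment {w : Vec d × Y → ℝ} {k b : ℝ} (hwm : Measurable w) (hw : ∀ p, 0 ≤ w p)
    {C : ℝ} (hC : ∀ p, w p ≤ C * ‖p.1‖ ^ 2)
    (hk : ∀ y, ∫ p, inner ℝ p.1 y ^ 2 * w p ∂D ≤ k * form S y y) (hk0 : 0 ≤ k)
    (hb : ∀ x, ∫ p, (lossDeriv ℓ (inner ℝ p.1 x) p.2 - lossDeriv ℓ (inner ℝ p.1 xs) p.2) ^ 2
      * w p ∂D ≤ 2 * Lℓ * b * gap D ℓ xs x) (h : ℝ) (yt y : Vec d) :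
    Integrable (fun p => (inner ℝ p.1 y + h * (lossDeriv ℓ (inner ℝ p.1 yt) p.2
      - inner ℝ p.1 (T (gradRisk D ℓ yt)))) ^ 2 * w p) D ∧
    ∫ p, (inner ℝ p.1 y + h * (lossDeriv ℓ (inner ℝ p.1 yt) p.2
      - inner ℝ p.1 (T (gradRisk D ℓ yt)))) ^ 2 * w p ∂D
      ≤ 2 * k * form S y y + 2 * (3 * h ^ 2 * (∫ p, lossDeriv ℓ (inner ℝ p.1 xs) p.2 ^ 2 * w p ∂D
        + 2 * Lℓ * (b + k) * gap D ℓ xs yt)) := by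
  have hxs := hP.measurable_lossDeriv_at xs
  have hyt := hP.measurable_lossDeriv_at yt
  -- weights `v ≥ 0` integrable against `‖a‖²` are integrable against `w`
  have hdom : ∀ v : Vec d × Y → ℝ, Measurable v → (∀ p, 0 ≤ v p) →
      Integrable (fun p => v p * ‖p.1‖ ^ 2) D → Integrable (fun p => v p * w p) D := by
    intro v hv hv0 hi
    refine (hi.const_mul C).mono' (by fun_prop) (.of_forall fun p => ?_)
    rw [Real.norm_of_nonneg (mul_nonneg (hv0 p) (hw p))]
    calc v p * w p ≤ v p * (C * ‖p.1‖ ^ 2) := mul_le_mul_of_nonneg_left (hC p) (hv0 p)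
      _ = _ := by ring
  have i1 := fun y => hdom _ (by fun_prop) (fun p => sq_nonneg _) (hP.integrable_inner_sq_mul y)
  have i2 := hdom _ (by fun_prop) (fun p => sq_nonneg _) hP.noise
  have i3 := hdom _ (by fun_prop) (fun p => sq_nonneg _) (hP.integrable_noise_sub yt)
  have i4 : Integrable (fun p => lossDeriv ℓ (inner ℝ p.1 xs) p.2 ^ 2 * w p
      + (lossDeriv ℓ (inner ℝ p.1 yt) p.2 - lossDeriv ℓ (inner ℝ p.1 xs) p.2) ^ 2 * w p) D :=
    i2.add i3
  have i5 : Integrable (fun p => lossDeriv ℓ (inner ℝ p.1 xs) p.2 ^ 2 * w p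
      + (lossDeriv ℓ (inner ℝ p.1 yt) p.2 - lossDeriv ℓ (inner ℝ p.1 xs) p.2) ^ 2 * w p
      + inner ℝ p.1 (T (gradRisk D ℓ yt)) ^ 2 * w p) D := i4.add (i1 _)
  have i6 := ((i1 y).const_mul 2).add (i5.const_mul (6 * h ^ 2))
  have hle := fun p => hP.innerOracle_sq_le (hw p) h yt y p
  have i7 : Integrable (fun p => (inner ℝ p.1 y + h * (lossDeriv ℓ (inner ℝ p.1 yt) p.2
      - inner ℝ p.1 (T (gradRisk D ℓ yt)))) ^ 2 * w p) D := by
    refine i6.mono' (by fun_prop) (.of_forall fun p => ?_)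
    rw [Real.norm_of_nonneg (mul_nonneg (sq_nonneg _) (hw p))]
    exact hle p
  refine ⟨i7, (integral_mono i7 i6 hle).trans ?_⟩
  simp only [Pi.add_apply]
  rw [integral_add ((i1 y).const_mul 2) (i5.const_mul (6 * h ^ 2)), integral_const_mul,
    integral_const_mul, integral_add i4 (i1 _), integral_add i2 i3]
  have h1 := hk y
  have h2 := hb yt
  have h3 := hk (T (gradRisk D ℓ yt))
  rw [← hP.design.pair.inv_self] at h3
  have h4 := mul_le_mul_of_nonneg_left (hP.form_inv_gradRisk_le yt) hk0
  have h5 : 0 ≤ 6 * h ^ 2 := by positivity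
  have h6 := mul_le_mul_of_nonneg_left (add_le_add h2 (h3.trans h4)) h5
  linarith

lemma integral_inner_smul (y : Vec d) :
    Integrable (fun p : Vec d × Y => (inner ℝ p.1 y : ℝ) • p.1) D ∧
    ∫ p, (inner ℝ p.1 y : ℝ) • p.1 ∂D = S y := by
  have hi : Integrable (fun p : Vec d × Y => (inner ℝ p.1 y : ℝ) • p.1) D := by
    refine integrable_of_sq (by fun_prop) ?_
    simpa only [norm_smul, mul_pow, Real.norm_eq_abs, sq_abs] using hP.integrable_inner_sq_mul y
  refine ⟨hi, ext_inner_right ℝ fun v => ?_⟩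
  have h1 := hP.design.cov y v
  rw [form] at h1
  rw [← h1, real_inner_comm, ← integral_inner hi]
  simp only [real_inner_comm _ v, real_inner_smul_left]

/-- The inner stochastic gradient is an oracle for `S` in centred coordinates. -/
lemma oracle_innerOracle {B L : ℝ}
    (hB : GradNoise2 D ℓ xs Lℓ B) (hL : ∀ x, ∫ p, (lossDeriv ℓ (inner ℝ p.1 x) p.2
      - lossDeriv ℓ (inner ℝ p.1 xs) p.2) ^ 2 * form T p.1 p.1 ∂D ≤ 2 * Lℓ * L * gap D ℓ xs x)
    (hR : 0 ≤ R2) (h : ℝ) (yt : Vec d) :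
    Oracle D S T R2 κt
      (3 * h ^ 2 * (∫ p, lossDeriv ℓ (inner ℝ p.1 xs) p.2 ^ 2 * ‖p.1‖ ^ 2 ∂D
        + 2 * Lℓ * (B + R2) * gap D ℓ xs yt))
      (3 * h ^ 2 * (∫ p, lossDeriv ℓ (inner ℝ p.1 xs) p.2 ^ 2 * form T p.1 p.1 ∂D
        + 2 * Lℓ * (L + κt) * gap D ℓ xs yt))
      (innerOracle D ℓ T h yt) := by
  have hsq : ∀ y (p : Vec d × Y), ‖innerOracle D ℓ T h yt y p‖ ^ 2
      = (inner ℝ p.1 y + h * (lossDeriv ℓ (inner ℝ p.1 yt) p.2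
        - inner ℝ p.1 (T (gradRisk D ℓ yt)))) ^ 2 * ‖p.1‖ ^ 2 := fun y p => by
    rw [innerOracle, norm_smul, mul_pow, Real.norm_eq_abs, sq_abs]
  have h1 := fun y => hP.innerOracle_moment (w := fun p => ‖p.1‖ ^ 2) (k := R2) (b := B)
    (by fun_prop) (fun p => sq_nonneg _) (C := 1) (fun p => (one_mul _).ge)
    (fun y => by simpa only [mul_comm (‖_‖ ^ 2)] using hP.design.bound y) hR hB h yt y
  have h2 := fun y => hP.innerOracle_moment (w := fun p => form T p.1 p.1) (k := κt) (b := L)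
    (by fun_prop) (fun p => hP.design.pair.inv_nonneg _) (C := ‖T‖)
    (fun p => (le_abs_self _).trans (abs_form_self_le T _))
    (fun y => by simpa only [mul_comm (form T _ _)] using hP.design.boundInv y)
    (zero_le_one.trans hP.design.one_le) hL h yt y
  refine ⟨hP.measurable_innerOracle h yt, fun y => ?_, fun y => ?_, fun y => ?_, fun y => ?_⟩
  · simp only [hsq]; exact (h1 y).1
  · have e1 : ∀ p : Vec d × Y, innerOracle D ℓ T h yt y p = (inner ℝ p.1 y : ℝ) • p.1
        + (h • (lossDeriv ℓ (inner ℝ p.1 yt) p.2 • p.1)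
          - h • ((inner ℝ p.1 (T (gradRisk D ℓ yt)) : ℝ) • p.1)) := fun p => by
      rw [innerOracle]; module
    obtain ⟨j1, f1⟩ := hP.integral_inner_smul y
    obtain ⟨j2, f2⟩ := hP.integral_inner_smul (T (gradRisk D ℓ yt))
    have j3 : Integrable (fun p : Vec d × Y => h • (lossDeriv ℓ (inner ℝ p.1 yt) p.2 • p.1)) D :=
      (hP.integrable_grad yt).smul h
    have j4 : Integrable (fun p : Vec d × Y =>
      h • ((inner ℝ p.1 (T (gradRisk D ℓ yt)) : ℝ) • p.1)) D := j2.smul h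
    simp only [e1]
    have j5 : Integrable (fun p : Vec d × Y => h • (lossDeriv ℓ (inner ℝ p.1 yt) p.2 • p.1)
      - h • ((inner ℝ p.1 (T (gradRisk D ℓ yt)) : ℝ) • p.1)) D := j3.sub j4
    rw [integral_add j1 j5, integral_sub j3 j4, integral_smul, integral_smul, f1, f2,
      hP.design.pair.right_inv]
    simp only [gradRisk, sub_self, add_zero]
  · simp only [hsq]; exact (h1 y).2
  · simp only [innerOracle, form_smul_smul]; exact (h2 y).2

end Problem
end Inner

/-! ### The algebra of one outer iteration -/

section OuterAlgebra

variable {E : Type*} [NormedAddCommGroup E] [InnerProductSpace ℝ E] {A : E →L[ℝ] E}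

/-- A bound for one accelerated proximal step before taking expectations. Here `Y` and `Y + D` are
the centred extrapolated and auxiliary points, `n` is the preconditioned gradient at the
extrapolated point, `s` the step length and `e` the error of the step; `a` measures the change of
the momentum parameter. -/
lemma lyap_pointwise (hsym : ∀ x y, form A x y = form A y x) (hpos : ∀ x, 0 ≤ form A x x)
    {w s ϑ a fp fy : ℝ} (hs : 0 < s) (hϑ : 0 < ϑ) (hw : 0 ≤ w) (hws : w * s = ϑ ^ 2) (ha : 0 ≤ a)
    (hfp0 : 0 ≤ fp) (Y D n e : E)
    (hfp : fp ≤ fy + form A n (e - s • n) + 1 / 2 * form A (e - s • n) (e - s • n)) :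
    fp + w / 2 * form A ((1 + a) • (Y + (1 - ϑ) • D - (s / ϑ) • n + (1 / ϑ) • e) - a • (Y - ϑ • D))
        ((1 + a) • (Y + (1 - ϑ) • D - (s / ϑ) • n + (1 / ϑ) • e) - a • (Y - ϑ • D))
      ≤ (1 + a) ^ 2 * (1 + a / 2) * (fy - s / 2 * (1 - s) * form A n n
          + w / 2 * form A (Y + (1 - ϑ) • D) (Y + (1 - ϑ) • D)
          - ϑ * form A n (Y + (1 - ϑ) • D)
          + form A ((w / ϑ) • (Y + (1 - ϑ) • D) - s • n) e + 1 / 2 * (1 + 1 / s) * form A e e)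
        + w / 2 * (a ^ 2 + 2 * a) * form A (Y - ϑ • D) (Y - ϑ • D) := by
  set U := Y + (1 - ϑ) • D with hU
  set X := Y - ϑ • D with hX
  set v := U - (s / ϑ) • n + (1 / ϑ) • e with hv
  -- Young's inequality, from `0 ≤ ‖(1 + a) v + 2 X‖²` in the norm of `A`
  have h1 : form A ((1 + a) • v - a • X) ((1 + a) • v - a • X)
      ≤ (1 + a) ^ 2 * (1 + a / 2) * form A v v + (a ^ 2 + 2 * a) * form A X X := by
    have h2 := hpos ((1 + a) • v + (2 : ℝ) • X)
    simp only [form_sub_left, form_sub_right, form_add_left, form_add_right, form_smul_left,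
      form_smul_right, hsym X v] at h2 ⊢
    nlinarith [mul_nonneg ha h2]
  have h3 : w / 2 * form A v v = w / 2 * form A U U - ϑ * form A n U + s / 2 * form A n n
      + w / ϑ * form A U e - form A n e + 1 / (2 * s) * form A e e := by
    have e1 : w = ϑ ^ 2 / s := by rw [eq_div_iff hs.ne', hws]
    rw [hv]
    simp only [form_sub_left, form_sub_right, form_add_left, form_add_right, form_smul_left,
      form_smul_right, hsym U n, hsym e n, hsym e U]
    rw [e1]
    field_simp
    ring
  have h4 : fp + w / 2 * form A v v ≤ fy - s / 2 * (1 - s) * form A n n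
          + w / 2 * form A U U - ϑ * form A n U
          + form A ((w / ϑ) • U - s • n) e + 1 / 2 * (1 + 1 / s) * form A e e := by
    rw [h3]
    simp only [form_sub_left, form_sub_right, form_smul_left, form_smul_right, hsym e n] at hfp ⊢
    have e2 : 1 / 2 * (1 + 1 / s) * form A e e = 1 / 2 * form A e e + 1 / (2 * s) * form A e e := by
      field_simp
    rw [e2]
    linarith
  have h5 : 1 ≤ (1 + a) ^ 2 * (1 + a / 2) := by nlinarith [mul_nonneg ha ha]
  have h6 : fp ≤ (1 + a) ^ 2 * (1 + a / 2) * fp := le_mul_of_one_le_left hfp0 h5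
  have h7 := mul_le_mul_of_nonneg_left h4 (zero_le_one.trans h5)
  have h8 := mul_le_mul_of_nonneg_left h1 (by positivity : 0 ≤ w / 2)
  linarith

/-- Convexity of the squared norm along `U = (1 - ϑ) V + ϑ Y`, with room for a factor
`1 + ϑ / 50`. -/
lemma momentum_form_le {ϑ UU VV YY DD : ℝ} (hϑ : 0 ≤ ϑ) (hϑ1 : ϑ ≤ 1 / 100)
    (hVV : 0 ≤ VV) (hYY : 0 ≤ YY) (hDD : 0 ≤ DD)
    (hUU : UU = (1 - ϑ) * VV + ϑ * YY - ϑ * (1 - ϑ) * DD) :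
    (1 + ϑ / 50) * UU ≤ (1 - 24 / 25 * ϑ) * VV + ϑ * ((1 + 1 / 5000) * YY)
        - ϑ * (99 / 100 * DD) := by
  have k1 := mul_nonneg hϑ hVV
  have k2 := mul_nonneg hϑ hYY
  have k3 := mul_nonneg hϑ hDD
  have k4 := mul_nonneg hϑ k1
  have k5 := mul_le_mul_of_nonneg_right hϑ1 k2
  have k6 := mul_le_mul_of_nonneg_right hϑ1 k3
  have k7 := mul_le_mul_of_nonneg_right hϑ1 (mul_nonneg hϑ k3)
  rw [hUU]
  linarith

/-- Bound for the terms that are linear in the bias `b` of the inner loop, by Cauchy–Schwarz: they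
are absorbed by the gradient term and by a small multiple of `UU`. -/
lemma bias_terms_le {q s ϑ ε nn nb bb Ub UU : ℝ} (hq : 0 < q) (hs : 0 < s) (hϑ : 0 < ϑ)
    (hws : q / 2 * s = ϑ ^ 2) (hε : ε ≤ ϑ / 200)
    (hnn : 0 ≤ nn) (hUU0 : 0 ≤ UU) (hbb0 : 0 ≤ bb) (hbb : bb ≤ ε * s ^ 2 * nn)
    (hnb : nb ^ 2 ≤ nn * bb) (hUb : Ub ^ 2 ≤ UU * bb) :
    q / 2 / ϑ * Ub - s * nb ≤ q / 200 * ϑ * UU + s / 4 * nn + 2 * s * bb := by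
  have h1 : -(s * nb) ≤ s / 8 * nn + 2 * s * bb := by
    have h0 : -nb ≤ nn / 8 + 2 * bb := by
      refine le_of_sq_le_sq ?_ (by positivity)
      nlinarith [sq_nonneg (nn / 8 - 2 * bb)]
    have := mul_le_mul_of_nonneg_left h0 hs.le
    linarith
  have h2 : q / 2 / ϑ * Ub ≤ q / 200 * ϑ * UU + s / 8 * nn := by
    have h3 : Ub ≤ ϑ ^ 2 / 100 * UU + 25 / ϑ ^ 2 * bb := by
      refine le_of_sq_le_sq ?_ (by positivity)
      have h4 : (ϑ ^ 2 / 100 * UU + 25 / ϑ ^ 2 * bb) ^ 2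
          = (ϑ ^ 2 / 100 * UU - 25 / ϑ ^ 2 * bb) ^ 2 + UU * bb := by field_simp; ring
      rw [h4]
      linarith [sq_nonneg (ϑ ^ 2 / 100 * UU - 25 / ϑ ^ 2 * bb)]
    have h5 : 25 / ϑ ^ 2 * bb ≤ 25 / ϑ ^ 2 * (ϑ / 200 * s ^ 2 * nn) := by
      gcongr
      exact hbb.trans (by gcongr)
    have h6 : q / 2 / ϑ * (25 / ϑ ^ 2 * (ϑ / 200 * s ^ 2 * nn)) = s / 8 * nn := by
      have : q = 2 * ϑ ^ 2 / s := by rw [eq_div_iff hs.ne']; linarith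
      rw [this]; field_simp; ring
    calc q / 2 / ϑ * Ub ≤ q / 2 / ϑ * (ϑ ^ 2 / 100 * UU + 25 / ϑ ^ 2 * (ϑ / 200 * s ^ 2 * nn)) := by
          gcongr; linarith
      _ = q / 200 * ϑ * UU + s / 8 * nn := by rw [mul_add, h6]; field_simp; ring
  linarith

/-- The scalar inequality behind the contraction of the outer Lyapunov function: all error terms
are absorbed by strong convexity (the terms in `YY` and `DD`) and by the gradient term. -/
lemma lyap_scalar {q s ϑ ε N0 N1 fx fy nn nD nY nb bb Ub UU VV YY DD ee : ℝ}
    (hq : 0 < q) (hs : 0 < s) (hs1 : s ≤ 1 / 8) (hϑ : 0 < ϑ) (hϑ1 : ϑ ≤ 1 / 100)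
    (hϑq : ϑ ^ 2 ≤ q / 100) (hws : q / 2 * s = ϑ ^ 2) (hε : ε ≤ ϑ / 200)
    (hN1 : s * N1 ≤ ϑ / 50) (hfy0 : 0 ≤ fy)
    (hnn : 0 ≤ nn) (hVV : 0 ≤ VV) (hYY : 0 ≤ YY) (hDD : 0 ≤ DD) (hUU0 : 0 ≤ UU) (hbb0 : 0 ≤ bb)
    (hUU : UU = (1 - ϑ) * VV + ϑ * YY - ϑ * (1 - ϑ) * DD)
    (hx : fy - ϑ * nD ≤ fx) (hmin : fy + q / 2 * YY ≤ nY) (hy : fy ≤ 2 * fx + ϑ ^ 2 * DD)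
    (hbb : bb ≤ ε * s ^ 2 * nn) (hee : ee ≤ ε * s ^ 2 * nn + s ^ 2 * (N0 + N1 * fy)) (hee0 : 0 ≤ ee)
    (hnb : nb ^ 2 ≤ nn * bb) (hUb : Ub ^ 2 ≤ UU * bb) :
    fy - s / 2 * (1 - s) * nn + q / 2 / 2 * UU - ϑ * (nY + (1 - ϑ) * nD)
        + (q / 2 / ϑ * Ub - s * nb) + 1 / 2 * (1 + 1 / s) * ee
      ≤ (1 - 24 / 25 * ϑ) * (fx + q / 4 * VV) - 6 / 25 * q * ϑ * (YY + DD) + s * N0 := by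
  have h2 := bias_terms_le hq hs hϑ hws hε hnn hUU0 hbb0 hbb hnb hUb
  have h3 : 1 / 2 * (1 + 1 / s) * ee ≤ ε * s * nn + s * N0 + ϑ / 50 * fy := by
    have h4 : 1 / 2 * (1 + 1 / s) * ee ≤ 1 / s * ee := by
      have h7 : 1 ≤ 1 / s := by rw [le_div_iff₀ hs]; linarith
      exact mul_le_mul_of_nonneg_right (by linarith) hee0
    have h5 : 1 / s * ee ≤ 1 / s * (ε * s ^ 2 * nn + s ^ 2 * (N0 + N1 * fy)) := by gcongr
    have h6 : 1 / s * (ε * s ^ 2 * nn + s ^ 2 * (N0 + N1 * fy))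
        = ε * s * nn + s * N0 + (s * N1) * fy := by field_simp; ring
    have h7 := mul_le_mul_of_nonneg_right hN1 hfy0
    linarith
  have h4 : -(ϑ * (nY + (1 - ϑ) * nD)) ≤ -ϑ * (fy + q / 2 * YY) + (1 - ϑ) * (fx - fy) := by
    have h5 := mul_le_mul_of_nonneg_left hmin hϑ.le
    have h6 := mul_le_mul_of_nonneg_left hx (by linarith : 0 ≤ 1 - ϑ)
    linarith
  -- the gradient term absorbs the bias
  have h5 : -(s / 2 * (1 - s) * nn) + s / 4 * nn + 2 * s * bb + ε * s * nn ≤ 0 := by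
    have hsn := mul_nonneg hs.le hnn
    have h6 : 2 * s * bb ≤ 2 * (ε * s ^ 2) * (s * nn) := by
      have := mul_le_mul_of_nonneg_left hbb (by positivity : 0 ≤ 2 * s)
      linarith
    have h7 : ε ≤ 1 / 20000 := by linarith
    have h8 : ε * s ^ 2 ≤ 1 / 20000 * 1 := by
      gcongr; nlinarith
    have h9 := mul_le_mul_of_nonneg_right h8 hsn
    have h10 := mul_le_mul_of_nonneg_right h7 hsn
    have h11 := mul_le_mul_of_nonneg_right hs1 hsn
    linarith
  have hqϑ := mul_pos hq hϑ
  have h6 : ϑ / 50 * fy ≤ ϑ / 25 * fx + 1 / 5000 * (q * ϑ) * DD := by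
    have h7 := mul_le_mul_of_nonneg_left hy (by positivity : 0 ≤ ϑ / 50)
    have h8 := mul_le_mul_of_nonneg_right hϑq (mul_nonneg hϑ.le hDD)
    linarith
  have h7 : q / 4 * (1 + ϑ / 50) * UU ≤ q / 4 * (1 - 24 / 25 * ϑ) * VV
      + q * ϑ * (1 / 4 * (1 + 1 / 5000) * YY) - q * ϑ * (1 / 4 * (99 / 100) * DD) := by
    have h8 := momentum_form_le hϑ.le hϑ1 hVV hYY hDD hUU
    have h9 := mul_le_mul_of_nonneg_left h8 (by positivity : 0 ≤ q / 4)
    linarith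
  have k1 := mul_nonneg hqϑ.le hYY
  have k2 := mul_nonneg hqϑ.le hDD
  linarith

end OuterAlgebra

/-! ### Contraction of the outer Lyapunov function -/

section OuterStep

/-- The change of the momentum parameter between two outer iterations costs less than the
contraction gains. -/
lemma momentum_change_le {q ϑ a sN F P XX YY DD : ℝ} (hq : 0 ≤ q) (hϑ : 0 < ϑ) (hϑ1 : ϑ ≤ 1 / 100)
    (ha : 0 ≤ a) (haϑ : a ≤ ϑ / 4) (hF : 0 ≤ F) (hsN : 0 ≤ sN) (hYY : 0 ≤ YY) (hDD : 0 ≤ DD)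
    (hXX : XX ≤ 3 / 2 * YY + DD)
    (hP : P ≤ (1 - 24 / 25 * ϑ) * F - 6 / 25 * q * ϑ * (YY + DD) + sN) :
    (1 + a) ^ 2 * (1 + a / 2) * P + q / 2 / 2 * (a ^ 2 + 2 * a) * XX
      ≤ (1 - 3 / 10 * ϑ) * F + 11 / 10 * sN := by
  have h1 : 1 ≤ (1 + a) ^ 2 * (1 + a / 2) := by nlinarith [mul_nonneg ha ha]
  have h2 : a ^ 2 ≤ 1 / 400 * a := by nlinarith
  have h3 : (1 + a) ^ 2 * (1 + a / 2) ≤ 1 + 63 / 100 * ϑ := by nlinarith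
  set k := (1 + a) ^ 2 * (1 + a / 2) with hk
  have h4 := mul_le_mul_of_nonneg_left hP (zero_le_one.trans h1)
  have h5 : k * ((1 - 24 / 25 * ϑ) * F) ≤ (1 - 3 / 10 * ϑ) * F := by
    rw [← mul_assoc]
    refine mul_le_mul_of_nonneg_right ?_ hF
    calc k * (1 - 24 / 25 * ϑ) ≤ (1 + 63 / 100 * ϑ) * (1 - 24 / 25 * ϑ) :=
          mul_le_mul_of_nonneg_right h3 (by linarith)
      _ ≤ _ := by nlinarith
  have h6 : k * sN ≤ 11 / 10 * sN := mul_le_mul_of_nonneg_right (by linarith) hsN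
  have h7 : 6 / 25 * q * ϑ * (YY + DD) ≤ k * (6 / 25 * q * ϑ * (YY + DD)) :=
    le_mul_of_one_le_left (by positivity) h1
  have h8 : q / 2 / 2 * (a ^ 2 + 2 * a) * XX ≤ 6 / 25 * q * ϑ * (YY + DD) := by
    have h9 : a ^ 2 + 2 * a ≤ 51 / 100 * ϑ := by linarith
    calc q / 2 / 2 * (a ^ 2 + 2 * a) * XX ≤ q / 2 / 2 * (a ^ 2 + 2 * a) * (3 / 2 * YY + DD) := by
          gcongr
      _ ≤ q / 2 / 2 * (51 / 100 * ϑ) * (3 / 2 * YY + DD) := by gcongr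
      _ ≤ _ := by
          have k1 := mul_nonneg (mul_nonneg hq hϑ.le) hYY
          have k2 := mul_nonneg (mul_nonneg hq hϑ.le) hDD
          linarith
  linarith

variable {d : ℕ} {Y : Type u} [MeasurableSpace Y] {D : Measure (Vec d × Y)}
  [IsProbabilityMeasure D] {ℓ : ℝ → Y → ℝ} {Lℓ μℓ : ℝ}
  {xs : Vec d} {S T : Vec d →L[ℝ] Vec d} {mu R2 κt : ℝ}

/-- The Lyapunov function of the outer loop at the pair `(x_k, x_{k-1})`: the suboptimality gap of
`x_k` plus the distance of the auxiliary point `x_k + (1 / ϑ - 1) (x_k - x_{k-1})` from the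
minimiser, in the norm of `S`. -/
def lyap (D : Measure (Vec d × Y)) (ℓ : ℝ → Y → ℝ) (μℓ : ℝ) (xs : Vec d) (S : Vec d →L[ℝ] Vec d)
    (ϑ : ℝ) (s : Vec d × Vec d) : ℝ :=
  gap D ℓ xs s.1 + μℓ / 4 * form S (s.1 + (1 / ϑ - 1) • (s.1 - s.2) - xs)
    (s.1 + (1 / ϑ - 1) • (s.1 - s.2) - xs)

/-- Extrapolated point of an outer iteration. -/
def extrapolate (β : ℝ) (s : Vec d × Vec d) : Vec d := s.1 + β • (s.1 - s.2)

namespace Problem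

variable (hP : Problem D ℓ Lℓ μℓ xs S T mu R2 κt)
include hP

lemma measurable_lyap (ϑ : ℝ) : Measurable (lyap D ℓ μℓ xs S ϑ) := by
  have h1 : Measurable fun s : Vec d × Vec d => risk D ℓ s.1 :=
    hP.measurable_risk.comp measurable_fst
  have h2 : Measurable fun s : Vec d × Vec d => s.1 + (1 / ϑ - 1) • (s.1 - s.2) - xs := by fun_prop
  have h3 := (continuous_form_self S).measurable.comp h2
  exact (h1.sub_const _).add (h3.const_mul _)

lemma lyap_nonneg (ϑ : ℝ) (s : Vec d × Vec d) : 0 ≤ lyap D ℓ μℓ xs S ϑ s :=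
  add_nonneg (hP.gap_nonneg _)
    (mul_nonneg (by linarith [hP.loss.mu_pos]) (hP.design.pair.nonneg _))

lemma gap_le_lyap (ϑ : ℝ) (s : Vec d × Vec d) : gap D ℓ xs s.1 ≤ lyap D ℓ μℓ xs S ϑ s :=
  le_add_of_nonneg_right
    (mul_nonneg (by linarith [hP.loss.mu_pos]) (hP.design.pair.nonneg _))

lemma lyap_start_le (ϑ : ℝ) (x : Vec d) :
    lyap D ℓ μℓ xs S ϑ (x, x) ≤ 3 / 2 * gap D ℓ xs x := by
  have := hP.form_sub_min_le x
  simp only [lyap, sub_self, smul_zero, add_zero]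
  linarith

variable {Ω : Type v} [MeasurableSpace Ω] {P : Measure Ω} [IsProbabilityMeasure P]
  {ξ : ℕ → Ω → Vec d × Y} {η γ θ : ℝ}

/-- One outer iteration with momentum parameter `ϑ`, started at a fixed pair `st`, contracts the
Lyapunov function up to the noise of the inner loop. The inner loop acts as a gradient step of length
`h Lℓ` in the norm of `Lℓ S`, with an error whose mean and second moment are bounded by
`form_integral_accOutput_le` and `accOutput_moment`. -/
theorem outer_step {B L : ℝ} (hB : GradNoise2 D ℓ xs Lℓ B)
    (hL : ∀ x, ∫ p, (lossDeriv ℓ (inner ℝ p.1 x) p.2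
      - lossDeriv ℓ (inner ℝ p.1 xs) p.2) ^ 2 * form T p.1 p.1 ∂D ≤ 2 * Lℓ * L * gap D ℓ xs x)
    (hB0 : 0 ≤ B) (hL0 : 0 ≤ L)
    (hst : StepSizes mu R2 κt η γ θ) (hξ : ∀ t, Measurable (ξ t)) (hlaw : ∀ t, P.map (ξ t) = D)
    (hind : iIndepFun ξ P) {lam : ℝ} (hlam : mu ≤ lam) (hup : ∀ x, form S x x ≤ lam * ‖x‖ ^ 2)
    {n : ℕ} (hn : 404 ≤ n * θ) {h ϑ ϑ' : ℝ} (hh : 0 < h) (hϑ : 0 < ϑ) (hϑ1 : ϑ ≤ 1 / 100)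
    (hϑq : ϑ ^ 2 ≤ μℓ / Lℓ / 100) (hws : μℓ / Lℓ / 2 * (h * Lℓ) = ϑ ^ 2)
    (hδ0 : 0 ≤ 1 / ϑ' - 1 / ϑ) (hδ1 : 1 / ϑ' - 1 / ϑ ≤ 1 / 4)
    (hε : 2 * (lam / mu) * (1 - θ) ^ n ≤ ϑ / 200)
    (hN1 : h * Lℓ * (6 / n * (7 * (L + κt) + 9 * η * κt * (B + R2))) ≤ ϑ / 50)
    (st : Vec d × Vec d) :
    Integrable (fun ω => lyap D ℓ μℓ xs S ϑ' (innerOutput ℓ η γ θ h (2 * n)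
      (extrapolate ((1 - ϑ) / (1 + ϑ)) st) (fun i => ξ i ω), st.1)) P ∧
    ∫ ω, lyap D ℓ μℓ xs S ϑ' (innerOutput ℓ η γ θ h (2 * n)
      (extrapolate ((1 - ϑ) / (1 + ϑ)) st) (fun i => ξ i ω), st.1) ∂P
      ≤ (1 - 3 / 10 * ϑ) * lyap D ℓ μℓ xs S ϑ st
        + 11 / 10 * (h * Lℓ * (3 / n * (7 * (∫ p, lossDeriv ℓ (inner ℝ p.1 xs) p.2 ^ 2
            * form T p.1 p.1 ∂D) + 9 * η * κt
            * ∫ p, lossDeriv ℓ (inner ℝ p.1 xs) p.2 ^ 2 * ‖p.1‖ ^ 2 ∂D) / Lℓ)) := by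
  have hLp := hP.loss.L_pos
  have hmp := hP.loss.mu_pos
  have hpair := hP.design.pair
  have hκ := hP.design.one_le
  have hmu := hpair.mu_pos
  have hη := hst.eta_pos
  have hθ := hst.theta_pos
  have hR := hst.R2_nonneg
  have hn0 : 0 < n := by
    rcases Nat.eq_zero_or_pos n with h0 | h0
    · subst h0; norm_num at hn
    · exact h0
  have hn0' : (0 : ℝ) < n := by exact_mod_cast hn0
  -- `Yv` and `Dv` are the centred extrapolated point and the gap to the auxiliary point `v`; `A` is
  -- the Hessian bound `Lℓ S` and `nv` the gradient preconditioned by `A`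
  set yt := extrapolate ((1 - ϑ) / (1 + ϑ)) st with hyt
  set g := gradRisk D ℓ yt with hg
  set s := h * Lℓ with hs
  have hs0 : 0 < s := by positivity
  set q := μℓ / Lℓ with hq
  have hq0 : 0 < q := by positivity
  set nv := Lℓ⁻¹ • T g with hnv
  set v := st.1 + (1 / ϑ - 1) • (st.1 - st.2) with hv
  set Yv := yt - xs with hYv
  set Dv := v - yt with hDv
  set A := Lℓ • S with hA
  have fA : ∀ x y, form A x y = Lℓ * form S x y := fun x y => by
    simp [form, hA, real_inner_smul_left]
  have hsym : ∀ x y, form A x y = form A y x := fun x y => by rw [fA, fA, hpair.symm]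
  have hpos : ∀ x, 0 ≤ form A x x := fun x => by
    rw [fA]; exact mul_nonneg hLp.le (hpair.nonneg x)
  have hgrad : ∀ x, form A nv x = inner ℝ g x := fun x => by
    rw [fA, hnv, form_smul_left, form, hpair.right_inv, ← mul_assoc, mul_inv_cancel₀ hLp.ne',
      one_mul]
  have hstep : exactStep D ℓ T h yt = s • nv := by
    rw [exactStep, hs, hnv, smul_smul, mul_assoc, mul_inv_cancel₀ hLp.ne', mul_one]
  have hϑp : 1 + ϑ ≠ 0 := by positivity
  have hX : st.1 - xs = Yv - ϑ • Dv := by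
    rw [hYv, hDv, hv, hyt, extrapolate]
    match_scalars <;> field_simp <;> ring
  have hV : v - xs = Yv + Dv := by rw [hYv, hDv]; module
  set qi := ∫ p, lossDeriv ℓ (inner ℝ p.1 xs) p.2 ^ 2 * form T p.1 p.1 ∂D with hqi
  set q2 := ∫ p, lossDeriv ℓ (inner ℝ p.1 xs) p.2 ^ 2 * ‖p.1‖ ^ 2 ∂D with hq2
  have hqi0 : 0 ≤ qi := integral_nonneg fun p => mul_nonneg (sq_nonneg _) (hpair.inv_nonneg _)
  have hq20 : 0 ≤ q2 := integral_nonneg fun p => mul_nonneg (sq_nonneg _) (sq_nonneg _)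
  set N0 := 3 / n * (7 * qi + 9 * η * κt * q2) / Lℓ with hN0
  set N1 := 6 / n * (7 * (L + κt) + 9 * η * κt * (B + R2)) with hN1'
  have hN00 : 0 ≤ N0 := by positivity
  set fy := gap D ℓ xs yt with hfy
  have hfy0 : 0 ≤ fy := hP.gap_nonneg yt
  -- the error of the inner loop
  have hO := hP.oracle_innerOracle hB hL hR h yt
  set σ2 := 3 * h ^ 2 * (q2 + 2 * Lℓ * (B + R2) * fy) with hσ2
  set σi := 3 * h ^ 2 * (qi + 2 * Lℓ * (L + κt) * fy) with hσi
  have hσ20 : 0 ≤ σ2 := by positivity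
  have hσi0 : 0 ≤ σi := by positivity
  have hγ := hst.gamma_pos
  have hNn : 0 ≤ 2 * η ^ 2 * σ2 + 2 * mu * γ ^ 2 * σi := by positivity
  set e : Ω → Vec d := fun ω => accOutput η γ θ (innerOracle D ℓ T h yt) (exactStep D ℓ T h yt) n
    fun i => ξ i ω with he
  have hout : ∀ ω, innerOutput ℓ η γ θ h (2 * n) yt (fun i => ξ i ω) = e ω + (yt - s • nv) :=
    fun ω => by
      rw [← hstep]
      exact innerOutput_eq (D := D) (T := T) h η γ θ hθ yt _ hn0
  have hem : Measurable e := measurable_accOutput hO.meas hξ n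
  obtain ⟨ie2, he2⟩ := accOutput_moment (r := exactStep D ℓ T h yt) hpair hO hst hξ hlaw hind
    (by linarith) hσ20 hσi0 hn
  have ie := integrable_accOutput (r := exactStep D ℓ T h yt) hpair hO hst hξ hlaw hind hNn n
  have hbias := form_integral_accOutput_le (r := exactStep D ℓ T h yt) hpair hO hst hξ hlaw hind hκ
    (hmu.le.trans hlam) hup hNn n
  change Integrable e P at ie
  change Integrable (fun ω => form S (e ω) (e ω)) P at ie2
  change ∫ ω, form S (e ω) (e ω) ∂P ≤ _ at he2
  change form S (∫ ω, e ω ∂P) (∫ ω, e ω ∂P) ≤ _ at hbias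
  set b := ∫ ω, e ω ∂P with hb
  set ε := 2 * (lam / mu) * (1 - θ) ^ n with hεd
  have hρ0 : 0 ≤ (1 - θ) ^ n := pow_nonneg (sub_nonneg.2 hst.theta_le) _
  have hρε : (1 - θ) ^ n ≤ ε := by
    refine le_mul_of_one_le_left hρ0 ?_
    have : 1 ≤ lam / mu := by rwa [le_div_iff₀ hmu, one_mul]
    linarith
  have ieA : Integrable (fun ω => form A (e ω) (e ω)) P := by
    simp only [fA]; exact ie2.const_mul _
  set ee := ∫ ω, form A (e ω) (e ω) ∂P with hee
  have hee0 : 0 ≤ ee := integral_nonneg fun ω => hpos _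
  have hbb : form A b b ≤ ε * s ^ 2 * form A nv nv := by
    rw [hstep, form_smul_smul] at hbias
    rw [fA, fA]
    have := mul_le_mul_of_nonneg_left hbias hLp.le
    linarith
  have hee1 : ee ≤ ε * s ^ 2 * form A nv nv + s ^ 2 * (N0 + N1 * fy) := by
    rw [hstep, form_smul_smul] at he2
    have h1 : ee = Lℓ * ∫ ω, form S (e ω) (e ω) ∂P := by
      rw [hee, ← integral_const_mul]; simp only [fA]
    have h2 := mul_le_mul_of_nonneg_left he2 hLp.le
    have h3 : Lℓ * ((7 * σi + 9 * η * κt * σ2) / n) = s ^ 2 * (N0 + N1 * fy) := by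
      rw [hσi, hσ2, hs, hN0, hN1']; field_simp; ring
    have h4 := mul_le_mul_of_nonneg_right hρε (mul_nonneg (sq_nonneg s) (hpos nv))
    rw [fA] at h4 ⊢
    rw [h1]
    linarith
  -- the pointwise bound and its expectation
  set a := ϑ * (1 / ϑ' - 1 / ϑ) with ha
  have ha0 : 0 ≤ a := mul_nonneg hϑ.le hδ0
  have ha1 : a ≤ ϑ / 4 := by
    have := mul_le_mul_of_nonneg_left hδ1 hϑ.le
    linarith
  have hϑ'a : 1 / ϑ' = (1 + a) / ϑ := by rw [ha]; field_simp; ring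
  set U := Yv + (1 - ϑ) • Dv with hU
  set k := (1 + a) ^ 2 * (1 + a / 2) with hk
  have hpw : ∀ ω, lyap D ℓ μℓ xs S ϑ' (innerOutput ℓ η γ θ h (2 * n) yt (fun i => ξ i ω), st.1)
      ≤ k * (fy - s / 2 * (1 - s) * form A nv nv + q / 2 / 2 * form A U U - ϑ * form A nv U
          + form A ((q / 2 / ϑ) • U - s • nv) (e ω) + 1 / 2 * (1 + 1 / s) * form A (e ω) (e ω))
        + q / 2 / 2 * (a ^ 2 + 2 * a) * form A (Yv - ϑ • Dv) (Yv - ϑ • Dv) := by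
    intro ω
    have h1 : gap D ℓ xs (e ω + (yt - s • nv)) ≤ fy + form A nv (e ω - s • nv)
        + 1 / 2 * form A (e ω - s • nv) (e ω - s • nv) := by
      have h2 := hP.risk_upper yt (e ω - s • nv)
      rw [← hgrad, show yt + (e ω - s • nv) = e ω + (yt - s • nv) by abel] at h2
      rw [hfy, gap, gap, fA (e ω - s • nv)]
      linarith
    have h3 := lyap_pointwise hsym hpos hs0 hϑ (by positivity) hws ha0 (hP.gap_nonneg _) Yv Dv nv
      (e ω) h1
    refine le_trans (le_of_eq ?_) h3
    have h4 : e ω + (yt - s • nv) + (1 / ϑ' - 1) • (e ω + (yt - s • nv) - st.1) - xs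
        = (1 + a) • (Yv + (1 - ϑ) • Dv - (s / ϑ) • nv + (1 / ϑ) • e ω) - a • (Yv - ϑ • Dv) := by
      have h5 : st.1 = xs + (Yv - ϑ • Dv) := by rw [← hX]; abel
      have h6 : yt = xs + Yv := by rw [hYv]; abel
      rw [h5, h6, hϑ'a]
      match_scalars <;> field_simp <;> ring
    simp only [lyap, hout, h4]
    rw [fA]
    have : μℓ = q * Lℓ := by rw [hq]; field_simp
    rw [this]; ring
  have i1 : Integrable (fun ω => form A ((q / 2 / ϑ) • U - s • nv) (e ω)) P :=
    integrable_form_left A _ ie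
  have i2 : Integrable (fun ω => 1 / 2 * (1 + 1 / s) * form A (e ω) (e ω)) P := ieA.const_mul _
  set Q0 := fy - s / 2 * (1 - s) * form A nv nv + q / 2 / 2 * form A U U - ϑ * form A nv U
  have i3 : Integrable (fun ω => Q0 + form A ((q / 2 / ϑ) • U - s • nv) (e ω)) P :=
    (integrable_const _).add i1
  have i4 : Integrable (fun ω => k * (Q0 + form A ((q / 2 / ϑ) • U - s • nv) (e ω)
      + 1 / 2 * (1 + 1 / s) * form A (e ω) (e ω))) P := (i3.add i2).const_mul k
  have i5 := i4.add (integrable_const (μ := P)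
    (q / 2 / 2 * (a ^ 2 + 2 * a) * form A (Yv - ϑ • Dv) (Yv - ϑ • Dv)))
  have hlm : Measurable fun ω => lyap D ℓ μℓ xs S ϑ'
      (innerOutput ℓ η γ θ h (2 * n) yt (fun i => ξ i ω), st.1) := by
    simp only [hout]
    exact (hP.measurable_lyap ϑ').comp ((hem.add_const _).prodMk measurable_const)
  have i6 : Integrable (fun ω => lyap D ℓ μℓ xs S ϑ'
      (innerOutput ℓ η γ θ h (2 * n) yt (fun i => ξ i ω), st.1)) P := by
    refine i5.mono' hlm.aestronglyMeasurable (.of_forall fun ω => ?_)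
    rw [Real.norm_of_nonneg (hP.lyap_nonneg _ _)]
    exact hpw ω
  refine ⟨i6, (integral_mono i6 i5 hpw).trans ?_⟩
  simp only [Pi.add_apply]
  rw [integral_add i4 (integrable_const _), integral_const_mul, integral_add i3 i2,
    integral_add (integrable_const _) i1, integral_const_mul, integral_form_left A _ ie]
  simp only [integral_const, probReal_univ, one_smul]
  have hUV : form A U U = (1 - ϑ) * form A (Yv + Dv) (Yv + Dv) + ϑ * form A Yv Yv
      - ϑ * (1 - ϑ) * form A Dv Dv := by
    rw [hU]
    simp only [form_add_left, form_add_right, form_smul_left, form_smul_right, hsym Dv Yv]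
    ring
  have hCS : ∀ x y, form A x y ^ 2 ≤ form A x x * form A y y := fun x y => by
    rw [fA, fA, fA]
    have := mul_le_mul_of_nonneg_left (hpair.form_sq_le x y) (sq_nonneg Lℓ)
    linarith
  have hx : fy - ϑ * form A nv Dv ≤ gap D ℓ xs st.1 := by
    have h1 := hP.risk_lower yt (-(ϑ • Dv))
    have h2 : yt + -(ϑ • Dv) = st.1 := by
      have h3 : st.1 = xs + (Yv - ϑ • Dv) := by rw [← hX]; abel
      rw [h3, hYv]; abel
    rw [h2, ← hg, ← hgrad, ← neg_smul, form_smul_right] at h1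
    have h4 := mul_nonneg (by linarith : 0 ≤ μℓ / 2) (hpair.nonneg ((-ϑ) • Dv))
    rw [hfy, gap, gap]
    linarith
  have hmin : fy + q / 2 * form A Yv Yv ≤ form A nv Yv := by
    have h1 := hP.gap_le_inner yt
    rw [← hg, ← hYv, ← hgrad] at h1
    rw [fA Yv Yv]
    have : q / 2 * (Lℓ * form S Yv Yv) = μℓ / 2 * form S Yv Yv := by rw [hq]; field_simp
    linarith
  have hy : fy ≤ 2 * gap D ℓ xs st.1 + ϑ ^ 2 * form A Dv Dv := by
    have h1 := hP.gap_add_le st.1 (ϑ • Dv)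
    have h2 : st.1 + ϑ • Dv = yt := by
      have h3 : st.1 = xs + (Yv - ϑ • Dv) := by rw [← hX]; abel
      rw [h3, hYv]; abel
    rw [h2, form_smul_smul] at h1
    rw [fA]
    linarith
  have hs1 : s ≤ 1 / 8 := by
    have : q * s ≤ q * (1 / 50) := by linarith
    linarith [le_of_mul_le_mul_left this hq0]
  have hsc := lyap_scalar hq0 hs0 hs1 hϑ hϑ1 hϑq hws hε hN1 hfy0 (hpos nv) (hpos (Yv + Dv))
    (hpos Yv) (hpos Dv) (hpos U) (hpos b) hUV hx hmin hy hbb hee1 hee0 (hCS nv b) (hCS U b)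
  have hXX : form A (Yv - ϑ • Dv) (Yv - ϑ • Dv) ≤ 3 / 2 * form A Yv Yv + form A Dv Dv := by
    have h1 := hpos (Yv + Dv)
    have h2 := hpos Yv
    have h3 := hpos Dv
    simp only [form_add_left, form_add_right, form_sub_left, form_sub_right, form_smul_left,
      form_smul_right, hsym Dv Yv] at h1 ⊢
    have h4 := mul_nonneg hϑ.le h1
    have h5 := mul_le_mul_of_nonneg_right hϑ1 h2
    have h6 := mul_le_mul_of_nonneg_right hϑ1 h3
    have h7 := mul_le_mul_of_nonneg_right hϑ1 (mul_nonneg hϑ.le h3)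
    linarith
  have hF : lyap D ℓ μℓ xs S ϑ st = gap D ℓ xs st.1 + q / 4 * form A (Yv + Dv) (Yv + Dv) := by
    rw [lyap, ← hv, hV, fA]
    have : μℓ = q * Lℓ := by rw [hq]; field_simp
    rw [this]; ring
  refine momentum_change_le hq0.le hϑ hϑ1 ha0 ha1 (hP.lyap_nonneg ϑ st)
    (mul_nonneg hs0.le hN00) (hpos Yv) (hpos Dv) hXX ?_
  rw [hF]
  refine le_trans (le_of_eq ?_) hsc
  have h1 : form A nv U = form A nv Yv + (1 - ϑ) * form A nv Dv := by
    rw [hU, form_add_right, form_smul_right]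
  have h2 : form A ((q / 2 / ϑ) • U - s • nv) b = q / 2 / ϑ * form A U b - s * form A nv b := by
    rw [form_sub_left, form_smul_left, form_smul_left]
  rw [h2]
  simp only [Q0, h1]
  rfl

end Problem
end OuterStep

/-! ### The momentum schedule -/

section Schedule

variable {θmax : ℝ} {K : ℕ}

/-- In terms of `1 / ϑ_k` the schedule is constant and then grows linearly with slope `1 / 4`. -/
lemma one_div_thetaSched (k : ℕ) :
    1 / thetaSched θmax K k = 1 / θmax + max 0 (((k : ℝ) - K / 2) / 4) := by
  unfold thetaSched
  split_ifs with h
  · rw [max_eq_left (by linarith), add_zero]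
  · push Not at h
    rw [max_eq_right (by linarith), one_div_div]
    ring

lemma thetaSched_pos (hθ : 0 < θmax) (k : ℕ) : 0 < thetaSched θmax K k := by
  rw [← one_div_pos, one_div_thetaSched]
  positivity

lemma thetaSched_anti (hθ : 0 < θmax) {j k : ℕ} (hjk : j ≤ k) :
    thetaSched θmax K k ≤ thetaSched θmax K j := by
  rw [← one_div_le_one_div (thetaSched_pos hθ j) (thetaSched_pos hθ k), one_div_thetaSched,
    one_div_thetaSched]
  have : (j : ℝ) ≤ k := by exact_mod_cast hjk
  gcongr

lemma thetaSched_zero : thetaSched θmax K 0 = θmax := by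
  rw [thetaSched, if_pos (by simpa using by positivity)]

lemma thetaSched_le (hθ : 0 < θmax) (k : ℕ) : thetaSched θmax K k ≤ θmax :=
  (thetaSched_anti hθ (Nat.zero_le k)).trans_eq thetaSched_zero

lemma one_div_thetaSched_succ_le (k : ℕ) :
    1 / thetaSched θmax K (k + 1) - 1 / thetaSched θmax K k ≤ 1 / 4 := by
  rw [one_div_thetaSched, one_div_thetaSched]
  have : max 0 (((k + 1 : ℕ) - (K : ℝ) / 2) / 4) ≤ max 0 (((k : ℝ) - K / 2) / 4) + 1 / 4 := by
    push_cast
    refine max_le (by positivity) ?_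
    have := le_max_right 0 (((k : ℝ) - K / 2) / 4)
    linarith
  linarith

lemma thetaSched_self_le (hθ : 0 < θmax) (hK : 1 ≤ K) : thetaSched θmax K K ≤ 8 / K := by
  have hK0 : (0 : ℝ) < K := by exact_mod_cast hK
  rw [← one_div_le_one_div (by positivity) (thetaSched_pos hθ K), one_div_thetaSched, one_div_div]
  have h1 := le_max_right 0 (((K : ℝ) - K / 2) / 4)
  have h2 : 0 < 1 / θmax := by positivity
  linarith

/-- Half of the iterations use `θmax`; the bound `K / 3` also covers the smallest `K`. -/
lemma le_sum_thetaSched (hθ : 0 < θmax) (hθ1 : θmax ≤ 1) (hK : 1 ≤ K) :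
    K * θmax / 3 ≤ ∑ j ∈ Finset.range K, thetaSched θmax K (j + 1) := by
  rcases hK.eq_or_lt with rfl | hK2
  · have h1 := one_div_thetaSched (θmax := θmax) (K := 1) 1
    norm_num at h1
    have h2 : thetaSched θmax 1 1 = 1 / (θmax⁻¹ + 1 / 8) := by rw [← h1]; simp
    simp only [Finset.range_one, Finset.sum_singleton, zero_add, Nat.cast_one, one_mul]
    rw [h2, le_div_iff₀ (by positivity)]
    have h3 : θmax / 3 * (θmax⁻¹ + 1 / 8) = 1 / 3 + θmax / 24 := by field_simp; ring
    linarith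
  · have h1 : ∑ j ∈ Finset.range (K / 2), thetaSched θmax K (j + 1)
        ≤ ∑ j ∈ Finset.range K, thetaSched θmax K (j + 1) :=
      Finset.sum_le_sum_of_subset_of_nonneg (Finset.range_mono (Nat.div_le_self K 2))
        fun j _ _ => (thetaSched_pos hθ _).le
    have h2 : ∀ j ∈ Finset.range (K / 2), thetaSched θmax K (j + 1) = θmax := by
      intro j hj
      rw [thetaSched, if_pos]
      have h3 : (j + 1) * 2 ≤ K := by have := Finset.mem_range.1 hj; omega
      have h4 : ((j + 1 : ℕ) : ℝ) * 2 ≤ K := by exact_mod_cast h3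
      linarith
    rw [Finset.sum_congr rfl h2, Finset.sum_const, Finset.card_range, nsmul_eq_mul] at h1
    have h3 : (K : ℝ) ≤ 3 * (K / 2 : ℕ) := by
      have : K ≤ 3 * (K / 2) := by omega
      exact_mod_cast this
    have h4 := mul_le_mul_of_nonneg_right h3 hθ.le
    linarith

/-- Solution of the recursion of the outer loop: the contraction factors multiply up, while the
noise terms `c ϑ_k²` sum to `20 c ϑ_k` because the schedule decays slowly. -/
lemma recursion_bound {E ϑ : ℕ → ℝ} {c : ℝ} (hc : 0 ≤ c) (hϑ : ∀ k, 0 < ϑ k)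
    (hϑ1 : ∀ k, ϑ k ≤ 1 / 100) (hδ : ∀ k, 1 / ϑ (k + 1) - 1 / ϑ k ≤ 1 / 4) (hE0 : 0 ≤ E 0)
    {K : ℕ} (hE : ∀ k < K, E (k + 1) ≤ (1 - 3 / 10 * ϑ (k + 1)) * E k + c * ϑ (k + 1) ^ 2) :
    ∀ k ≤ K, E k ≤ Real.exp (-(3 / 10 * ∑ j ∈ Finset.range k, ϑ (j + 1))) * E 0
      + 20 * c * ϑ k := by
  intro k
  induction k with
  | zero =>
    intro _
    simp only [Finset.range_zero, Finset.sum_empty, mul_zero, neg_zero, Real.exp_zero, one_mul]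
    have := mul_nonneg (mul_nonneg (by norm_num : (0 : ℝ) ≤ 20) hc) (hϑ 0).le
    linarith
  | succ k ih =>
    intro hk
    have h1 := ih (by omega)
    have h2 := hE k (by omega)
    have p := hϑ k
    have p' := hϑ (k + 1)
    have q' := hϑ1 (k + 1)
    set x := ϑ (k + 1)
    set y := ϑ k
    have h3 : (1 - x / 4) * y ≤ x := by
      have h4 : 1 / x ≤ 1 / y + 1 / 4 := by linarith [hδ k]
      have h5 := mul_le_mul_of_nonneg_right h4 (mul_pos p' p).le
      have h6 : 1 / x * (x * y) = y := by field_simp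
      have h7 : (1 / y + 1 / 4) * (x * y) = x + x * y / 4 := by field_simp
      linarith
    have h4 : (1 - 3 / 10 * x) * (20 * y) + x ^ 2 ≤ 20 * x := by
      have h5 := mul_le_mul_of_nonneg_left h3 (by linarith : (0 : ℝ) ≤ 1 - 3 / 10 * x)
      have h6 : 0 < 1 - x / 4 := by linarith
      refine le_of_mul_le_mul_left ?_ h6
      nlinarith [mul_pos p' p', mul_pos (mul_pos p' p') p']
    have h5 : (1 - 3 / 10 * x) * Real.exp (-(3 / 10 * ∑ j ∈ Finset.range k, ϑ (j + 1)))
        ≤ Real.exp (-(3 / 10 * ∑ j ∈ Finset.range (k + 1), ϑ (j + 1))) := by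
      rw [Finset.sum_range_succ, mul_add, neg_add, Real.exp_add, mul_comm]
      refine mul_le_mul_of_nonneg_left ?_ (Real.exp_pos _).le
      have := Real.add_one_le_exp (-(3 / 10 * x))
      linarith
    have h6 := mul_le_mul_of_nonneg_left h1 (by linarith : (0 : ℝ) ≤ 1 - 3 / 10 * x)
    have h7 := mul_le_mul_of_nonneg_right h5 hE0
    have h8 := mul_le_mul_of_nonneg_left h4 hc
    linarith

end Schedule

/-! ### The outer loop -/

section OuterLoop

variable {d : ℕ} {Y : Type u} [MeasurableSpace Y] {D : Measure (Vec d × Y)}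
  [IsProbabilityMeasure D] {ℓ : ℝ → Y → ℝ} {Lℓ μℓ : ℝ}
  {xs : Vec d} {S T : Vec d →L[ℝ] Vec d} {mu R2 κt : ℝ}

lemma measurable_extrapolate (β : ℝ) : Measurable (extrapolate (d := d) β) := by
  unfold extrapolate; fun_prop

namespace Problem

variable (hP : Problem D ℓ Lℓ μℓ xs S T mu R2 κt)
include hP

lemma measurable_innerStep (η γ θ h : ℝ) :
    Measurable fun q : (Vec d × (Vec d × Y)) × (Vec d × Vec d) =>
      innerStep ℓ η γ θ h q.1.1 q.1.2 q.2 := by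
  have h1 : Measurable fun q : (Vec d × (Vec d × Y)) × (Vec d × Vec d) =>
      lossDeriv ℓ (inner ℝ q.1.2.1 q.1.1) q.1.2.2 :=
    hP.measurable_lossDeriv_inner.comp
      ((measurable_snd.comp measurable_fst).prodMk (measurable_fst.comp measurable_fst))
  simp only [innerStep]
  fun_prop

lemma measurable_innerIter (η γ θ h : ℝ) (t : ℕ) :
    Measurable fun q : Vec d × (ℕ → Vec d × Y) => innerIter ℓ η γ θ h q.1 q.2 t := by
  induction t with
  | zero => exact measurable_fst.prodMk measurable_fst
  | succ t ih =>
    have h1 : Measurable fun q : Vec d × (ℕ → Vec d × Y) => q.2 (t + 1) := by fun_prop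
    have h2 := (hP.measurable_innerStep η γ θ h).comp ((measurable_fst.prodMk h1).prodMk ih)
    simp only [innerIter]
    exact h2

lemma measurable_innerOutput (η γ θ h : ℝ) (N : ℕ) :
    Measurable fun q : Vec d × (ℕ → Vec d × Y) => innerOutput ℓ η γ θ h N q.1 q.2 := by
  have h1 : Measurable fun q : Vec d × (ℕ → Vec d × Y) => ∑ t ∈ Finset.Icc (N / 2 + 1) N,
      (innerIter ℓ η γ θ h q.1 q.2 t).1 :=
    Finset.measurable_fun_sum _ fun t _ => (hP.measurable_innerIter η γ θ h t).fst
  exact h1.const_smul (2 / (N : ℝ))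

lemma measurable_outerStep (η γ θ h β : ℝ) (N : ℕ) :
    Measurable fun q : (Vec d × Vec d) × (ℕ → Vec d × Y) =>
      (innerOutput ℓ η γ θ h N (extrapolate β q.1) q.2, q.1.1) := by
  have h1 : Measurable fun q : (Vec d × Vec d) × (ℕ → Vec d × Y) => extrapolate β q.1 :=
    (measurable_extrapolate β).comp measurable_fst
  exact ((hP.measurable_innerOutput η γ θ h N).comp (h1.prodMk measurable_snd)).prodMk
    (measurable_fst.comp measurable_fst)

variable {Ω : Type v} [MeasurableSpace Ω] {P : Measure Ω} [IsProbabilityMeasure P]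
  {ξ : ℕ → ℕ → Ω → Vec d × Y} {η γ θ : ℝ}

omit hP in
/-- The samples of one outer iteration, as a single random variable. -/
lemma measurable_block (k : ℕ) :
    Measurable[⨆ i ∈ {i : ℕ × ℕ | i.1 = k}, MeasurableSpace.comap (ξ i.1 i.2) inferInstance]
      fun ω t => ξ k t ω := by
  refine @measurable_pi_lambda _ _ _ (_) _ _ fun t => ?_
  have h1 : MeasurableSpace.comap (ξ k t) inferInstance
      ≤ ⨆ i ∈ {i : ℕ × ℕ | i.1 = k}, MeasurableSpace.comap (ξ i.1 i.2) inferInstance :=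
    le_biSup (f := fun i : ℕ × ℕ => MeasurableSpace.comap (ξ i.1 i.2) inferInstance)
      (show (k, t) ∈ {i : ℕ × ℕ | i.1 = k} from rfl)
  exact (comap_measurable (ξ k t)).mono h1 le_rfl

/-- The `k`-th outer iterates depend on the samples of the first `k` outer iterations only. -/
lemma measurable_outerIter (h β : ℕ → ℝ) (N : ℕ) (x0 : Vec d) (k : ℕ) :
    Measurable[⨆ i ∈ {i : ℕ × ℕ | i.1 ≤ k}, MeasurableSpace.comap (ξ i.1 i.2) inferInstance]
      fun ω => outerIter ℓ η γ θ h β N x0 (fun k t => ξ k t ω) k := by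
  induction k with
  | zero => exact measurable_const
  | succ k ih =>
    have h1 : Measurable[⨆ i ∈ {i : ℕ × ℕ | i.1 ≤ k + 1},
        MeasurableSpace.comap (ξ i.1 i.2) inferInstance]
        fun ω => outerIter ℓ η γ θ h β N x0 (fun k t => ξ k t ω) k :=
      ih.mono (biSup_mono fun i (hi : i.1 ≤ k) => Nat.le_succ_of_le hi) le_rfl
    have h2 : Measurable[⨆ i ∈ {i : ℕ × ℕ | i.1 ≤ k + 1},
        MeasurableSpace.comap (ξ i.1 i.2) inferInstance] fun ω t => ξ (k + 1) t ω :=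
      (measurable_block (k + 1)).mono (biSup_mono fun i (hi : i.1 = k + 1) => hi.le) le_rfl
    have h3 := hP.measurable_outerStep η γ θ (h (k + 1)) (β (k + 1)) N
    have h4 := h3.comp (h1.prodMk h2)
    simp only [outerIter]
    exact h4

/-- One outer iteration along the stochastic trajectory. -/
lemma outer_recursion {B L : ℝ} (hB : GradNoise2 D ℓ xs Lℓ B)
    (hL : ∀ x, ∫ p, (lossDeriv ℓ (inner ℝ p.1 x) p.2
      - lossDeriv ℓ (inner ℝ p.1 xs) p.2) ^ 2 * form T p.1 p.1 ∂D ≤ 2 * Lℓ * L * gap D ℓ xs x)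
    (hB0 : 0 ≤ B) (hL0 : 0 ≤ L) (hst : StepSizes mu R2 κt η γ θ)
    (hξ : ∀ k t, Measurable (ξ k t)) (hlaw : ∀ k t, P.map (ξ k t) = D)
    (hind : iIndepFun (fun i : ℕ × ℕ => ξ i.1 i.2) P)
    {lam : ℝ} (hlam : mu ≤ lam) (hup : ∀ x, form S x x ≤ lam * ‖x‖ ^ 2)
    {n : ℕ} (hn : 404 ≤ n * θ) {h β ϑ : ℕ → ℝ} {k : ℕ} (hh : 0 < h (k + 1))
    (hβ : β (k + 1) = (1 - ϑ (k + 1)) / (1 + ϑ (k + 1)))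
    (hϑ : 0 < ϑ (k + 1)) (hϑ1 : ϑ (k + 1) ≤ 1 / 100)
    (hϑq : ϑ (k + 1) ^ 2 ≤ μℓ / Lℓ / 100) (hws : μℓ / Lℓ / 2 * (h (k + 1) * Lℓ) = ϑ (k + 1) ^ 2)
    (hδ0 : 0 ≤ 1 / ϑ (k + 2) - 1 / ϑ (k + 1)) (hδ1 : 1 / ϑ (k + 2) - 1 / ϑ (k + 1) ≤ 1 / 4)
    (hε : 2 * (lam / mu) * (1 - θ) ^ n ≤ ϑ (k + 1) / 200)
    (hN1 : h (k + 1) * Lℓ * (6 / n * (7 * (L + κt) + 9 * η * κt * (B + R2))) ≤ ϑ (k + 1) / 50)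
    (x0 : Vec d)
    (hi : Integrable (fun ω => lyap D ℓ μℓ xs S (ϑ (k + 1))
      (outerIter ℓ η γ θ h β (2 * n) x0 (fun k t => ξ k t ω) k)) P) :
    Integrable (fun ω => lyap D ℓ μℓ xs S (ϑ (k + 2))
      (outerIter ℓ η γ θ h β (2 * n) x0 (fun k t => ξ k t ω) (k + 1))) P ∧
    ∫ ω, lyap D ℓ μℓ xs S (ϑ (k + 2))
      (outerIter ℓ η γ θ h β (2 * n) x0 (fun k t => ξ k t ω) (k + 1)) ∂P
      ≤ (1 - 3 / 10 * ϑ (k + 1)) * ∫ ω, lyap D ℓ μℓ xs S (ϑ (k + 1))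
          (outerIter ℓ η γ θ h β (2 * n) x0 (fun k t => ξ k t ω) k) ∂P
        + 11 / 10 * (h (k + 1) * Lℓ * (3 / n * (7 * (∫ p, lossDeriv ℓ (inner ℝ p.1 xs) p.2 ^ 2
            * form T p.1 p.1 ∂D) + 9 * η * κt
            * ∫ p, lossDeriv ℓ (inner ℝ p.1 xs) p.2 ^ 2 * ‖p.1‖ ^ 2 ∂D) / Lℓ)) := by
  have hind' : iIndepFun (ξ (k + 1)) P :=
    hind.precomp (g := fun t => ((k + 1, t) : ℕ × ℕ)) (Prod.mk_right_injective _)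
  have hone := hP.outer_step hB hL hB0 hL0 hst (hξ (k + 1)) (hlaw (k + 1)) hind' hlam hup hn hh hϑ
    hϑ1 hϑq hws hδ0 hδ1 hε hN1
  have hSm := hP.measurable_outerIter (ξ := ξ) (η := η) (γ := γ) (θ := θ) h β (2 * n) x0 k
  have hBm := measurable_block (ξ := ξ) (k + 1)
  have hle : ∀ A : Set (ℕ × ℕ), ⨆ i ∈ A, MeasurableSpace.comap (ξ i.1 i.2) inferInstance
      ≤ ‹MeasurableSpace Ω› := fun A => iSup₂_le fun i _ => (hξ i.1 i.2).comap_le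
  have hdisj : Disjoint {i : ℕ × ℕ | i.1 ≤ k} {i : ℕ × ℕ | i.1 = k + 1} := by
    rw [Set.disjoint_left]
    intro i (h1 : i.1 ≤ k) (h2 : i.1 = k + 1)
    omega
  have hindep := indepFun_of_measurable_iSup (fun i : ℕ × ℕ => hξ i.1 i.2) hind hdisj hSm hBm
  set N := 11 / 10 * (h (k + 1) * Lℓ * (3 / n * (7 * (∫ p, lossDeriv ℓ (inner ℝ p.1 xs) p.2 ^ 2
            * form T p.1 p.1 ∂D) + 9 * η * κt
            * ∫ p, lossDeriv ℓ (inner ℝ p.1 xs) p.2 ^ 2 * ‖p.1‖ ^ 2 ∂D) / Lℓ)) with hN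
  have hV : Integrable (fun ω => (1 - 3 / 10 * ϑ (k + 1)) * lyap D ℓ μℓ xs S (ϑ (k + 1))
      (outerIter ℓ η γ θ h β (2 * n) x0 (fun k t => ξ k t ω) k) + N) P :=
    (hi.const_mul _).add (integrable_const _)
  have hW := (hP.measurable_lyap (ϑ (k + 2))).comp
    (hP.measurable_outerStep η γ θ (h (k + 1)) (β (k + 1)) (2 * n))
  rw [hβ] at hW
  obtain ⟨r1, r2⟩ := integral_le_of_indepFun (P := P) (hSm.mono (hle _) le_rfl)
    (hBm.mono (hle _) le_rfl) hindep
    (W := fun st b => lyap D ℓ μℓ xs S (ϑ (k + 2)) (innerOutput ℓ η γ θ (h (k + 1)) (2 * n)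
      (extrapolate ((1 - ϑ (k + 1)) / (1 + ϑ (k + 1))) st) b, st.1)) hW
    (fun st b => hP.lyap_nonneg _ _)
    (V := fun st => (1 - 3 / 10 * ϑ (k + 1)) * lyap D ℓ μℓ xs S (ϑ (k + 1)) st + N) hV
    (fun st => (hone st).1) (fun st => (hone st).2)
  rw [integral_add (hi.const_mul _) (integrable_const _), integral_const_mul, integral_const,
    probReal_univ, one_smul] at r2
  rw [← hβ] at r1 r2
  exact ⟨r1, r2⟩

/-- Convergence of the outer loop with the two-phase schedule. -/
theorem integral_gap_outerIter_le {B L : ℝ} (hB : GradNoise2 D ℓ xs Lℓ B)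
    (hL : ∀ x, ∫ p, (lossDeriv ℓ (inner ℝ p.1 x) p.2
      - lossDeriv ℓ (inner ℝ p.1 xs) p.2) ^ 2 * form T p.1 p.1 ∂D ≤ 2 * Lℓ * L * gap D ℓ xs x)
    (hB0 : 0 ≤ B) (hL0 : 0 ≤ L) (hst : StepSizes mu R2 κt η γ θ)
    (hξ : ∀ k t, Measurable (ξ k t)) (hlaw : ∀ k t, P.map (ξ k t) = D)
    (hind : iIndepFun (fun i : ℕ × ℕ => ξ i.1 i.2) P)
    {lam : ℝ} (hlam : mu ≤ lam) (hup : ∀ x, form S x x ≤ lam * ‖x‖ ^ 2)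
    {n : ℕ} (hn : 404 ≤ n * θ) {θmax : ℝ} {K : ℕ} (hK : 1 ≤ K) (hθ0 : 0 < θmax)
    (hθ1 : θmax ≤ 1 / 100) (hθq : θmax ^ 2 ≤ μℓ / Lℓ / 100)
    (hε : 2 * (lam / mu) * (1 - θ) ^ n ≤ thetaSched θmax K K / 200)
    (hN1 : 2 * (Lℓ / μℓ) * θmax * (6 / n * (7 * (L + κt) + 9 * η * κt * (B + R2))) ≤ 1 / 50)
    (x0 : Vec d) :
    Integrable (fun ω => gap D ℓ xs (outerIter ℓ η γ θ (stepSched (Lℓ / μℓ) Lℓ θmax K)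
      (momentumSched θmax K) (2 * n) x0 (fun k t => ξ k t ω) K).1) P ∧
    ∫ ω, gap D ℓ xs (outerIter ℓ η γ θ (stepSched (Lℓ / μℓ) Lℓ θmax K)
      (momentumSched θmax K) (2 * n) x0 (fun k t => ξ k t ω) K).1 ∂P
      ≤ 3 / 2 * Real.exp (-(1 / 10 * (K * θmax))) * gap D ℓ xs x0
        + 352 * (Lℓ / μℓ) / K * (3 / n * (7 * (∫ p, lossDeriv ℓ (inner ℝ p.1 xs) p.2 ^ 2
            * form T p.1 p.1 ∂D) + 9 * η * κt
            * ∫ p, lossDeriv ℓ (inner ℝ p.1 xs) p.2 ^ 2 * ‖p.1‖ ^ 2 ∂D) / Lℓ) := by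
  have hLp := hP.loss.L_pos
  have hmp := hP.loss.mu_pos
  have hκ := hP.design.one_le
  have hR := hst.R2_nonneg
  have hη := hst.eta_pos
  set h := stepSched (Lℓ / μℓ) Lℓ θmax K with hh
  set β := momentumSched θmax K with hβ
  set ϑ := thetaSched θmax K with hϑ
  set N0 := 3 / n * (7 * (∫ p, lossDeriv ℓ (inner ℝ p.1 xs) p.2 ^ 2
            * form T p.1 p.1 ∂D) + 9 * η * κt
            * ∫ p, lossDeriv ℓ (inner ℝ p.1 xs) p.2 ^ 2 * ‖p.1‖ ^ 2 ∂D) / Lℓ with hN0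
  have hN00 : 0 ≤ N0 := by
    have h1 : 0 ≤ ∫ p, lossDeriv ℓ (inner ℝ p.1 xs) p.2 ^ 2 * form T p.1 p.1 ∂D :=
      integral_nonneg fun p => mul_nonneg (sq_nonneg _) (hP.design.pair.inv_nonneg _)
    have h2 : 0 ≤ ∫ p, lossDeriv ℓ (inner ℝ p.1 xs) p.2 ^ 2 * ‖p.1‖ ^ 2 ∂D :=
      integral_nonneg fun p => mul_nonneg (sq_nonneg _) (sq_nonneg _)
    positivity
  have hpos : ∀ k, 0 < ϑ k := thetaSched_pos hθ0
  have hle : ∀ k, ϑ k ≤ θmax := thetaSched_le hθ0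
  have hhL : ∀ k, h k * Lℓ = 2 * (Lℓ / μℓ) * ϑ k ^ 2 := fun k => by
    rw [hh, stepSched, hϑ]; field_simp
  set x : ℕ → Ω → Vec d × Vec d := fun k ω =>
    outerIter ℓ η γ θ h β (2 * n) x0 (fun k t => ξ k t ω) k with hx
  have hrec : ∀ k < K, Integrable (fun ω => lyap D ℓ μℓ xs S (ϑ (k + 1)) (x k ω)) P →
      Integrable (fun ω => lyap D ℓ μℓ xs S (ϑ (k + 2)) (x (k + 1) ω)) P ∧
      ∫ ω, lyap D ℓ μℓ xs S (ϑ (k + 2)) (x (k + 1) ω) ∂P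
        ≤ (1 - 3 / 10 * ϑ (k + 1)) * ∫ ω, lyap D ℓ μℓ xs S (ϑ (k + 1)) (x k ω) ∂P
          + 11 / 10 * (h (k + 1) * Lℓ * N0) := by
    intro k hk hi
    have p := hpos (k + 1)
    have l := hle (k + 1)
    refine hP.outer_recursion hB hL hB0 hL0 hst hξ hlaw hind hlam hup hn ?_ rfl p (l.trans hθ1) ?_ ?_
      ?_ (one_div_thetaSched_succ_le _) ?_ ?_ x0 hi
    · rw [hh, stepSched]; positivity
    · exact (pow_le_pow_left₀ p.le l 2).trans hθq
    · rw [hhL]; field_simp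
    · rw [sub_nonneg, one_div_le_one_div p (hpos _)]
      exact thetaSched_anti hθ0 (Nat.le_succ _)
    · have : ϑ K ≤ ϑ (k + 1) := thetaSched_anti hθ0 hk
      linarith
    · rw [hhL]
      have h1 : 0 ≤ 6 / n * (7 * (L + κt) + 9 * η * κt * (B + R2)) := by positivity
      have h2 : 2 * (Lℓ / μℓ) * ϑ (k + 1) * (6 / n * (7 * (L + κt) + 9 * η * κt * (B + R2)))
          ≤ 1 / 50 := le_trans (by gcongr) hN1
      have h3 := mul_le_mul_of_nonneg_right h2 p.le
      linarith
  have hint : ∀ k ≤ K, Integrable (fun ω => lyap D ℓ μℓ xs S (ϑ (k + 1)) (x k ω)) P := by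
    intro k
    induction k with
    | zero => exact fun _ => integrable_const (lyap D ℓ μℓ xs S (ϑ 1) (x0, x0))
    | succ k ih => exact fun hk => (hrec k hk (ih (by omega))).1
  set E : ℕ → ℝ := fun k => ∫ ω, lyap D ℓ μℓ xs S (ϑ (k + 1)) (x k ω) ∂P with hE
  have hE0 : E 0 = lyap D ℓ μℓ xs S (ϑ 1) (x0, x0) := by
    simp [hE, hx, outerIter]
  set c := 11 / 10 * (2 * (Lℓ / μℓ) * N0) with hc
  have hc0 : 0 ≤ c := by positivity
  have hb := recursion_bound (E := E) (ϑ := ϑ) hc0 hpos (fun k => (hle k).trans hθ1)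
    one_div_thetaSched_succ_le (hE0 ▸ hP.lyap_nonneg _ _) (K := K)
    (fun k hk => by
      have h1 := (hrec k hk (hint k hk.le)).2
      rw [hhL] at h1
      change E (k + 1) ≤ (1 - 3 / 10 * ϑ (k + 1)) * E k + _ at h1
      rw [hc]
      linarith) K le_rfl
  have hm : Measurable (x K) :=
    (hP.measurable_outerIter h β (2 * n) x0 K).mono
      (iSup₂_le fun i _ => (hξ i.1 i.2).comap_le) le_rfl
  have hgi : Integrable (fun ω => gap D ℓ xs (x K ω).1) P := by
    refine (hint K le_rfl).mono'
      ((hP.measurable_risk.comp hm.fst).sub_const _).aestronglyMeasurable (.of_forall fun ω => ?_)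
    rw [Real.norm_of_nonneg (hP.gap_nonneg _)]
    exact hP.gap_le_lyap _ _
  refine ⟨hgi, (integral_mono hgi (hint K le_rfl) fun ω => hP.gap_le_lyap _ _).trans (hb.trans ?_)⟩
  refine add_le_add ?_ ?_
  · have h1 : Real.exp (-(3 / 10 * ∑ j ∈ Finset.range K, ϑ (j + 1)))
        ≤ Real.exp (-(1 / 10 * (K * θmax))) := by
      have := le_sum_thetaSched hθ0 (by linarith) hK
      exact Real.exp_le_exp.2 (by linarith)
    rw [hE0]
    calc _ ≤ Real.exp (-(1 / 10 * (K * θmax))) * (3 / 2 * gap D ℓ xs x0) :=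
          mul_le_mul h1 (hP.lyap_start_le _ _) (hP.lyap_nonneg _ _) (Real.exp_pos _).le
      _ = _ := by ring
  · calc 20 * c * ϑ K ≤ 20 * c * (8 / K) := by
          gcongr; exact thetaSched_self_le hθ0 hK
      _ = _ := by rw [hc]; ring

end Problem
end OuterLoop

/-! ### Hyperparameters -/

section Parameters

lemma InversePair.mu_le_lam {E : Type*} [NormedAddCommGroup E] [InnerProductSpace ℝ E]
    [Nontrivial E] {S T : E →L[ℝ] E} {mu lam : ℝ} (h : InversePair S T mu lam) : mu ≤ lam := by
  obtain ⟨x, hx⟩ := exists_ne (0 : E)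
  have h1 : 0 < ‖x‖ ^ 2 := by positivity
  exact le_of_mul_le_mul_right ((h.lower x).trans (h.upper x)) h1

lemma stepSizes_param {mu R2 κt η : ℝ} (hmu : 0 < mu) (hR : mu ≤ R2) (hκ : 1 ≤ κt) (hη : 0 < η)
    (hηR : η ≤ 1 / (16 * R2)) :
    StepSizes mu R2 κt η (gammaParam η κt mu) (thetaParam η κt mu) := by
  have hR0 : 0 < R2 := hmu.trans_le hR
  have hκ0 : 0 < κt := by linarith
  have h1 : R2 * η ≤ 1 / 16 := by
    rw [le_div_iff₀ (by positivity)] at hηR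
    linarith
  refine ⟨hη, ?_, ?_, ?_, hR0.le, h1, ?_, ?_⟩
  · unfold gammaParam; positivity
  · unfold thetaParam; positivity
  · have h2 : mu * η / κt ≤ 1 := by
      rw [div_le_one hκ0]
      nlinarith
    have := Real.sqrt_le_one.2 h2
    unfold thetaParam
    linarith
  · have h2 : mu * η / κt = mu ^ 2 * (η / (κt * mu)) := by field_simp
    rw [thetaParam, h2, Real.sqrt_mul (sq_nonneg _), Real.sqrt_sq hmu.le, gammaParam]
    ring
  · rw [gammaParam, mul_pow, Real.sq_sqrt (by positivity)]
    field_simp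
    norm_num

/-- The inner loop is long enough to forget its initialisation: `404` is what the variance bound of
the tail average needs, and the second estimate makes its bias negligible. -/
lemma inner_length {mu lam κt η ϑ : ℝ} {n : ℕ} (hmu : 0 < mu) (hlam : mu ≤ lam) (hκ : 1 ≤ κt)
    (hη : 0 < η) (hθ1 : thetaParam η κt mu ≤ 1) (hϑ : 0 < ϑ) (hϑ1 : ϑ ≤ 1 / 100)
    (hT : 4000 * Real.sqrt (κt / (mu * η)) * Real.log (4 * (lam / mu) / ϑ ^ 2)
      ≤ ((2 * n : ℕ) : ℝ)) :
    404 ≤ n * thetaParam η κt mu ∧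
      2 * (lam / mu) * (1 - thetaParam η κt mu) ^ n ≤ ϑ / 200 := by
  have hκ0 : 0 < κt := by linarith
  set θ := thetaParam η κt mu with hθ
  have hθ0 : 0 < θ := by rw [hθ, thetaParam]; positivity
  have hr : 1 ≤ lam / mu := by rwa [le_div_iff₀ hmu, one_mul]
  set X := 4 * (lam / mu) / ϑ ^ 2 with hX
  have hX4 : Real.exp 1 ≤ X := by
    rw [hX, le_div_iff₀ (by positivity)]
    have h1 := Real.exp_one_lt_d9
    have h2 : ϑ ^ 2 ≤ 1 := by nlinarith
    nlinarith [Real.exp_pos 1]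
  have hX0 : 0 < X := (Real.exp_pos 1).trans_le hX4
  have hlog : 1 ≤ Real.log X := by rwa [Real.le_log_iff_exp_le hX0]
  have hsq : θ * Real.sqrt (κt / (mu * η)) = 1 / 4 := by
    rw [hθ, thetaParam, mul_assoc, ← Real.sqrt_mul (by positivity)]
    have : mu * η / κt * (κt / (mu * η)) = 1 := by field_simp
    rw [this, Real.sqrt_one]; norm_num
  have h1 := mul_le_mul_of_nonneg_left hT hθ0.le
  have h2 : θ * (4000 * Real.sqrt (κt / (mu * η)) * Real.log X) = 1000 * Real.log X := by
    linear_combination 4000 * Real.log X * hsq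
  push_cast at h1
  have h3 : 500 * Real.log X ≤ n * θ := by linarith
  refine ⟨by linarith, ?_⟩
  have h4 : (1 - θ) ^ n ≤ X⁻¹ := by
    calc (1 - θ) ^ n ≤ Real.exp (-θ) ^ n := by
          refine pow_le_pow_left₀ (by linarith) ?_ n
          have := Real.add_one_le_exp (-θ)
          linarith
      _ = Real.exp (-(n * θ)) := by rw [← Real.exp_nat_mul]; ring_nf
      _ ≤ Real.exp (-Real.log X) := Real.exp_le_exp.2 (by linarith)
      _ = X⁻¹ := by rw [Real.exp_neg, Real.exp_log hX0]
  calc 2 * (lam / mu) * (1 - θ) ^ n ≤ 2 * (lam / mu) * X⁻¹ := by gcongr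
    _ = ϑ * ϑ / 2 := by
        have hl : lam ≠ 0 := (hmu.trans_le hlam).ne'
        rw [hX]; field_simp; norm_num
    _ ≤ ϑ * (1 / 100) / 2 := by gcongr
    _ = ϑ / 200 := by ring

/-- A lower bound on the momentum parameter turns the contraction per outer iteration into the
stated exponential rate. -/
lemma exp_rate_le {c₁ u w w' K θmax : ℝ} (hc : 0 < c₁) (hu : 0 < u) (hw : 0 < w) (hK : 0 ≤ K)
    (hw' : w' = 1 / w) (h : c₁ * min (1 / u) w' ≤ θmax) :
    Real.exp (-(1 / 10 * (K * θmax))) ≤ Real.exp (-(c₁ / 10 * K / (u + w))) := by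
  have h1 : 1 / (u + w) ≤ min (1 / u) w' := by
    rw [hw']
    exact le_min (one_div_le_one_div_of_le hu (by linarith))
      (one_div_le_one_div_of_le hw (by linarith))
  have h2 : c₁ * (1 / (u + w)) ≤ θmax := le_trans (by gcongr) h
  have h3 := mul_le_mul_of_nonneg_left h2 hK
  have h4 : c₁ / 10 * K / (u + w) = 1 / 10 * (K * (c₁ * (1 / (u + w)))) := by ring
  rw [h4]
  exact Real.exp_le_exp.2 (by linarith)

end Parameters

/-! ### Convergence of the algorithm -/

section Final

variable {d : ℕ} {Y : Type u} [MeasurableSpace Y] {D : Measure (Vec d × Y)}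
  [IsProbabilityMeasure D] {ℓ : ℝ → Y → ℝ} {Lℓ μℓ : ℝ} {xs : Vec d} {S T : Vec d →L[ℝ] Vec d}
  {mu R2 κt : ℝ}

namespace Problem

variable (hP : Problem D ℓ Lℓ μℓ xs S T mu R2 κt)
include hP

/-- Without further assumptions the gradient noise in the norm of weight `w` is controlled by the
fourth-moment constant `k` of that norm, at the price of a factor `α`. -/
lemma noise_sub_le {w : Vec d × Y → ℝ} {k : ℝ} (hw : ∀ p, 0 ≤ w p) (hk0 : 0 ≤ k)
    (hi : ∀ y, Integrable (fun p => w p * inner ℝ p.1 y ^ 2) D)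
    (hk : ∀ y, ∫ p, w p * inner ℝ p.1 y ^ 2 ∂D ≤ k * form S y y) (x : Vec d) :
    ∫ p, (lossDeriv ℓ (inner ℝ p.1 x) p.2 - lossDeriv ℓ (inner ℝ p.1 xs) p.2) ^ 2 * w p ∂D
      ≤ 2 * Lℓ * (Lℓ / μℓ * k) * gap D ℓ xs x := by
  have hmp := hP.loss.mu_pos
  have hLp := hP.loss.L_pos
  have h1 : ∫ p, (lossDeriv ℓ (inner ℝ p.1 x) p.2 - lossDeriv ℓ (inner ℝ p.1 xs) p.2) ^ 2 * w p ∂D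
      ≤ ∫ p, Lℓ ^ 2 * (w p * inner ℝ p.1 (x - xs) ^ 2) ∂D := by
    refine integral_mono_of_nonneg (.of_forall fun p => mul_nonneg (sq_nonneg _) (hw p))
      ((hi _).const_mul _) (.of_forall fun p => ?_)
    have h2 := hP.loss.sq_sub_le (inner ℝ p.1 xs) (inner ℝ p.1 x) p.2
    have h3 := mul_le_mul_of_nonneg_right h2 (hw p)
    rw [← inner_sub_right] at h3
    refine h3.trans_eq ?_
    ring
  rw [integral_const_mul] at h1
  have h2 := mul_le_mul_of_nonneg_left (hk (x - xs)) (sq_nonneg Lℓ)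
  have h3 := mul_le_mul_of_nonneg_left (hP.form_sub_min_le x)
    (by positivity : 0 ≤ 2 * Lℓ * (Lℓ / μℓ * k))
  have h4 : 2 * Lℓ * (Lℓ / μℓ * k) * (μℓ / 2 * form S (x - xs) (x - xs))
      = Lℓ ^ 2 * (k * form S (x - xs) (x - xs)) := by field_simp
  linarith

end Problem

lemma LossCondition.one_le_ratio [Nonempty Y] (h : LossCondition ℓ Lℓ μℓ) : 1 ≤ Lℓ / μℓ := by
  obtain ⟨b⟩ := ‹Nonempty Y›
  rw [le_div_iff₀ h.mu_pos, one_mul]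
  exact (h.lower 0 b).trans (h.upper 0 b)

lemma trace_inv_smul_mul_gradMoment (h2 : SecondMomentCondition D) (hL : 0 < Lℓ)
    (hm : Measurable fun p : Vec d × Y => lossDeriv ℓ (inner ℝ p.1 xs) p.2)
    (hQ : Integrable (fun p => (lossDeriv ℓ (inner ℝ p.1 xs) p.2) ^ 2 * ‖p.1‖ ^ 2) D) :
    ((Lℓ • covMat D)⁻¹ * gradMoment D ℓ xs).trace
      = (∫ p, lossDeriv ℓ (inner ℝ p.1 xs) p.2 ^ 2 * form (opOf (covMat D)⁻¹) p.1 p.1 ∂D) / Lℓ := by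
  have h1 : (Lℓ • covMat D)⁻¹ = Lℓ⁻¹ • (covMat D)⁻¹ := by
    have : Invertible Lℓ := invertibleOfNonzero hL.ne'
    rw [Matrix.inv_smul _ _ h2.posDef.det_pos.ne'.isUnit, invOf_eq_inv]
  rw [h1, smul_mul, trace_smul, gradMoment, trace_mul_weightedMoment (hm.pow_const 2) hQ,
    smul_eq_mul, inv_mul_eq_div]

variable {Ω : Type v} [MeasurableSpace Ω] {P : Measure Ω} [IsProbabilityMeasure P]
  {ξ : ℕ → ℕ → Ω → Vec d × Y}

/-- The convergence guarantee in terms of the momentum parameter `θmax`, for any admissible noise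
constants `B` and `L`. -/
theorem risk_output_le [NeZero d] {R : ℝ} (h2 : SecondMomentCondition D)
    (hP : Problem D ℓ Lℓ μℓ xs (opOf (covMat D)) (opOf (covMat D)⁻¹) (lamMin (covMat D)) (R ^ 2) κt)
    {B L : ℝ} (hB0 : 0 ≤ B) (hL0 : 0 ≤ L) (hB : GradNoise2 D ℓ xs Lℓ B)
    (hL : GradNoiseInv D ℓ xs Lℓ L)
    (hξ : ∀ k t, Measurable (ξ k t)) (hlaw : ∀ k t, P.map (ξ k t) = D)
    (hind : iIndepFun (fun i : ℕ × ℕ => ξ i.1 i.2) P) (x0 : Vec d) {η : ℝ} (hη : 0 < η)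
    (hηR : η ≤ 1 / (16 * R ^ 2)) {K N : ℕ} (hK : 1 ≤ K) (hN : 1 ≤ N) (hN2 : Even N) {θmax : ℝ}
    (hlong : InnerLong 4000 D κt η θmax K N) (hθ0 : 0 < θmax) (hθ1 : θmax ≤ 1 / 100)
    (hθq : θmax ≤ 1 / 100 * (1 / Real.sqrt (Lℓ / μℓ)))
    (hθN : Lℓ / μℓ * effNoise L B κt η * θmax ≤ N / 12) :
    Integrable (fun ω => risk D ℓ (output D ℓ Lℓ μℓ κt η θmax K N x0 fun k t => ξ k t ω)) P ∧
    (∫ ω, risk D ℓ (output D ℓ Lℓ μℓ κt η θmax K N x0 fun k t => ξ k t ω) ∂P) - risk D ℓ xs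
      ≤ 3 / 2 * Real.exp (-(1 / 10 * (K * θmax))) * (risk D ℓ x0 - risk D ℓ xs)
        + 14784 * (Lℓ / μℓ) * ((Lℓ • covMat D)⁻¹ * gradMoment D ℓ xs).trace / (K * N)
        + 19008 * (Lℓ / μℓ) * η * κt * (gradMoment D ℓ xs).trace / (Lℓ * (K * N)) := by
  obtain ⟨n, rfl⟩ := hN2
  rw [← two_mul] at *
  have hn0 : (0 : ℝ) < n := by
    have : 0 < n := by omega
    exact_mod_cast this
  have hLp := hP.loss.L_pos
  have hmp := hP.loss.mu_pos
  have hκ := hP.design.one_le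
  have hκ0 : 0 < κt := by linarith
  have : Nonempty (Fin d) := ⟨0⟩
  have hpair := inversePair_of_posDef h2.posDef
  have hmu := hpair.mu_pos
  have hR : lamMin (covMat D) ≤ R ^ 2 := hP.design.pair.mu_le_lam
  have hR0 : 0 ≤ R ^ 2 := sq_nonneg R
  have hst := stepSizes_param hmu hR hκ hη hηR
  have hK0 : (0 : ℝ) < K := by exact_mod_cast hK
  obtain ⟨hn, hε⟩ := inner_length hmu hpair.mu_le_lam hκ hη hst.theta_le
    (thetaSched_pos hθ0 K) ((thetaSched_le hθ0 K).trans hθ1) hlong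
  have hθq' : θmax ^ 2 ≤ μℓ / Lℓ / 100 := by
    have h3 := pow_le_pow_left₀ hθ0.le hθq 2
    rw [mul_pow, div_pow, div_pow, Real.sq_sqrt (by positivity), one_pow, one_div_div] at h3
    have : 0 < μℓ / Lℓ := by positivity
    linarith
  have hηR' : η * R ^ 2 ≤ 1 / 16 := by linarith [hst.eta_R]
  have hN1 : 2 * (Lℓ / μℓ) * θmax * (6 / n * (7 * (L + κt) + 9 * η * κt * (B + R ^ 2)))
      ≤ 1 / 50 := by
    have h3 : 7 * (L + κt) + 9 * η * κt * (B + R ^ 2) ≤ effNoise L B κt η / 100 := by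
      have h4 := mul_le_mul_of_nonneg_left hηR' hκ0.le
      have h5 := mul_nonneg (mul_nonneg hκ0.le hη.le) hB0
      unfold effNoise
      linarith
    calc _ ≤ 2 * (Lℓ / μℓ) * θmax * (6 / n * (effNoise L B κt η / 100)) := by gcongr
      _ = 12 / 100 / n * (Lℓ / μℓ * effNoise L B κt η * θmax) := by ring
      _ ≤ 12 / 100 / n * ((2 * n : ℕ) / 12) := by gcongr
      _ = 1 / 50 := by push_cast; field_simp; norm_num
  obtain ⟨r1, r2⟩ := hP.integral_gap_outerIter_le hB (L := L)
    (fun x => by simpa only [form_opOf_self, gap] using hL x) hB0 hL0 hst hξ hlaw hind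
    hpair.mu_le_lam hpair.upper hn hK hθ0 hθ1 hθq' hε hN1 x0
  have hm := hP.measurable_lossDeriv_at xs
  have t1 := trace_inv_smul_mul_gradMoment h2 hLp hm hP.noise
  have t2 : (gradMoment D ℓ xs).trace = _ := trace_weightedMoment (hm.pow_const 2) hP.noise
  have r3 : Integrable (fun ω => risk D ℓ
      (output D ℓ Lℓ μℓ κt η θmax K (2 * n) x0 fun k t => ξ k t ω)) P := by
    have := r1.add (integrable_const (risk D ℓ xs))
    refine this.congr (.of_forall fun ω => ?_)
    simp [gap, output]
  refine ⟨r3, ?_⟩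
  have r4 : (∫ ω, risk D ℓ (output D ℓ Lℓ μℓ κt η θmax K (2 * n) x0 fun k t => ξ k t ω) ∂P)
      - risk D ℓ xs = ∫ ω, gap D ℓ xs (output D ℓ Lℓ μℓ κt η θmax K (2 * n) x0
        fun k t => ξ k t ω) ∂P := by
    simp only [gap]
    rw [integral_sub r3 (integrable_const _), integral_const, probReal_univ, one_smul]
  rw [r4]
  refine r2.trans (le_of_eq ?_)
  rw [t1, t2, gap]
  push_cast
  field_simp
  ring

end Final

end SADA

end

theorem theorem1 :
    ∃ c₂ > (0 : ℝ), ∃ CT > (0 : ℝ), ∀ c₁ > (0 : ℝ), ∃ c₀ > (0 : ℝ), ∃ C > (0 : ℝ),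
    ∀ (d : ℕ) (_ : 0 < d) (Y : Type u) [MeasurableSpace Y]
      (D : Measure (SADA.Vec d × Y)) [IsProbabilityMeasure D]
      (ℓ : ℝ → Y → ℝ) (_ : Measurable fun q : ℝ × Y => ℓ q.1 q.2)
      (Lℓ μℓ R κt : ℝ) (xs : SADA.Vec d)
      (_ : SADA.LossCondition ℓ Lℓ μℓ)
      (_ : SADA.SecondMomentCondition D)
      (_ : SADA.FourthMomentCondition D R κt)
      -- the risk is well defined, `xs` minimises it, and `Q` is finite
      (_ : ∀ x : SADA.Vec d, Integrable (fun p => ℓ (inner ℝ p.1 x) p.2) D)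
      (_ : ∀ x : SADA.Vec d, SADA.risk D ℓ xs ≤ SADA.risk D ℓ x)
      (_ : Integrable
        (fun p => (SADA.lossDeriv ℓ (inner ℝ p.1 xs) p.2) ^ 2 * ‖p.1‖ ^ 2) D)
      -- fresh samples: independent, with common law `D`
      (Ω : Type v) [MeasurableSpace Ω] (P : Measure Ω) [IsProbabilityMeasure P]
      (ξ : ℕ → ℕ → Ω → SADA.Vec d × Y)
      (_ : ∀ k t, Measurable (ξ k t))
      (_ : ∀ k t, P.map (ξ k t) = D)
      (_ : iIndepFun (fun i : ℕ × ℕ => ξ i.1 i.2) P)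
      -- initial point and hyperparameters
      (x0 : SADA.Vec d) (η : ℝ) (_ : 0 < η) (_ : η ≤ 1 / (16 * R ^ 2))
      (K T : ℕ) (_ : 1 ≤ K) (_ : 1 ≤ T) (_ : Even T) (θmax : ℝ)
      (_ : SADA.InnerLong CT D κt η θmax K T),
    -- the bound in terms of the data
    (c₁ * min (1 / Real.sqrt (Lℓ / μℓ)) (T / ((Lℓ / μℓ) ^ 2 * κt)) ≤ θmax →
      θmax ≤ c₂ * min (1 / Real.sqrt (Lℓ / μℓ)) (T / ((Lℓ / μℓ) ^ 2 * κt)) →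
      Integrable (fun ω => SADA.risk D ℓ
        (SADA.output D ℓ Lℓ μℓ κt η θmax K T x0 fun k t => ξ k t ω)) P ∧
      (∫ ω, SADA.risk D ℓ (SADA.output D ℓ Lℓ μℓ κt η θmax K T x0 fun k t => ξ k t ω) ∂P)
          - SADA.risk D ℓ xs
        ≤ C * (Real.exp (-(c₀ * K / (Real.sqrt (Lℓ / μℓ) + (Lℓ / μℓ) ^ 2 * κt / T)))
              * (SADA.risk D ℓ x0 - SADA.risk D ℓ xs)
            + (Lℓ / μℓ) * ((Lℓ • SADA.covMat D)⁻¹ * SADA.gradMoment D ℓ xs).trace / (K * T)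
            + (Lℓ / μℓ) * η * κt * (SADA.gradMoment D ℓ xs).trace / (Lℓ * (K * T)))) ∧
    -- the bound in terms of the generalized noise constants
    (∀ B > (0 : ℝ), ∀ L > (0 : ℝ), SADA.GradNoise2 D ℓ xs Lℓ B → SADA.GradNoiseInv D ℓ xs Lℓ L →
      c₁ * min (1 / Real.sqrt (Lℓ / μℓ)) (T / ((Lℓ / μℓ) * SADA.effNoise L B κt η)) ≤ θmax →
      θmax ≤ c₂ * min (1 / Real.sqrt (Lℓ / μℓ)) (T / ((Lℓ / μℓ) * SADA.effNoise L B κt η)) →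
      Integrable (fun ω => SADA.risk D ℓ
        (SADA.output D ℓ Lℓ μℓ κt η θmax K T x0 fun k t => ξ k t ω)) P ∧
      (∫ ω, SADA.risk D ℓ (SADA.output D ℓ Lℓ μℓ κt η θmax K T x0 fun k t => ξ k t ω) ∂P)
          - SADA.risk D ℓ xs
        ≤ 5 / 3 * Real.exp (-(c₀ * K / (Real.sqrt (Lℓ / μℓ)
                  + (Lℓ / μℓ) * SADA.effNoise L B κt η / T)))
              * (SADA.risk D ℓ x0 - SADA.risk D ℓ xs)
            + 46080 * (Lℓ / μℓ) * ((Lℓ • SADA.covMat D)⁻¹ * SADA.gradMoment D ℓ xs).trace / (K * T)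
            + 122880 * (Lℓ / μℓ) * η * κt * (SADA.gradMoment D ℓ xs).trace / (Lℓ * (K * T))) := by
  -- `c₂` must beat the factor `2240` between `α κt` and the effective noise in the first bound;
  -- the rate `c₁ / 10` is the contraction `3 / 10` per step times the fraction `1 / 3` of the
  -- schedule that is spent at `θmax`
  refine ⟨1 / 100000, by norm_num, 4000, by norm_num, fun c₁ hc₁ => ⟨c₁ / 10, by positivity,
    122880, by norm_num, ?_⟩⟩
  intro d hd Y _ D _ ℓ hℓ Lℓ μℓ R κt xs hloss h2 h4 hint hmin hQ Ω _ P _ ξ hξ hlaw hind x0 η hη hηR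
    K N hK hN hN2 θmax hlong
  have : NeZero d := ⟨hd.ne'⟩
  have hP : SADA.Problem D ℓ Lℓ μℓ xs (SADA.opOf (SADA.covMat D)) (SADA.opOf (SADA.covMat D)⁻¹)
      (SADA.lamMin (SADA.covMat D)) (R ^ 2) κt :=
    ⟨SADA.design_of_moments h2 h4, hloss, hℓ, hint, hmin, hQ⟩
  have : Nonempty Y := (nonempty_of_isProbabilityMeasure D).map Prod.snd
  have hα := hloss.one_le_ratio
  have hLp := hloss.L_pos
  have hmp := hloss.mu_pos
  have hκ := hP.design.one_le
  have hκ0 : 0 < κt := by linarith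
  have hK0 : (0 : ℝ) < K := by exact_mod_cast hK
  have hN0 : (0 : ℝ) < N := by exact_mod_cast hN
  have : Nonempty (Fin d) := ⟨0⟩
  have hR2 : 0 < R ^ 2 := hP.design.pair.mu_pos.trans_le hP.design.pair.mu_le_lam
  have hm := hP.measurable_lossDeriv_at xs
  set α := Lℓ / μℓ with hαd
  have hα0 : 0 < α := by positivity
  have hsα : 1 ≤ Real.sqrt α := Real.one_le_sqrt.2 hα
  have hu1 : 1 / Real.sqrt α ≤ 1 := by
    rw [div_le_one (by positivity)]; exact hsα
  set u := Real.sqrt α with hu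
  have hu0 : 0 < u := by linarith
  set tH := ((Lℓ • SADA.covMat D)⁻¹ * SADA.gradMoment D ℓ xs).trace with htH
  set tQ := (SADA.gradMoment D ℓ xs).trace with htQ
  have htH0 : 0 ≤ tH := by
    rw [htH, SADA.trace_inv_smul_mul_gradMoment h2 hLp hm hQ]
    exact div_nonneg (integral_nonneg fun p =>
      mul_nonneg (sq_nonneg _) (hP.design.pair.inv_nonneg _)) hLp.le
  have htQ0 : 0 ≤ tQ := by
    rw [htQ, SADA.gradMoment, SADA.trace_weightedMoment (hm.pow_const 2) hQ]
    exact integral_nonneg fun p => mul_nonneg (sq_nonneg _) (sq_nonneg _)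
  set g0 := SADA.risk D ℓ x0 - SADA.risk D ℓ xs with hg0
  have hg00 : 0 ≤ g0 := sub_nonneg.2 (hmin x0)
  -- the two noise terms and the optimisation term of the general bound
  have hA : 0 ≤ α * tH / (K * N) := by positivity
  have hB : 0 ≤ α * η * κt * tQ / (Lℓ * (K * N)) := by positivity
  have e1 : ∀ c : ℝ, c * α * tH / (K * N) = c * (α * tH / (K * N)) := fun c => by ring
  have e2 : ∀ c : ℝ, c * α * η * κt * tQ / (Lℓ * (K * N))
      = c * (α * η * κt * tQ / (Lℓ * (K * N))) := fun c => by ring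
  constructor
  · intro hlo hhi
    set m := min (1 / u) (N / (α ^ 2 * κt)) with hm'
    have hm0 : 0 < m := by positivity
    have hθ0 : 0 < θmax := lt_of_lt_of_le (by positivity) hlo
    have hm1 : m ≤ 1 / u := min_le_left _ _
    have hm2 : m ≤ N / (α ^ 2 * κt) := min_le_right _ _
    -- the fourth-moment constants bound the gradient noise up to a factor `α`
    have hn2 : SADA.GradNoise2 D ℓ xs Lℓ (α * R ^ 2) := fun x =>
      hP.noise_sub_le (w := fun p => ‖p.1‖ ^ 2) (fun p => sq_nonneg _) hR2.le
        (fun y => by simpa only [mul_comm] using hP.integrable_inner_sq_mul y)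
        hP.design.bound x
    have hni : SADA.GradNoiseInv D ℓ xs Lℓ (α * κt) := fun x => by
      simp only [← SADA.form_opOf_self]
      exact hP.noise_sub_le (w := fun p => SADA.form (SADA.opOf (SADA.covMat D)⁻¹) p.1 p.1)
        (fun p => hP.design.pair.inv_nonneg _) hκ0.le
        (fun y => SADA.integrable_form_mul _ (by fun_prop) (hP.integrable_inner_sq_mul y))
        hP.design.boundInv x
    have hηR' : η * R ^ 2 ≤ 1 / 16 := by
      rw [le_div_iff₀ (by positivity)] at hηR
      linarith
    have heff : SADA.effNoise (α * κt) (α * R ^ 2) κt η ≤ 2240 * α * κt := by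
      have h3 := mul_le_mul_of_nonneg_left hηR' (mul_pos hα0 hκ0).le
      have h5 := mul_le_mul_of_nonneg_right hα hκ0.le
      unfold SADA.effNoise
      linarith
    have hθN : α * SADA.effNoise (α * κt) (α * R ^ 2) κt η * θmax ≤ N / 12 := by
      have h3 : θmax ≤ 1 / 100000 * (N / (α ^ 2 * κt)) := hhi.trans (by gcongr)
      calc α * SADA.effNoise (α * κt) (α * R ^ 2) κt η * θmax
          ≤ α * (2240 * α * κt) * (1 / 100000 * (N / (α ^ 2 * κt))) := by gcongr
        _ = 2240 / 100000 * N := by field_simp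
        _ ≤ N / 12 := by linarith
    obtain ⟨r1, r2⟩ := SADA.risk_output_le h2 hP (by positivity) (by positivity) hn2 hni hξ hlaw hind
      x0 hη hηR hK hN hN2 hlong hθ0 (by linarith) (by linarith) hθN
    refine ⟨r1, r2.trans ?_⟩
    have h3 := SADA.exp_rate_le hc₁ hu0 (w := α ^ 2 * κt / N) (by positivity) hK0.le
      (one_div_div _ _).symm hlo
    have h5 := mul_le_mul_of_nonneg_right h3 hg00
    have h6 := mul_nonneg (Real.exp_pos (-(c₁ / 10 * K / (u + α ^ 2 * κt / N)))).le hg00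
    rw [e1, e2]
    linarith
  · intro B hB0 L hL0 hnB hnL hlo hhi
    have heff : 0 < SADA.effNoise L B κt η := by unfold SADA.effNoise; positivity
    set Leff := SADA.effNoise L B κt η with hLeff
    set m := min (1 / u) (N / (α * Leff)) with hm'
    have hm0 : 0 < m := by positivity
    have hθ0 : 0 < θmax := lt_of_lt_of_le (by positivity) hlo
    have hm1 : m ≤ 1 / u := min_le_left _ _
    have hm2 : m ≤ N / (α * Leff) := min_le_right _ _
    have hθN : α * Leff * θmax ≤ N / 12 := by
      have h3 : θmax ≤ 1 / 100000 * (N / (α * Leff)) := hhi.trans (by gcongr)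
      calc α * Leff * θmax ≤ α * Leff * (1 / 100000 * (N / (α * Leff))) := by gcongr
        _ = 1 / 100000 * N := by field_simp
        _ ≤ N / 12 := by linarith
    obtain ⟨r1, r2⟩ := SADA.risk_output_le h2 hP hB0.le hL0.le hnB hnL hξ hlaw hind
      x0 hη hηR hK hN hN2 hlong hθ0 (by linarith) (by linarith) hθN
    refine ⟨r1, r2.trans ?_⟩
    have h3 := SADA.exp_rate_le hc₁ hu0 (w := α * Leff / N) (by positivity) hK0.le
      (one_div_div _ _).symm hlo
    have h5 := mul_le_mul_of_nonneg_right h3 hg00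
    have h6 := mul_nonneg (Real.exp_pos (-(c₁ / 10 * K / (u + α * Leff / N)))).le hg00
    rw [e1, e2, e1, e2]
    linarith
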